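/- **Theorem 1.6.** For $n\ge 1$ let $K_n$ be the transition matrix of an irreducible birth and death chain $(X^{(n)}_m)_{m\ge 0}$ on $\mathcal X_n=\{0,1,\dots,n\}$ (that is, $K_n$ is an irreducible stochastic matrix with $K_n(i,j)=0$ whenever $|i-j|>1$), with stationary distribution $\pi_n$, and let $\lambda_n$ be the smallest non-zero eigenvalue of $I-K_n$. Let $N_t$ be a Poisson process of parameter $1$ independent of $(X^{(n)}_m)$, and set $$\tau^{(n)}_i=\inf\{m\ge 0: X^{(n)}_m=i\},\qquad \widetilde\tau^{(n)}_i=\inf\{t\ge 0: X^{(n)}_{N_t}=i\};$$ $\mathbb E_j$ and $\mathrm{Var}_j$ denote expectation and variance given $X^{(n)}_0=j$. Let $M_n\in\mathcal X_n$ satisfy $$\inf_{n\ge1}\pi_n([0,M_n])>0,\qquad \inf_{n\ge1}\pi_n([M_n,n])>0 .$$ The hitting times of $M_n$ from $0$ and from $n$ are almost surely finite with finite second moment, and one may set $$\theta_n=\max\{\mathbb E_0\tau^{(n)}_{M_n},\mathbb E_n\tau^{(n)}_{M_n}\}=\max\{\mathbb E_0\widetilde\tau^{(n)}_{M_n},\mathbb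 E_n\widetilde\tau^{(n)}_{M_n}\},$$ $$\alpha_n^2=\max\{\mathrm{Var}_0\widetilde\tau^{(n)}_{M_n},\mathrm{Var}_n\widetilde\tau^{(n)}_{M_n}\},\qquad \beta_n^2=\max\{\mathrm{Var}_0\tau^{(n)}_{M_n},\mathrm{Var}_n\tau^{(n)}_{M_n}\},\qquad \alpha_n,\beta_n\ge0.$$ For probabilities $\mu,\nu$ on $\mathcal X_n$ let $\|\mu-\nu\|_{TV}=\max_{A\subset\mathcal X_n}(\mu(A)-\nu(A))$. For $\epsilon\in(0,1)$ let $T_n(\epsilon)=\min\{m\in\mathbb Z_{\ge0}:\max_x\|K_n^m(x,\cdot)-\pi_n\|_{TV}\le\epsilon\}$ and $T^{(c)}_n(\epsilon)=\min\{t\ge 0:\max_x\|e^{-t(I-K_n)}(x,\cdot)-\pi_n\|_{TV}\le\epsilon\}$ be the maximum total variation mixing times in discrete and continuous time. A family with mixing times $S_n(\epsilon)$ has a *cutoff* if there are $t_n>0$ (integers in discrete time, reals in continuous time) with $S_n(\epsilon)/t_n\to1$ for every $\epsilon\in(0,1)$; it has a *$(t_n,b_n)$ cutoff* if $t_n>0$,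 $b_n>0$, $b_n/t_n\to0$ and $\limsup_n|S_n(\epsilon)-t_n|/b_n<\infty$ for every $\epsilon\in(0,1)$. Let $\mathcal F$ be the family of the discrete time chains (mixing times $T_n$) and $\mathcal F_c$ the family of the associated continuous time chains (mixing times $T_n^{(c)}$). 1. $\mathcal F_c$ has a cutoff if and only if $\theta_n\lambda_n\to\infty$, if and only if $\theta_n/\alpha_n\to\infty$. Furthermore, if $\mathcal F_c$ has a cutoff, then it has a $(\theta_n,\alpha_n)$ cutoff. 2. Assume $\inf_{i,n}K_n(i,i)>0$. Then $\mathcal F$ has a cutoff if and only if $\theta_n\lambda_n\to\infty$, if and only if $\theta_n/\beta_n\to\infty$. Furthermore, if $\mathcal F$ has a cutoff, then it has a $(\theta_n,\beta_n)$ cutoff. -/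

import Mathlib

open MeasureTheory ProbabilityTheory Filter Topology

noncomputable section

namespace BDCutoff

/-! ### Birth and death chains on `{0, 1, ..., n}` -/

/-- An irreducible birth and death chain on `{0, 1, ..., n}`, given by its transition matrix:
a stochastic matrix whose only possibly nonzero entries are `K(i, i+1)` (birth rates),
`K(i, i-1)` (death rates) and `K(i, i)` (holding rates), and which is irreducible. -/
structure BirthDeathChain (n : ℕ) where
  /-- the transition matrix -/
  K : Matrix (Fin (n + 1)) (Fin (n + 1)) ℝ
  nonneg : ∀ i j, 0 ≤ K i j
  row_sum : ∀ i, ∑ j, K i j = 1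
  nearest : ∀ i j : Fin (n + 1), (i : ℕ) + 1 < j ∨ (j : ℕ) + 1 < i → K i j = 0
  irreducible : K.IsIrreducible

variable {n : ℕ}

/-- `π` is a stationary distribution of the transition matrix `K`. -/
structure IsStationary (K : Matrix (Fin (n + 1)) (Fin (n + 1)) ℝ) (π : Fin (n + 1) → ℝ) :
    Prop where
  nonneg : ∀ i, 0 ≤ π i
  sum_one : ∑ i, π i = 1
  stationary : Matrix.vecMul π K = π

/-- The smallest nonzero eigenvalue of `I - K`. -/
def spectralGap (K : Matrix (Fin (n + 1)) (Fin (n + 1)) ℝ) : ℝ :=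
  sInf {μ : ℝ | μ ≠ 0 ∧ Module.End.HasEigenvalue (Matrix.toLin' (1 - K)) μ}

/-! ### Total variation distance to stationarity and mixing times -/

/-- Total variation distance `max_A (μ(A) - ν(A))`, probabilities being given by their weights. -/
def tvDist (μ ν : Fin (n + 1) → ℝ) : ℝ :=
  ⨆ A : Finset (Fin (n + 1)), (∑ x ∈ A, μ x - ∑ x ∈ A, ν x)

/-- The transition function `H_t = exp(-t (I - K))` of the associated continuous time chain. -/
def heat (K : Matrix (Fin (n + 1)) (Fin (n + 1)) ℝ) (t : ℝ) :
    Matrix (Fin (n + 1)) (Fin (n + 1)) ℝ :=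
  NormedSpace.exp (-t • (1 - K))

/-- Maximum (over the initial state) total variation distance at the discrete time `m`. -/
def maxTV (K : Matrix (Fin (n + 1)) (Fin (n + 1)) ℝ) (π : Fin (n + 1) → ℝ) (m : ℕ) : ℝ :=
  ⨆ x : Fin (n + 1), tvDist ((K ^ m) x) π

/-- Maximum (over the initial state) total variation distance at the continuous time `t`. -/
def maxTVc (K : Matrix (Fin (n + 1)) (Fin (n + 1)) ℝ) (π : Fin (n + 1) → ℝ) (t : ℝ) : ℝ :=
  ⨆ x : Fin (n + 1), tvDist (heat K t x) π

/-- Discrete time mixing time in maximum total variation. -/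
def mixTime (K : Matrix (Fin (n + 1)) (Fin (n + 1)) ℝ) (π : Fin (n + 1) → ℝ) (ε : ℝ) : ℕ :=
  sInf {m : ℕ | maxTV K π m ≤ ε}

/-- Continuous time mixing time in maximum total variation. -/
def mixTimec (K : Matrix (Fin (n + 1)) (Fin (n + 1)) ℝ) (π : Fin (n + 1) → ℝ) (ε : ℝ) : ℝ :=
  sInf {t : ℝ | 0 ≤ t ∧ maxTVc K π t ≤ ε}

/-! ### Cutoffs

Families are indexed by `n ≥ 1`; `T n ε` is the mixing time of the `n`-th chain. -/

/-- Cutoff of a family of discrete time chains (the cutoff times are positive integers). -/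
def HasCutoff (T : ℕ → ℝ → ℕ) : Prop :=
  ∃ t : ℕ → ℕ, (∀ n, 1 ≤ n → 0 < t n) ∧
    ∀ ε ∈ Set.Ioo (0 : ℝ) 1, Tendsto (fun n => (T n ε : ℝ) / (t n : ℝ)) atTop (𝓝 1)

/-- Cutoff of a family of continuous time chains (the cutoff times are positive reals). -/
def HasCutoffc (T : ℕ → ℝ → ℝ) : Prop :=
  ∃ t : ℕ → ℝ, (∀ n, 1 ≤ n → 0 < t n) ∧
    ∀ ε ∈ Set.Ioo (0 : ℝ) 1, Tendsto (fun n => T n ε / t n) atTop (𝓝 1)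

/-- The quantitative condition in a `(t_n, b_n)` cutoff: `t_n > 0`, `b_n > 0`, `b_n / t_n → 0`, and
`limsup |T_n(ε) - t_n| / b_n < ∞` for every `ε ∈ (0, 1)`. -/
def HasWindow (T : ℕ → ℝ → ℝ) (t b : ℕ → ℝ) : Prop :=
  (∀ n, 1 ≤ n → 0 < t n ∧ 0 < b n) ∧
    Tendsto (fun n => b n / t n) atTop (𝓝 0) ∧
    ∀ ε ∈ Set.Ioo (0 : ℝ) 1, ∃ C : ℝ, ∀ᶠ n in atTop, |T n ε - t n| / b n ≤ C

/-! ### The Markov chain, the Poisson process and the hitting times -/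

/-- The one-step transition kernel of the chain. -/
def stepKernel (C : BirthDeathChain n) : Kernel (Fin (n + 1)) (Fin (n + 1)) :=
  Kernel.ofFunOfCountable fun x => ∑ y, ENNReal.ofReal (C.K x y) • Measure.dirac y

instance (C : BirthDeathChain n) : IsMarkovKernel (stepKernel C) := by
  refine ⟨fun x => ⟨?_⟩⟩
  change (∑ y, ENNReal.ofReal (C.K x y) • Measure.dirac y) Set.univ = 1
  simp only [Measure.coe_finsetSum, Finset.sum_apply, Measure.smul_apply, measure_univ,
    smul_eq_mul, mul_one]
  rw [← ENNReal.ofReal_sum_of_nonneg fun y _ => C.nonneg x y, C.row_sum, ENNReal.ofReal_one]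

/-- The kernel giving the state at time `m + 1` from the trajectory up to time `m`: it depends on
the state at time `m` only. -/
def historyKernel (C : BirthDeathChain n) (m : ℕ) :
    Kernel ((i : Finset.Iic m) → (fun _ : ℕ => Fin (n + 1)) i) (Fin (n + 1)) :=
  (stepKernel C).comap (fun h => h ⟨m, Finset.mem_Iic.2 le_rfl⟩) (measurable_pi_apply _)

instance (C : BirthDeathChain n) (m : ℕ) : IsMarkovKernel (historyKernel C m) := by
  unfold historyKernel; infer_instance

/-- The law, on the space of trajectories `ℕ → {0, ..., n}`, of the discrete time Markov chain
`(X_m)` with transition matrix `K` and initial state `x`. -/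
def chainLaw (C : BirthDeathChain n) (x : Fin (n + 1)) : Measure (ℕ → Fin (n + 1)) :=
  Kernel.traj (X := fun _ => Fin (n + 1)) (historyKernel C) 0 (fun _ => x)

/-- The law of a sequence of independent exponential variables of parameter `1`
(the interarrival times of the Poisson process). -/
def clockLaw : Measure (ℕ → ℝ) := Measure.infinitePi fun _ => expMeasure 1

/-- The Poisson process of parameter `1` with interarrival times `ξ`: `N_t` is the number of
arrival times `ξ_0 + ... + ξ_k` in `[0, t]`. -/
def poissonProcess (ξ : ℕ → ℝ) (t : ℝ) : ℕ :=
  Set.ncard {k : ℕ | ∑ l ∈ Finset.range (k + 1), ξ l ≤ t}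

/-- The joint law of the chain started at `x` and of an independent Poisson clock. -/
def jointLaw (C : BirthDeathChain n) (x : Fin (n + 1)) :
    Measure ((ℕ → Fin (n + 1)) × (ℕ → ℝ)) :=
  (chainLaw C x).prod clockLaw

/-- The hitting time `τ_i = inf {m ≥ 0 | X_m = i}`. -/
def hit (i : Fin (n + 1)) (X : ℕ → Fin (n + 1)) : ℝ :=
  ((sInf {m : ℕ | X m = i} : ℕ) : ℝ)

/-- The hitting time `τ̃_i = inf {t ≥ 0 | X_{N_t} = i}`. -/
def hitc (i : Fin (n + 1)) (ω : (ℕ → Fin (n + 1)) × (ℕ → ℝ)) : ℝ :=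
  sInf {t : ℝ | 0 ≤ t ∧ ω.1 (poissonProcess ω.2 t) = i}

/-- `max {E_0 τ_i, E_n τ_i}`. -/
def theta (C : BirthDeathChain n) (i : Fin (n + 1)) : ℝ :=
  max (∫ X, hit i X ∂(chainLaw C 0)) (∫ X, hit i X ∂(chainLaw C (Fin.last n)))

/-- `max {E_0 τ̃_i, E_n τ̃_i}`. -/
def thetac (C : BirthDeathChain n) (i : Fin (n + 1)) : ℝ :=
  max (∫ ω, hitc i ω ∂(jointLaw C 0)) (∫ ω, hitc i ω ∂(jointLaw C (Fin.last n)))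

/-- `α`, where `α ^ 2 = max {Var_0 τ̃_i, Var_n τ̃_i}`. -/
def alpha (C : BirthDeathChain n) (i : Fin (n + 1)) : ℝ :=
  √(max (variance (hitc i) (jointLaw C 0)) (variance (hitc i) (jointLaw C (Fin.last n))))

/-- `β`, where `β ^ 2 = max {Var_0 τ_i, Var_n τ_i}`. -/
def beta (C : BirthDeathChain n) (i : Fin (n + 1)) : ℝ :=
  √(max (variance (hit i) (chainLaw C 0)) (variance (hit i) (chainLaw C (Fin.last n))))

/-- The hitting times of `i` by both chains started at `x` are almost surely finite, and are
square integrable (so that their means and variances are meaningful). -/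
def HitRegular (C : BirthDeathChain n) (x i : Fin (n + 1)) : Prop :=
  (∀ᵐ X ∂(chainLaw C x), ∃ m, X m = i) ∧
  (∀ᵐ ω ∂(jointLaw C x), ∃ t, 0 ≤ t ∧ ω.1 (poissonProcess ω.2 t) = i) ∧
  MemLp (hit i) 2 (chainLaw C x) ∧
  MemLp (hitc i) 2 (jointLaw C x)

end BDCutoff

end

/-! Write θ and α² for the larger mean and variance of the continuous time hitting times of M from
the two ends, λ for the gap, and let c bound π[0,M] and π[M,n] from below. The theorem follows from
estimates uniform over all such chains: (a) the mixing time at level ε differs from θ by at most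
D(c,ε)·α (`abs_mixTimec_sub_le`, and `abs_mixTime_sub_le` with D depending also on the holding
probability); (b) 1 ≤ λα (`IsBD.one_le_spectralGap_mul`) and cλα² ≤ 2θ (`IsBD.mul_hitVar_le`); (c)
the distance to equilibrium dominates half the decay of a gap eigenfunction. By (b), θλ ≥ θ/α and
(θ/α)² ≥ (c/2)θλ, so the two criteria agree, and then (a) is a (θ,α) cutoff. Conversely, by (c) the
mixing time at small ε is at least a large multiple of 1/λ; under a cutoff it is comparable with the
one at 1/4, which is at most θ + Dα. So λθ + Dλα is large, and (b) makes λθ large. This deduction is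
abstracted in `CutoffData`.

For (b), the hitting time variance has a closed form in conductances. It is the squared
Hilbert-Schmidt norm of the kernel of a Hardy inequality (`IsBD.hardy`), whence a Poincaré
inequality with constant 1/α (`IsBD.poincare_of_upVar`). In the other direction, equilibrium
potentials as test functions bound effective resistances by 1/λ (`IsBD.mul_resist_le`), and the
variance is a sum of passage means times such resistances.

Upper bound in (a): by Chebyshev the chain reaches M within θ + O(α), and then any fixed z in a
stretch [M,w] of mass at least c/2 within O(1/λ) = O(α) more. The time of arrival at z is random, so
the orbit K^k g must be small at z for all remaining times k at once. An L² maximal inequality for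
chains with holding (`IsReversible.exists_maximal`) gives this on average over z in [M,w]
(`IsBD.orbit_le_of_mixing`). Lower bound: before reaching a low quantile z the chain started at the
end sits in a set of small weight, and stopping at z instead of M costs only O(1/λ) in the mean
(`IsBD.orbit_le_of_early`).

Continuous time is a Poisson average of discrete time. Since θ ≤ α², the Poisson fluctuations are
O(α). Holding is not an assumption there, because the same semigroup comes from the half-lazy chain
at doubled time. In discrete time the variance is the continuous one minus the mean, and holding
probability δ keeps it at least δ times the continuous one.

The moments are tied to the closed forms through survival probabilities: they are the series of P(τ
> k) and (2k+1)P(τ > k), summed by first-step recursions. -/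

noncomputable section

namespace BDCutoff

/-! ### Reversible chains on a finite set -/

section Reversible

variable {ι : Type*} [Fintype ι]

/-- `K` is a stochastic matrix, reversible with respect to the probability weights `π`. -/
structure IsReversible (K : Matrix ι ι ℝ) (π : ι → ℝ) : Prop where
  nonneg : ∀ x y, 0 ≤ K x y
  row_sum : ∀ x, ∑ y, K x y = 1
  weight_nonneg : ∀ x, 0 ≤ π x
  weight_sum : ∑ x, π x = 1
  balance : ∀ x y, π x * K x y = π y * K y x

/-- The inner product of `L²(π)`. -/
def wInner (π f g : ι → ℝ) : ℝ := ∑ x, π x * (f x * g x)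

/-- The Dirichlet form of `K`. -/
def dirichlet (K : Matrix ι ι ℝ) (π f : ι → ℝ) : ℝ := wInner π (f - K.mulVec f) f

/-- The Poincaré inequality with constant `lam`. -/
def Poincare (K : Matrix ι ι ℝ) (π : ι → ℝ) (lam : ℝ) : Prop :=
  ∀ f : ι → ℝ, ∑ x, π x * f x = 0 → lam * wInner π f f ≤ dirichlet K π f

variable {K : Matrix ι ι ℝ} {π : ι → ℝ}

lemma wInner_comm (f g : ι → ℝ) : wInner π f g = wInner π g f := by
  simp only [wInner, mul_comm]

lemma wInner_sub_left (f g h : ι → ℝ) : wInner π (f - g) h = wInner π f h - wInner π g h := by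
  simp only [wInner, Pi.sub_apply, ← Finset.sum_sub_distrib]
  exact Finset.sum_congr rfl fun _ _ => by ring

lemma wInner_add_left (f g h : ι → ℝ) : wInner π (f + g) h = wInner π f h + wInner π g h := by
  simp only [wInner, Pi.add_apply, ← Finset.sum_add_distrib]
  exact Finset.sum_congr rfl fun _ _ => by ring

lemma wInner_sub_right (f g h : ι → ℝ) : wInner π f (g - h) = wInner π f g - wInner π f h := by
  rw [wInner_comm, wInner_sub_left, wInner_comm g, wInner_comm h]

lemma wInner_self_nonneg (hπ : ∀ x, 0 ≤ π x) (f : ι → ℝ) : 0 ≤ wInner π f f :=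
  Finset.sum_nonneg fun x _ => mul_nonneg (hπ x) (mul_self_nonneg _)

namespace IsReversible

variable (h : IsReversible K π)
include h

lemma sum_weight_mul (y : ι) : ∑ x, π x * K x y = π y := by
  simp_rw [h.balance _ y, ← Finset.mul_sum, h.row_sum, mul_one]

lemma sum_mulVec (f : ι → ℝ) : ∑ x, π x * K.mulVec f x = ∑ x, π x * f x := by
  simp only [Matrix.mulVec, dotProduct, Finset.mul_sum]
  rw [Finset.sum_comm]
  refine Finset.sum_congr rfl fun y _ => ?_
  rw [← h.sum_weight_mul y, Finset.sum_mul]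
  exact Finset.sum_congr rfl fun _ _ => by ring

lemma wInner_mulVec_left (f g : ι → ℝ) : wInner π (K.mulVec f) g = wInner π f (K.mulVec g) := by
  simp only [wInner, Matrix.mulVec, dotProduct, Finset.mul_sum, Finset.sum_mul]
  rw [Finset.sum_comm]
  refine Finset.sum_congr rfl fun y _ => Finset.sum_congr rfl fun x _ => ?_
  linear_combination (f y * g x) * h.balance x y

lemma wInner_self_eq_left (f : ι → ℝ) :
    wInner π f f = ∑ x, ∑ y, π x * K x y * f x ^ 2 := by
  simp_rw [wInner, ← Finset.sum_mul, ← Finset.mul_sum, h.row_sum]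
  exact Finset.sum_congr rfl fun _ _ => by ring

lemma wInner_self_eq_right (f : ι → ℝ) :
    wInner π f f = ∑ x, ∑ y, π x * K x y * f y ^ 2 := by
  rw [Finset.sum_comm]
  simp_rw [wInner, ← Finset.sum_mul, h.sum_weight_mul]
  exact Finset.sum_congr rfl fun _ _ => by ring

omit h in
lemma wInner_mulVec_self (f : ι → ℝ) :
    wInner π (K.mulVec f) f = ∑ x, ∑ y, π x * K x y * (f x * f y) := by
  simp only [wInner, Matrix.mulVec, dotProduct, Finset.mul_sum, Finset.sum_mul]
  exact Finset.sum_congr rfl fun _ _ => Finset.sum_congr rfl fun _ _ => by ring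

lemma dirichlet_eq (f : ι → ℝ) :
    dirichlet K π f = 1 / 2 * ∑ x, ∑ y, π x * K x y * (f x - f y) ^ 2 := by
  have h1 := h.wInner_self_eq_left f
  have h2 := h.wInner_self_eq_right f
  have h3 := wInner_mulVec_self (K := K) (π := π) f
  have : ∑ x, ∑ y, π x * K x y * (f x - f y) ^ 2 =
      ∑ x, ∑ y, π x * K x y * f x ^ 2 + ∑ x, ∑ y, π x * K x y * f y ^ 2
        - 2 * ∑ x, ∑ y, π x * K x y * (f x * f y) := by
    simp only [Finset.mul_sum, ← Finset.sum_add_distrib, ← Finset.sum_sub_distrib]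
    exact Finset.sum_congr rfl fun _ _ => Finset.sum_congr rfl fun _ _ => by ring
  rw [dirichlet, wInner_sub_left, this]; linarith

lemma wInner_add_mulVec (f : ι → ℝ) :
    wInner π (f + K.mulVec f) f = 1 / 2 * ∑ x, ∑ y, π x * K x y * (f x + f y) ^ 2 := by
  have h1 := h.wInner_self_eq_left f
  have h2 := h.wInner_self_eq_right f
  have h3 := wInner_mulVec_self (K := K) (π := π) f
  have : ∑ x, ∑ y, π x * K x y * (f x + f y) ^ 2 =
      ∑ x, ∑ y, π x * K x y * f x ^ 2 + ∑ x, ∑ y, π x * K x y * f y ^ 2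
        + 2 * ∑ x, ∑ y, π x * K x y * (f x * f y) := by
    simp only [Finset.mul_sum, ← Finset.sum_add_distrib]
    exact Finset.sum_congr rfl fun _ _ => Finset.sum_congr rfl fun _ _ => by ring
  rw [wInner_add_left, this]; linarith

lemma dirichlet_nonneg (f : ι → ℝ) : 0 ≤ dirichlet K π f := by
  rw [h.dirichlet_eq]
  have : 0 ≤ ∑ x, ∑ y, π x * K x y * (f x - f y) ^ 2 :=
    Finset.sum_nonneg fun x _ => Finset.sum_nonneg fun y _ =>
      mul_nonneg (mul_nonneg (h.weight_nonneg x) (h.nonneg x y)) (sq_nonneg _)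
  linarith

/-- Holding keeps the spectrum of K away from -1: of the sum of squares representing I + K, only the
diagonal terms are kept. -/
lemma mul_wInner_le_of_lazy {δ : ℝ} (hδ : ∀ x, δ ≤ K x x) (f : ι → ℝ) :
    2 * δ * wInner π f f ≤ wInner π (f + K.mulVec f) f := by
  classical
  rw [h.wInner_add_mulVec, wInner, Finset.mul_sum, Finset.mul_sum]
  refine Finset.sum_le_sum fun x _ => ?_
  have h1 : π x * K x x * (f x + f x) ^ 2 ≤ ∑ y, π x * K x y * (f x + f y) ^ 2 :=
    Finset.single_le_sum (f := fun y => π x * K x y * (f x + f y) ^ 2)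
      (fun y _ => mul_nonneg (mul_nonneg (h.weight_nonneg x) (h.nonneg x y)) (sq_nonneg _))
      (Finset.mem_univ x)
  have h2 : δ * (π x * (f x * f x)) ≤ K x x * (π x * (f x * f x)) :=
    mul_le_mul_of_nonneg_right (hδ x) (mul_nonneg (h.weight_nonneg x) (mul_self_nonneg _))
  nlinarith

lemma mul_self : IsReversible (K * K) π where
  nonneg x y := Finset.sum_nonneg fun z _ => mul_nonneg (h.nonneg x z) (h.nonneg z y)
  row_sum x := by
    simp_rw [Matrix.mul_apply]
    rw [Finset.sum_comm]
    simp_rw [← Finset.mul_sum, h.row_sum, mul_one, h.row_sum]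
  weight_nonneg := h.weight_nonneg
  weight_sum := h.weight_sum
  balance x y := by
    simp_rw [Matrix.mul_apply, Finset.mul_sum]
    refine Finset.sum_congr rfl fun z _ => ?_
    linear_combination K z y * h.balance x z + K z x * h.balance z y

/-- Two of the two-step paths suffice: hold and then jump, or jump and then hold. -/
lemma two_mul_le_sq_apply {δ : ℝ} (hδ : ∀ x, δ ≤ K x x) {x y : ι} (hxy : x ≠ y) :
    2 * δ * K x y ≤ (K * K) x y := by
  classical
  rw [Matrix.mul_apply]
  have h1 : ∑ z ∈ {x, y}, K x z * K z y ≤ ∑ z, K x z * K z y :=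
    Finset.sum_le_sum_of_subset_of_nonneg (Finset.subset_univ _)
      fun z _ _ => mul_nonneg (h.nonneg x z) (h.nonneg z y)
  rw [Finset.sum_pair hxy] at h1
  nlinarith [mul_le_mul_of_nonneg_right (hδ x) (h.nonneg x y),
    mul_le_mul_of_nonneg_left (hδ y) (h.nonneg x y)]

/-- Comparison of off-diagonal entries. Together with `wInner_sub_wInner_mulVec` it says that one
step lowers the squared norm by at least 2δ times the energy. -/
lemma mul_dirichlet_le_sq {δ : ℝ} (hδ : ∀ x, δ ≤ K x x) (f : ι → ℝ) :
    2 * δ * dirichlet K π f ≤ dirichlet (K * K) π f := by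
  rw [h.dirichlet_eq, h.mul_self.dirichlet_eq]
  have : ∑ x, ∑ y, 2 * δ * (π x * K x y * (f x - f y) ^ 2) ≤
      ∑ x, ∑ y, π x * (K * K) x y * (f x - f y) ^ 2 := by
    refine Finset.sum_le_sum fun x _ => Finset.sum_le_sum fun y _ => ?_
    rcases eq_or_ne x y with rfl | hxy
    · simp
    · have := mul_le_mul_of_nonneg_left (h.two_mul_le_sq_apply hδ hxy)
        (mul_nonneg (h.weight_nonneg x) (sq_nonneg (f x - f y)))
      nlinarith
  simp only [← Finset.mul_sum] at this
  linarith

lemma wInner_sub_wInner_mulVec (f : ι → ℝ) :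
    wInner π f f - wInner π (K.mulVec f) (K.mulVec f) = dirichlet (K * K) π f := by
  rw [dirichlet, wInner_sub_left, ← Matrix.mulVec_mulVec, h.wInner_mulVec_left (K.mulVec f) f]

/-- Both sides are ⟨(I + K)g, g⟩ with g = (I - K)f. With holding, the energy therefore drops at each
step by at least 2δ times the squared norm of the increment. -/
lemma dirichlet_sub_dirichlet_mulVec (f : ι → ℝ) :
    dirichlet K π f - dirichlet K π (K.mulVec f) =
      wInner π ((f - K.mulVec f) + K.mulVec (f - K.mulVec f)) (f - K.mulVec f) := by
  simp only [dirichlet, wInner_add_left, wInner_sub_left, wInner_sub_right, Matrix.mulVec_sub,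
    h.wInner_mulVec_left (K.mulVec f) f]
  linarith [h.wInner_mulVec_left f f]

end IsReversible

/-- Energy estimates along the orbit `φ k = K ^ k g`. -/
lemma IsReversible.orbit_energy (h : IsReversible K π) {δ : ℝ} (hδ0 : 0 < δ)
    (hδ : ∀ x, δ ≤ K x x) {φ : ℕ → ι → ℝ} (hφ : ∀ k, φ (k + 1) = K.mulVec (φ k)) (s m : ℕ) :
    (∑ k ∈ Finset.range m, dirichlet K π (φ k) ≤ wInner π (φ 0) (φ 0) / (2 * δ)) ∧
    s * ∑ k ∈ Finset.Ico s m, wInner π (φ k - φ (k + 1)) (φ k - φ (k + 1)) ≤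
      wInner π (φ 0) (φ 0) / (4 * δ ^ 2) := by
  have hN : ∀ k, 2 * δ * dirichlet K π (φ k) ≤
      wInner π (φ k) (φ k) - wInner π (φ (k + 1)) (φ (k + 1)) := fun k => by
    rw [hφ, h.wInner_sub_wInner_mulVec]; exact h.mul_dirichlet_le_sq hδ _
  have hE : ∀ k, 2 * δ * wInner π (φ k - φ (k + 1)) (φ k - φ (k + 1)) ≤
      dirichlet K π (φ k) - dirichlet K π (φ (k + 1)) := fun k => by
    rw [hφ, h.dirichlet_sub_dirichlet_mulVec]; exact h.mul_wInner_le_of_lazy hδ _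
  have hanti : Antitone fun k => dirichlet K π (φ k) := antitone_nat_of_succ_le fun k => by
    have := hE k
    have h2 := wInner_self_nonneg h.weight_nonneg (φ k - φ (k + 1))
    nlinarith
  have hsum : ∀ m, 2 * δ * ∑ k ∈ Finset.range m, dirichlet K π (φ k) ≤
      wInner π (φ 0) (φ 0) := fun m => by
    rw [Finset.mul_sum]
    refine (Finset.sum_le_sum fun k _ => hN k).trans ?_
    rw [Finset.sum_range_sub']
    linarith [wInner_self_nonneg h.weight_nonneg (φ m)]
  refine ⟨?_, ?_⟩
  · rw [le_div_iff₀ (by positivity)]; linarith [hsum m]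
  · have h1 : 2 * δ * ∑ k ∈ Finset.Ico s m, wInner π (φ k - φ (k + 1)) (φ k - φ (k + 1)) ≤
        dirichlet K π (φ s) := by
      rcases le_total s m with hsm | hsm
      · rw [Finset.mul_sum]
        refine (Finset.sum_le_sum fun k _ => hE k).trans ?_
        have := Finset.sum_Ico_sub (fun k => -dirichlet K π (φ k)) hsm
        simp only [neg_sub_neg] at this
        rw [this]
        linarith [h.dirichlet_nonneg (φ m)]
      · simp [Finset.Ico_eq_empty_of_le hsm, h.dirichlet_nonneg]
    -- The energy decreases along the orbit, so its value at time s is at most its average over the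
    -- first s steps. This is the source of the factor 1/s for the increments after time s.
    have h2 : s * dirichlet K π (φ s) ≤ ∑ k ∈ Finset.range s, dirichlet K π (φ k) := by
      have := Finset.card_nsmul_le_sum (Finset.range s) (fun k => dirichlet K π (φ k))
        (dirichlet K π (φ s)) fun k hk => hanti (Finset.mem_range.1 hk).le
      simpa using this
    have h3 := hsum s
    rw [le_div_iff₀ (by positivity)]
    have h4 := mul_le_mul_of_nonneg_left h1 (Nat.cast_nonneg (α := ℝ) s)
    nlinarith [mul_le_mul_of_nonneg_left h4 (by positivity : (0:ℝ) ≤ 2 * δ),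
      mul_le_mul_of_nonneg_left h2 (by positivity : (0:ℝ) ≤ 2 * δ)]

/-- A maximal inequality for lazy reversible chains with a spectral gap. -/
lemma IsReversible.exists_maximal (h : IsReversible K π) {δ lam A : ℝ} (hδ0 : 0 < δ)
    (hδ : ∀ x, δ ≤ K x x) (hlam : 0 < lam) (hP : Poincare K π lam) (hA : 0 < A)
    {φ : ℕ → ι → ℝ} (hφ : ∀ k, φ (k + 1) = K.mulVec (φ k)) (h0 : ∑ x, π x * φ 0 x = 0)
    {s m : ℕ} (hsm : s ≤ m) (hs : A ≤ lam * s) :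
    ∃ B : ι → ℝ, (∀ k, s ≤ k → k ≤ m → ∀ x, φ k x ^ 2 ≤ B x) ∧
      ∑ x, π x * B x ≤ wInner π (φ 0) (φ 0) *
        (1 / (2 * δ * A) + (1 / √A) * (1 / (4 * δ ^ 2) + 1 / δ)) := by
  have hmean : ∀ k, ∑ x, π x * φ k x = 0 := fun k => by
    induction k with
    | zero => exact h0
    | succ k ih => rw [hφ, h.sum_mulVec, ih]
  have hs0 : (0 : ℝ) < s := by
    by_contra hcon
    nlinarith [not_lt.1 hcon]
  set N0 := wInner π (φ 0) (φ 0)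
  have hN0 : 0 ≤ N0 := wInner_self_nonneg h.weight_nonneg _
  have hsumN : ∀ m, ∑ k ∈ Finset.range m, wInner π (φ k) (φ k) ≤ N0 / (2 * δ * lam) := fun m => by
    have h1 := (h.orbit_energy hδ0 hδ hφ 0 m).1
    have h2 := Finset.sum_le_sum fun k (_ : k ∈ Finset.range m) => hP (φ k) (hmean k)
    rw [← Finset.mul_sum] at h2
    have h3 := h2.trans h1
    rw [le_div_iff₀ (by positivity)] at h3 ⊢
    linarith
  have hdec : Antitone fun k => wInner π (φ k) (φ k) := antitone_nat_of_succ_le fun k => by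
    have h1 := h.mul_dirichlet_le_sq hδ (φ k)
    have h2 := h.wInner_sub_wInner_mulVec (φ k)
    have h3 := h.dirichlet_nonneg (φ k)
    rw [← hφ] at h2
    nlinarith
  have hNm : s * wInner π (φ m) (φ m) ≤ N0 / (2 * δ * lam) := by
    refine le_trans ?_ (hsumN s)
    have := Finset.card_nsmul_le_sum (Finset.range s) (fun k => wInner π (φ k) (φ k))
      (wInner π (φ m) (φ m)) fun k hk => hdec ((Finset.mem_range.1 hk).le.trans hsm)
    simpa using this
  -- `φ k x ^ 2` telescopes down to `φ m x ^ 2`, and each difference (a - b)(a + b) is split by a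
  -- weighted AM-GM inequality with weight w. The squared increments sum to O(1/s) and the squares
  -- to O(1/lam) ≤ O(s/A), so this w makes both contributions O(1/√A).
  set w : ℝ := s / √A with hw
  have hsA : 0 < √A := Real.sqrt_pos.2 hA
  have hw0 : 0 < w := by positivity
  refine ⟨fun x => φ m x ^ 2 + ∑ i ∈ Finset.Ico s m,
    (w * ((φ i x - φ (i + 1) x) * (φ i x - φ (i + 1) x)) +
      (1 / (2 * w)) * (φ i x * φ i x + φ (i + 1) x * φ (i + 1) x)), ?_, ?_⟩
  · intro k hsk hkm x
    have h1 : φ k x ^ 2 - φ m x ^ 2 = ∑ i ∈ Finset.Ico k m, (φ i x ^ 2 - φ (i + 1) x ^ 2) := by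
      have := Finset.sum_Ico_sub (fun k => -φ k x ^ 2) hkm
      simp only [neg_sub_neg] at this
      rw [this]
    have h2 : ∀ i, φ i x ^ 2 - φ (i + 1) x ^ 2 ≤
        w * ((φ i x - φ (i + 1) x) * (φ i x - φ (i + 1) x)) +
      (1 / (2 * w)) * (φ i x * φ i x + φ (i + 1) x * φ (i + 1) x) := fun i => by
      set a := φ i x
      set b := φ (i + 1) x
      have e : w * ((a - b) * (a - b)) + (1 / (2 * w)) * (a * a + b * b) - (a ^ 2 - b ^ 2) =
          (1 / (4 * w)) * ((2 * w * (a - b) - (a + b)) ^ 2 + (a - b) ^ 2) := by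
        field_simp; ring
      have : 0 ≤ (1 / (4 * w)) * ((2 * w * (a - b) - (a + b)) ^ 2 + (a - b) ^ 2) := by positivity
      linarith
    have h3 : ∑ i ∈ Finset.Ico k m, (φ i x ^ 2 - φ (i + 1) x ^ 2) ≤ _ :=
      Finset.sum_le_sum fun i _ => h2 i
    have h4 := Finset.sum_le_sum_of_subset_of_nonneg (f := fun i =>
        w * ((φ i x - φ (i + 1) x) * (φ i x - φ (i + 1) x)) +
      (1 / (2 * w)) * (φ i x * φ i x + φ (i + 1) x * φ (i + 1) x))
      (Finset.Ico_subset_Ico_left hsk (b := m)) fun i _ _ => by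
        have := mul_self_nonneg (φ i x - φ (i + 1) x)
        have := mul_self_nonneg (φ i x)
        have := mul_self_nonneg (φ (i + 1) x)
        positivity
    linarith
  · have e : ∑ x, π x * (φ m x ^ 2 + ∑ i ∈ Finset.Ico s m,
        (w * ((φ i x - φ (i + 1) x) * (φ i x - φ (i + 1) x)) +
        (1 / (2 * w)) * (φ i x * φ i x + φ (i + 1) x * φ (i + 1) x))) =
        wInner π (φ m) (φ m) +
        (w * ∑ k ∈ Finset.Ico s m, wInner π (φ k - φ (k + 1)) (φ k - φ (k + 1)) +
        (1 / (2 * w)) * (∑ k ∈ Finset.Ico s m, wInner π (φ k) (φ k) +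
          ∑ k ∈ Finset.Ico s m, wInner π (φ (k + 1)) (φ (k + 1)))) := by
      simp only [wInner, mul_add, Finset.sum_add_distrib, Finset.mul_sum, Pi.sub_apply]
      congr 1
      · exact Finset.sum_congr rfl fun _ _ => by ring
      · congr 1
        · rw [Finset.sum_comm]
          exact Finset.sum_congr rfl fun _ _ => Finset.sum_congr rfl fun _ _ => by ring
        · congr 1
          · rw [Finset.sum_comm]
            exact Finset.sum_congr rfl fun _ _ => Finset.sum_congr rfl fun _ _ => by ring
          · rw [Finset.sum_comm]
            exact Finset.sum_congr rfl fun _ _ => Finset.sum_congr rfl fun _ _ => by ring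
    rw [e]
    have hb := (h.orbit_energy hδ0 hδ hφ s m).2
    have nn := fun k => wInner_self_nonneg h.weight_nonneg (φ k)
    have hc1 : ∑ k ∈ Finset.Ico s m, wInner π (φ k) (φ k) ≤ N0 / (2 * δ * lam) := by
      refine le_trans (Finset.sum_le_sum_of_subset_of_nonneg ?_ fun k _ _ => nn k) (hsumN m)
      intro k hk; simp at hk ⊢; omega
    have hc2 : ∑ k ∈ Finset.Ico s m, wInner π (φ (k + 1)) (φ (k + 1)) ≤ N0 / (2 * δ * lam) :=
      le_trans (Finset.sum_le_sum fun k _ => hdec k.le_succ) hc1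
    have t1 : wInner π (φ m) (φ m) ≤ N0 * (1 / (2 * δ * A)) := by
      have : wInner π (φ m) (φ m) ≤ N0 / (2 * δ * lam) / s := by
        rw [le_div_iff₀ hs0]; linarith
      refine this.trans ?_
      rw [div_div, div_eq_mul_one_div]
      gcongr _ * (1 / ?_)
      nlinarith
    have t2 : w * ∑ k ∈ Finset.Ico s m, wInner π (φ k - φ (k + 1)) (φ k - φ (k + 1)) ≤
        N0 * ((1 / √A) * (1 / (4 * δ ^ 2))) := by
      rw [hw, div_mul_eq_mul_div]
      refine (div_le_div_of_nonneg_right hb hsA.le).trans (le_of_eq ?_)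
      field_simp
      rfl
    have t3 : (1 / (2 * w)) * (∑ k ∈ Finset.Ico s m, wInner π (φ k) (φ k) +
          ∑ k ∈ Finset.Ico s m, wInner π (φ (k + 1)) (φ (k + 1))) ≤
        N0 * ((1 / √A) * (1 / δ)) := by
      have : (1 / (2 * w)) * (∑ k ∈ Finset.Ico s m, wInner π (φ k) (φ k) +
          ∑ k ∈ Finset.Ico s m, wInner π (φ (k + 1)) (φ (k + 1))) ≤
          (1 / (2 * w)) * (N0 / (2 * δ * lam) + N0 / (2 * δ * lam)) := by gcongr
      refine this.trans ?_
      have e2 : (1 / (2 * w)) * (N0 / (2 * δ * lam) + N0 / (2 * δ * lam)) =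
          N0 * ((√A / (2 * (lam * s))) * (1 / δ)) := by
        rw [hw]; field_simp; ring
      rw [e2]
      gcongr N0 * (?_ * _)
      rw [div_le_div_iff₀ (by positivity) hsA, Real.mul_self_sqrt hA.le]
      nlinarith
    nlinarith

end Reversible

/-! ### Birth and death chains in coordinates -/

section Coordinates

variable {n : ℕ}

/-- `K` is a birth and death matrix with positive birth rates, reversible with respect to `π`. -/
structure IsBD (K : Matrix (Fin (n + 1)) (Fin (n + 1)) ℝ) (π : Fin (n + 1) → ℝ) : Prop
    extends IsReversible K π where
  weight_pos : ∀ x, 0 < π x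
  nearest : ∀ i j : Fin (n + 1), (i : ℕ) + 1 < j ∨ (j : ℕ) + 1 < i → K i j = 0
  up_pos : ∀ i : Fin n, 0 < K i.castSucc i.succ

/-- The birth rate at `k`. -/
def up (K : Matrix (Fin (n + 1)) (Fin (n + 1)) ℝ) (k : ℕ) : ℝ :=
  if h : k < n then K ⟨k, by omega⟩ ⟨k + 1, by omega⟩ else 0

/-- The death rate at `k + 1`. -/
def down (K : Matrix (Fin (n + 1)) (Fin (n + 1)) ℝ) (k : ℕ) : ℝ :=
  if h : k < n then K ⟨k + 1, by omega⟩ ⟨k, by omega⟩ else 0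

/-- The weights, extended by zero to `ℕ`. -/
def wt (π : Fin (n + 1) → ℝ) (k : ℕ) : ℝ := if h : k < n + 1 then π ⟨k, h⟩ else 0

/-- The conductance of the edge `{k, k + 1}`. -/
def cond (K : Matrix (Fin (n + 1)) (Fin (n + 1)) ℝ) (π : Fin (n + 1) → ℝ) (k : ℕ) : ℝ :=
  wt π k * up K k

/-- The weight of `[0, k]`. -/
def cum (π : Fin (n + 1) → ℝ) (k : ℕ) : ℝ := ∑ i ∈ Finset.range (k + 1), wt π i

/-- The mean passage time from `k` to `k + 1`. -/
def passMean (K : Matrix (Fin (n + 1)) (Fin (n + 1)) ℝ) (π : Fin (n + 1) → ℝ) (k : ℕ) : ℝ :=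
  cum π k / cond K π k

/-- The variance of the passage time from `k` to `k + 1` of the continuous time chain. -/
def passVar (K : Matrix (Fin (n + 1)) (Fin (n + 1)) ℝ) (π : Fin (n + 1) → ℝ) (k : ℕ) : ℝ :=
  (cond K π k * passMean K π k ^ 2 +
    2 * ∑ y ∈ Finset.range k, cond K π y * passMean K π y ^ 2) / cond K π k

/-- The mean hitting time of `z` from `k ≤ z`. -/
def upMean (K : Matrix (Fin (n + 1)) (Fin (n + 1)) ℝ) (π : Fin (n + 1) → ℝ) (z k : ℕ) : ℝ :=
  ∑ i ∈ Finset.Ico k z, passMean K π i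

/-- The variance of the hitting time of `z` from `k ≤ z` of the continuous time chain. -/
def upVar (K : Matrix (Fin (n + 1)) (Fin (n + 1)) ℝ) (π : Fin (n + 1) → ℝ) (z k : ℕ) : ℝ :=
  ∑ i ∈ Finset.Ico k z, passVar K π i

variable {K : Matrix (Fin (n + 1)) (Fin (n + 1)) ℝ} {π : Fin (n + 1) → ℝ}

lemma wt_coe (x : Fin (n + 1)) : wt π x = π x := by
  rw [wt, dif_pos x.2]

lemma sum_range_wt (f : ℕ → ℝ) :
    ∑ i ∈ Finset.range (n + 1), wt π i * f i = ∑ x : Fin (n + 1), π x * f x := by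
  rw [← Fin.sum_univ_eq_sum_range (fun i => wt π i * f i)]
  simp [wt_coe]

lemma cum_succ (k : ℕ) : cum π (k + 1) = cum π k + wt π (k + 1) := Finset.sum_range_succ _ _

namespace IsBD

variable (h : IsBD K π)
include h

lemma up_pos' {k : ℕ} (hk : k < n) : 0 < up K k := by
  simpa [up, hk] using h.up_pos ⟨k, hk⟩

lemma wt_pos {k : ℕ} (hk : k ≤ n) : 0 < wt π k := by
  simpa [wt, Nat.lt_succ_of_le hk] using h.weight_pos ⟨k, by omega⟩

lemma wt_nonneg (k : ℕ) : 0 ≤ wt π k := by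
  unfold wt; split_ifs
  · exact h.weight_nonneg _
  · exact le_rfl

lemma up_nonneg (k : ℕ) : 0 ≤ up K k := by
  unfold up; split_ifs
  · exact h.nonneg _ _
  · exact le_rfl

lemma cond_eq (k : ℕ) : cond K π k = wt π (k + 1) * down K k := by
  unfold cond up down
  split_ifs with hk
  · have := h.balance ⟨k, by omega⟩ ⟨k + 1, by omega⟩
    simpa [wt, hk, Nat.lt_succ_of_lt hk] using this
  · simp

lemma cond_pos {k : ℕ} (hk : k < n) : 0 < cond K π k :=
  mul_pos (h.wt_pos hk.le) (h.up_pos' hk)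

lemma cond_nonneg (k : ℕ) : 0 ≤ cond K π k := mul_nonneg (h.wt_nonneg k) (h.up_nonneg k)

lemma down_pos {k : ℕ} (hk : k < n) : 0 < down K k := by
  have h1 := h.cond_pos hk
  rw [h.cond_eq] at h1
  exact pos_of_mul_pos_right h1 (h.wt_nonneg _)

lemma cum_nonneg (k : ℕ) : 0 ≤ cum π k := Finset.sum_nonneg fun i _ => h.wt_nonneg i

lemma wt_le_cum (k : ℕ) : wt π k ≤ cum π k :=
  Finset.single_le_sum (fun i _ => h.wt_nonneg i) (Finset.self_mem_range_succ k)

lemma cum_last : cum π n = 1 := by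
  have := sum_range_wt (π := π) fun _ => 1
  simp only [mul_one, h.weight_sum] at this
  exact this

lemma cum_mono : Monotone (cum π) := monotone_nat_of_le_succ fun k => by
  rw [cum_succ]; linarith [h.wt_nonneg (k + 1)]

lemma cum_le_one {k : ℕ} (hk : k ≤ n) : cum π k ≤ 1 := h.cum_last ▸ h.cum_mono hk

lemma passMean_nonneg (k : ℕ) : 0 ≤ passMean K π k :=
  div_nonneg (h.cum_nonneg k) (h.cond_nonneg k)

lemma passVar_nonneg (k : ℕ) : 0 ≤ passVar K π k :=
  div_nonneg (add_nonneg (mul_nonneg (h.cond_nonneg k) (sq_nonneg _))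
    (mul_nonneg zero_le_two (Finset.sum_nonneg fun y _ =>
      mul_nonneg (h.cond_nonneg y) (sq_nonneg _)))) (h.cond_nonneg k)

lemma upMean_nonneg (z k : ℕ) : 0 ≤ upMean K π z k :=
  Finset.sum_nonneg fun i _ => h.passMean_nonneg i

lemma upVar_nonneg (z k : ℕ) : 0 ≤ upVar K π z k :=
  Finset.sum_nonneg fun i _ => h.passVar_nonneg i

lemma one_le_mul_passMean {k : ℕ} (hk : k < n) : 1 ≤ up K k * passMean K π k := by
  have h1 := h.wt_pos hk.le
  have h2 := h.up_pos' hk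
  rw [passMean, cond, ← mul_div_assoc, le_div_iff₀ (by positivity)]
  nlinarith [h.wt_le_cum k]

lemma up_add_le (k : ℕ) (hk : k < n) : up K k + K ⟨k, by omega⟩ ⟨k, by omega⟩ ≤ 1 := by
  rw [← h.row_sum ⟨k, by omega⟩]
  have := Finset.sum_le_sum_of_subset_of_nonneg
    (Finset.subset_univ {(⟨k + 1, by omega⟩ : Fin (n + 1)), ⟨k, by omega⟩})
    fun j _ _ => h.nonneg ⟨k, by omega⟩ j
  rw [Finset.sum_pair (by simp)] at this
  simpa [up, hk] using this

lemma one_le_passMean {k : ℕ} (hk : k < n) : 1 ≤ passMean K π k := by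
  have h1 := h.one_le_mul_passMean hk
  have h2 := h.up_add_le k hk
  have h3 := h.nonneg ⟨k, by omega⟩ ⟨k, by omega⟩
  nlinarith [h.passMean_nonneg k]

/-- The action of `K - 1` on functions. -/
lemma sum_mul_sub (f : ℕ → ℝ) (x : Fin (n + 1)) :
    ∑ j, K x j * (f j - f x) = up K x * (f (x + 1) - f x) +
      if (x : ℕ) = 0 then 0 else down K (x - 1) * (f (x - 1) - f x) := by
  have e : ∀ j : Fin (n + 1), K x j * (f j - f x) =
      (if (j : ℕ) = x + 1 then K x j * (f j - f x) else 0) +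
      (if (j : ℕ) + 1 = x then K x j * (f j - f x) else 0) := fun j => by
    by_cases h1 : (j : ℕ) = x + 1
    · rw [if_pos h1, if_neg (by omega), add_zero]
    · by_cases h2 : (j : ℕ) + 1 = x
      · rw [if_neg h1, if_pos h2, zero_add]
      · rw [if_neg h1, if_neg h2]
        by_cases h3 : j = x
        · rw [h3]; simp
        · rw [h.nearest x j (by rw [Fin.ext_iff] at h3; omega)]; simp
  rw [Finset.sum_congr rfl fun j _ => e j, Finset.sum_add_distrib]
  congr 1
  · unfold up
    split_ifs with hx
    · rw [Finset.sum_eq_single ⟨x + 1, by omega⟩]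
      · simp
      · intro j _ hj
        rw [if_neg fun hh => hj (Fin.ext hh)]
      · simp
    · rw [zero_mul]
      refine Finset.sum_eq_zero fun j _ => if_neg ?_
      omega
  · split_ifs with hx
    · exact Finset.sum_eq_zero fun j _ => if_neg (by omega)
    · have hx' : (x : ℕ) - 1 < n := by omega
      rw [Finset.sum_eq_single ⟨x - 1, by omega⟩]
      · have e2 : (x : ℕ) - 1 + 1 = x := by omega
        simp [down, hx', e2]
      · intro j _ hj
        rw [if_neg fun hh => hj (Fin.ext (by simp; omega))]
      · simp

lemma sum_mul_eq (f : ℕ → ℝ) (x : Fin (n + 1)) :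
    ∑ j, K x j * f j = f x + up K x * (f (x + 1) - f x) +
      if (x : ℕ) = 0 then 0 else down K (x - 1) * (f (x - 1) - f x) := by
  rw [add_assoc, ← h.sum_mul_sub]
  simp only [mul_sub, Finset.sum_sub_distrib, ← Finset.sum_mul, h.row_sum]
  ring

lemma passMean_zero (hn : 0 < n) : up K 0 * passMean K π 0 = 1 := by
  have h1 := h.wt_pos n.zero_le
  have h2 := h.up_pos' hn
  rw [passMean, cond, cum]; simp; field_simp

/-- First-step equation for the passage from k + 1 to k + 2: a step down has to be repaid by a
passage from k to k + 1. -/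
lemma passMean_succ {k : ℕ} (hk : k + 1 < n) :
    up K (k + 1) * passMean K π (k + 1) = 1 + down K k * passMean K π k := by
  have h1 := h.wt_pos hk.le
  have h2 := h.up_pos' hk
  have h3 := h.down_pos (by omega : k < n)
  rw [passMean, passMean, h.cond_eq k, cond, cum_succ]; field_simp; ring

lemma passVar_zero (hn : 0 < n) : up K 0 * passVar K π 0 = up K 0 * passMean K π 0 ^ 2 := by
  have h1 := h.cond_pos hn
  rw [passVar]; simp; left; field_simp

/-- The closed form telescopes: multiplied by the weight of k + 1, two consecutive variances differ
by the boundary terms of the sum only. -/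
lemma passVar_succ {k : ℕ} (hk : k + 1 < n) :
    up K (k + 1) * passVar K π (k + 1) = down K k * passVar K π k +
      up K (k + 1) * passMean K π (k + 1) ^ 2 + down K k * passMean K π k ^ 2 := by
  have h1 := h.wt_pos hk.le
  have h2 := h.up_pos' hk
  have h3 := h.down_pos (by omega : k < n)
  have c1 : cond K π (k + 1) = wt π (k + 1) * up K (k + 1) := rfl
  have c2 := h.cond_eq k
  rw [passVar, passVar, Finset.sum_range_succ, c1, c2]
  field_simp; ring

omit h in
lemma upMean_self (z : ℕ) : upMean K π z z = 0 := by simp [upMean]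

omit h in
lemma upVar_self (z : ℕ) : upVar K π z z = 0 := by simp [upVar]

omit h in
lemma upMean_eq_add {z k : ℕ} (hk : k < z) :
    upMean K π z k = passMean K π k + upMean K π z (k + 1) := Finset.sum_eq_sum_Ico_succ_bot hk _

omit h in
lemma upVar_eq_add {z k : ℕ} (hk : k < z) :
    upVar K π z k = passVar K π k + upVar K π z (k + 1) := Finset.sum_eq_sum_Ico_succ_bot hk _

omit h in
lemma upMean_add {a b c : ℕ} (hab : a ≤ b) (hbc : b ≤ c) :
    upMean K π b a + upMean K π c b = upMean K π c a := Finset.sum_Ico_consecutive _ hab hbc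

lemma upMean_anti (z : ℕ) : Antitone (upMean K π z) := fun _ _ hab =>
  Finset.sum_le_sum_of_subset_of_nonneg (Finset.Ico_subset_Ico_left hab)
    fun i _ _ => h.passMean_nonneg i

lemma upMean_mono {z z' : ℕ} (hz : z ≤ z') (k : ℕ) : upMean K π z k ≤ upMean K π z' k :=
  Finset.sum_le_sum_of_subset_of_nonneg (Finset.Ico_subset_Ico_right hz)
    fun i _ _ => h.passMean_nonneg i

lemma upVar_mono {z z' : ℕ} (hz : z ≤ z') (k : ℕ) : upVar K π z k ≤ upVar K π z' k :=
  Finset.sum_le_sum_of_subset_of_nonneg (Finset.Ico_subset_Ico_right hz)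
    fun i _ _ => h.passVar_nonneg i

lemma upVar_anti (z : ℕ) : Antitone (upVar K π z) := fun _ _ hab =>
  Finset.sum_le_sum_of_subset_of_nonneg (Finset.Ico_subset_Ico_left hab)
    fun i _ _ => h.passVar_nonneg i

lemma sub_le_upMean {z k : ℕ} (hz : z ≤ n) (hk : k ≤ z) : (z : ℝ) - k ≤ upMean K π z k := by
  have := Finset.card_nsmul_le_sum (Finset.Ico k z) (passMean K π) 1 fun i hi =>
    h.one_le_passMean ((Finset.mem_Ico.1 hi).2.trans_le hz)
  simpa [Nat.cast_sub hk, upMean] using this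

lemma one_le_upMean {z k : ℕ} (hz : z ≤ n) (hk : k < z) : 1 ≤ upMean K π z k := by
  have := h.sub_le_upMean hz hk.le
  have : (k : ℝ) + 1 ≤ z := by exact_mod_cast hk
  linarith

/-- First-step equation for the mean hitting time; it identifies the closed form `upMean` with an
expectation in `hasSum_surv_upMean`. -/
lemma sum_mul_upMean {z : ℕ} (hz : z ≤ n) {x : Fin (n + 1)} (hx : (x : ℕ) < z) :
    ∑ j, K x j * upMean K π z j = upMean K π z x - 1 := by
  rw [h.sum_mul_eq]
  obtain ⟨x, hxn⟩ := x
  simp only at hx ⊢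
  have e1 := upMean_eq_add (K := K) (π := π) hx
  rcases x with _ | k
  · have := h.passMean_zero (by omega)
    rw [e1]; simp; linarith
  · have := h.passMean_succ (by omega : k + 1 < n)
    have e2 := upMean_eq_add (K := K) (π := π) (by omega : k < z)
    simp only [Nat.add_eq_zero_iff, one_ne_zero, and_false, if_false, Nat.add_sub_cancel]
    rw [e2, e1]; linarith

/-- The second moment of the hitting time of `z` around `t`, up to the mean. -/
lemma sum_mul_upVar_add {z : ℕ} (hz : z ≤ n) {x : Fin (n + 1)} (hx : (x : ℕ) < z) (t : ℝ) :
    ∑ j, K x j * (upVar K π z j + (upMean K π z j - (t - 1)) ^ 2) =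
      upVar K π z x + (upMean K π z x - t) ^ 2 - 1 := by
  rw [h.sum_mul_eq fun j => upVar K π z j + (upMean K π z j - (t - 1)) ^ 2]
  obtain ⟨x, hxn⟩ := x
  simp only at hx ⊢
  have e1 := upMean_eq_add (K := K) (π := π) hx
  have v1 := upVar_eq_add (K := K) (π := π) hx
  rcases x with _ | k
  · have h1 := h.passMean_zero (by omega)
    have h2 := h.passVar_zero (by omega)
    rw [e1, v1]; simp only [if_true, add_zero]
    linear_combination -h2 - (2 * (passMean K π 0 + upMean K π z (0 + 1) - t + 1)) * h1
  · have h1 := h.passMean_succ (by omega : k + 1 < n)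
    have h2 := h.passVar_succ (by omega : k + 1 < n)
    have e2 := upMean_eq_add (K := K) (π := π) (by omega : k < z)
    have v2 := upVar_eq_add (K := K) (π := π) (by omega : k < z)
    simp only [Nat.add_eq_zero_iff, one_ne_zero, and_false, if_false, Nat.add_sub_cancel]
    rw [e2, v2, e1, v1]
    linear_combination -h2 -
      (2 * (passMean K π (k + 1) + upMean K π z (k + 1 + 1) - t + 1)) * h1

end IsBD

end Coordinates

/-! ### Survival probabilities -/

section Survival

variable {n : ℕ}

lemma mulVec_eq_sum (K : Matrix (Fin (n + 1)) (Fin (n + 1)) ℝ) (f : Fin (n + 1) → ℝ)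
    (x : Fin (n + 1)) : K.mulVec f x = ∑ y, K x y * f y := rfl

/-- The expectation of `f` at time `m` on the event that `z` has not been visited, for the chain
started at `x`. -/
def killed (K : Matrix (Fin (n + 1)) (Fin (n + 1)) ℝ) (z : Fin (n + 1)) (f : Fin (n + 1) → ℝ) :
    ℕ → Fin (n + 1) → ℝ
  | 0, x => if x = z then 0 else f x
  | m + 1, x => if x = z then 0 else ∑ y, K x y * killed K z f m y

/-- The probability that the chain started at `x` does not visit `z` up to time `m`. -/
def surv (K : Matrix (Fin (n + 1)) (Fin (n + 1)) ℝ) (z : Fin (n + 1)) (m : ℕ)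
    (x : Fin (n + 1)) : ℝ := killed K z (fun _ => 1) m x

variable {K : Matrix (Fin (n + 1)) (Fin (n + 1)) ℝ} {π : Fin (n + 1) → ℝ} {z : Fin (n + 1)}

@[simp] lemma killed_self (f : Fin (n + 1) → ℝ) (m : ℕ) : killed K z f m z = 0 := by
  cases m <;> simp [killed]

lemma killed_zero {x : Fin (n + 1)} (hx : x ≠ z) (f : Fin (n + 1) → ℝ) :
    killed K z f 0 x = f x := if_neg hx

lemma killed_succ {x : Fin (n + 1)} (hx : x ≠ z) (f : Fin (n + 1) → ℝ) (m : ℕ) :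
    killed K z f (m + 1) x = ∑ y, K x y * killed K z f m y := if_neg hx

@[simp] lemma surv_self (m : ℕ) : surv K z m z = 0 := killed_self _ m

lemma surv_zero {x : Fin (n + 1)} (hx : x ≠ z) : surv K z 0 x = 1 := killed_zero hx _

lemma surv_succ {x : Fin (n + 1)} (hx : x ≠ z) (m : ℕ) :
    surv K z (m + 1) x = ∑ y, K x y * surv K z m y := killed_succ hx _ m

lemma surv_nonneg (hK : ∀ x y, 0 ≤ K x y) (m : ℕ) (x : Fin (n + 1)) : 0 ≤ surv K z m x := by
  induction m generalizing x with
  | zero =>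
    rcases eq_or_ne x z with rfl | hx
    · simp
    · simp [surv_zero hx]
  | succ m ih =>
    rcases eq_or_ne x z with rfl | hx
    · simp
    · rw [surv_succ hx]
      exact Finset.sum_nonneg fun y _ => mul_nonneg (hK x y) (ih y)

lemma killed_rev (f : Fin (n + 1) → ℝ) (m : ℕ) (x : Fin (n + 1)) :
    killed (K.submatrix Fin.rev Fin.rev) z.rev (f ∘ Fin.rev) m x.rev = killed K z f m x := by
  induction m generalizing x with
  | zero => simp [killed]
  | succ m ih =>
    simp only [killed, Fin.rev_inj, Matrix.submatrix_apply, Fin.rev_rev]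
    congr 1
    rw [← Equiv.sum_comp Fin.revPerm]
    simp [ih]

lemma surv_rev (m : ℕ) (x : Fin (n + 1)) :
    surv (K.submatrix Fin.rev Fin.rev) z.rev m x.rev = surv K z m x :=
  killed_rev (fun _ => 1) m x

namespace IsReversible

variable (h : IsReversible K π)
include h

lemma surv_le_one (m : ℕ) (x : Fin (n + 1)) : surv K z m x ≤ 1 := by
  induction m generalizing x with
  | zero =>
    rcases eq_or_ne x z with rfl | hx
    · simp
    · simp [surv_zero hx]
  | succ m ih =>
    rcases eq_or_ne x z with rfl | hx
    · simp
    · rw [surv_succ hx, ← h.row_sum x]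
      exact Finset.sum_le_sum fun y _ => mul_le_of_le_one_right (h.nonneg x y) (ih y)

lemma surv_antitone (x : Fin (n + 1)) : Antitone fun m => surv K z m x := by
  refine antitone_nat_of_succ_le fun m => ?_
  induction m generalizing x with
  | zero =>
    rcases eq_or_ne x z with rfl | hx
    · simp
    · rw [surv_zero hx]; exact h.surv_le_one _ _
  | succ m ih =>
    rcases eq_or_ne x z with rfl | hx
    · simp
    · rw [surv_succ hx, surv_succ hx]
      exact Finset.sum_le_sum fun y _ => mul_le_mul_of_nonneg_left (ih y) (h.nonneg x y)

lemma orbit_le_one {φ : ℕ → Fin (n + 1) → ℝ} (hφ : ∀ k, φ (k + 1) = K.mulVec (φ k))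
    (hle : ∀ x, φ 0 x ≤ 1) (k : ℕ) (x : Fin (n + 1)) : φ k x ≤ 1 := by
  induction k generalizing x with
  | zero => exact hle x
  | succ k ih =>
    rw [hφ, mulVec_eq_sum, ← h.row_sum x]
    exact Finset.sum_le_sum fun y _ => mul_le_of_le_one_right (h.nonneg x y) (ih y)

/-- Decomposition of an orbit at the hitting time of `z`. -/
lemma orbit_le_add_surv {φ : ℕ → Fin (n + 1) → ℝ} (hφ : ∀ k, φ (k + 1) = K.mulVec (φ k))
    (hle : ∀ x, φ 0 x ≤ 1) {b : ℝ} (hb : 0 ≤ b) {s m : ℕ}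
    (hz : ∀ k, s ≤ k → k ≤ m → φ k z ≤ b) (a k : ℕ) (hak : s + a ≤ k) (hkm : k ≤ m)
    (x : Fin (n + 1)) : φ k x ≤ b + surv K z a x := by
  have hone := h.orbit_le_one hφ hle
  induction a generalizing k x with
  | zero =>
    rcases eq_or_ne x z with rfl | hx
    · simpa using hz k hak hkm
    · rw [surv_zero hx]; linarith [hone k x]
  | succ a ih =>
    rcases eq_or_ne x z with rfl | hx
    · simpa using hz k (by omega) hkm
    · obtain ⟨k, rfl⟩ : ∃ j, k = j + 1 := ⟨k - 1, by omega⟩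
      rw [surv_succ hx, hφ, mulVec_eq_sum]
      calc ∑ y, K x y * φ k y ≤ ∑ y, K x y * (b + surv K z a y) :=
            Finset.sum_le_sum fun y _ =>
              mul_le_mul_of_nonneg_left (ih k (by omega) (by omega) y) (h.nonneg x y)
        _ = _ := by
            simp_rw [mul_add, Finset.sum_add_distrib, ← Finset.sum_mul, h.row_sum, one_mul]

end IsReversible

/-! ### Survival below the target: Chebyshev bounds and the Markov property in analytic form -/

namespace IsBD

variable (h : IsBD K π)
include h

/-- A nearest-neighbour chain cannot jump over z, so from below z only values on [0, z] matter. -/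
lemma sum_mul_le_of_below {x : Fin (n + 1)} (hx : x < z) {f g : Fin (n + 1) → ℝ}
    (hfg : ∀ y ≤ z, f y ≤ g y) : ∑ y, K x y * f y ≤ ∑ y, K x y * g y := by
  refine Finset.sum_le_sum fun y _ => ?_
  rcases le_or_gt y z with hy | hy
  · exact mul_le_mul_of_nonneg_left (hfg y hy) (h.nonneg x y)
  · rw [h.nearest x y (by omega)]; simp

lemma sum_mul_congr_below {x : Fin (n + 1)} (hx : x < z) {f g : Fin (n + 1) → ℝ}
    (hfg : ∀ y ≤ z, f y = g y) : ∑ y, K x y * f y = ∑ y, K x y * g y :=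
  le_antisymm (h.sum_mul_le_of_below hx fun y hy => (hfg y hy).le)
    (h.sum_mul_le_of_below hx fun y hy => (hfg y hy).ge)

/-- Chebyshev's inequality for the upper tail, without any path space. The right side loses 1 when
averaged over one step with t lowered by 1, and the factor (a + 1 - t)² is invariant under that
shift, so induction on a applies. Survival up to time a means a hitting time of at least a + 1,
hence the shift. -/
lemma surv_mul_sq_le (a : ℕ) {t : ℝ} (ht : t ≤ a + 1) {x : Fin (n + 1)} (hx : x ≤ z) :
    surv K z a x * (a + 1 - t) ^ 2 ≤ upVar K π z x + (upMean K π z x - t) ^ 2 := by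
  induction a generalizing t x with
  | zero =>
    rcases eq_or_lt_of_le hx with rfl | hx
    · simp [upMean_self, upVar_self, sq_nonneg]
    · rw [surv_zero hx.ne]
      have h1 := h.one_le_upMean (Fin.is_le z) (Fin.lt_def.1 hx)
      have h2 := h.upVar_nonneg z x
      push_cast at ht ⊢
      nlinarith
  | succ a ih =>
    rcases eq_or_lt_of_le hx with rfl | hx
    · simp [upMean_self, upVar_self, sq_nonneg]
    · rw [surv_succ hx.ne, Finset.sum_mul]
      have h1 := h.sum_mul_upVar_add (Fin.is_le z) (Fin.lt_def.1 hx) t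
      have h2 := h.sum_mul_le_of_below hx
        (f := fun y => surv K z a y * (((a + 1 : ℕ) : ℝ) + 1 - t) ^ 2)
        (g := fun y => upVar K π z y + (upMean K π z y - (t - 1)) ^ 2) fun y hy => by
          have := ih (t := t - 1) (by push_cast at ht; linarith) hy
          push_cast
          convert this using 3
          ring
      simp only [mul_assoc]
      linarith

/-- The lower tail, by the same induction. -/
lemma one_sub_surv_mul_sq_le (a : ℕ) {t : ℝ} (ht : a ≤ t) {x : Fin (n + 1)} (hx : x ≤ z) :
    (1 - surv K z a x) * (t - a) ^ 2 ≤ upVar K π z x + (upMean K π z x - t) ^ 2 := by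
  induction a generalizing t x with
  | zero =>
    rcases eq_or_lt_of_le hx with rfl | hx
    · simp [upMean_self, upVar_self]
    · rw [surv_zero hx.ne]
      have h2 := h.upVar_nonneg z x
      simp
      positivity
  | succ a ih =>
    rcases eq_or_lt_of_le hx with rfl | hx
    · have : (0 : ℝ) ≤ ((a + 1 : ℕ) : ℝ) := by positivity
      simp [upMean_self, upVar_self]
      push_cast at *
      nlinarith
    · have h1 := h.sum_mul_upVar_add (Fin.is_le z) (Fin.lt_def.1 hx) t
      have h2 := h.sum_mul_le_of_below hx
        (f := fun y => (1 - surv K z a y) * (t - (a + 1 : ℕ)) ^ 2)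
        (g := fun y => upVar K π z y + (upMean K π z y - (t - 1)) ^ 2) fun y hy => by
          have := ih (t := t - 1) (by push_cast at ht; linarith) hy
          push_cast
          convert this using 3
          ring
      have h3 : ∑ y, K x y * ((1 - surv K z a y) * (t - (a + 1 : ℕ)) ^ 2) =
          (1 - surv K z (a + 1) x) * (t - (a + 1 : ℕ)) ^ 2 := by
        rw [surv_succ hx.ne]
        simp only [← mul_assoc, ← Finset.sum_mul, mul_sub, mul_one, Finset.sum_sub_distrib,
          h.row_sum]
      linarith

/-- From x ≤ z the way to w leads through z. To miss w up to time a + b the chain must miss z up to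
time a, or miss w for b steps after its visit to z. -/
lemma surv_add_le {w : Fin (n + 1)} (hzw : z ≤ w) (a b : ℕ) {x : Fin (n + 1)} (hx : x ≤ z) :
    surv K w (a + b) x ≤ surv K z a x + surv K w b z := by
  induction a generalizing x with
  | zero =>
    rcases eq_or_lt_of_le hx with rfl | hx
    · simp
    · rw [surv_zero hx.ne]
      linarith [h.surv_le_one (z := w) (0 + b) x, surv_nonneg h.nonneg (z := w) b z]
  | succ a ih =>
    rcases eq_or_lt_of_le hx with rfl | hx
    · simpa using h.surv_antitone (z := w) x (by omega : b ≤ a + 1 + b)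
    · rw [surv_succ hx.ne, add_right_comm, surv_succ (hx.trans_le hzw).ne]
      refine (h.sum_mul_le_of_below hx fun y hy => ih hy).trans (le_of_eq ?_)
      simp_rw [mul_add, Finset.sum_add_distrib, ← Finset.sum_mul, h.row_sum, one_mul]

/-- For the indicator of [z, n] this says that the chain can be at or above z at time a only if it
has hit z by then. -/
lemma orbit_add_surv_le_one {φ : ℕ → Fin (n + 1) → ℝ} (hφ : ∀ k, φ (k + 1) = K.mulVec (φ k))
    (hle : ∀ x, φ 0 x ≤ 1) (hzero : ∀ x < z, φ 0 x ≤ 0) (a : ℕ) {x : Fin (n + 1)} (hx : x ≤ z) :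
    φ a x + surv K z a x ≤ 1 := by
  have hone := h.toIsReversible.orbit_le_one hφ hle
  induction a generalizing x with
  | zero =>
    rcases eq_or_lt_of_le hx with rfl | hx
    · simpa using hone 0 x
    · rw [surv_zero hx.ne]; linarith [hzero x hx]
  | succ a ih =>
    rcases eq_or_lt_of_le hx with rfl | hx
    · simpa using hone _ x
    · rw [surv_succ hx.ne, hφ, ← h.row_sum x, mulVec_eq_sum,
        ← Finset.sum_add_distrib]
      simp_rw [← mul_add]
      exact (h.sum_mul_le_of_below hx fun y hy => ih hy).trans (by simp)

lemma killed_mem_Icc {f : Fin (n + 1) → ℝ} {D : ℝ} (hf : ∀ y ≤ z, f y ∈ Set.Icc 0 D)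
    (a : ℕ) {x : Fin (n + 1)} (hx : x ≤ z) :
    killed K z f a x ∈ Set.Icc 0 (D * surv K z a x) := by
  induction a generalizing x with
  | zero =>
    rcases eq_or_lt_of_le hx with rfl | hx
    · simp
    · rw [surv_zero hx.ne, killed_zero hx.ne, mul_one]; exact hf x hx.le
  | succ a ih =>
    rcases eq_or_lt_of_le hx with rfl | hx
    · simp
    · rw [surv_succ hx.ne, killed_succ hx.ne]
      constructor
      · have := h.sum_mul_le_of_below hx (f := fun _ => 0) fun y hy => (ih hy).1
        simpa using this
      · refine (h.sum_mul_le_of_below hx fun y hy => (ih hy).2).trans (le_of_eq ?_)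
        rw [Finset.mul_sum]
        exact Finset.sum_congr rfl fun _ _ => by ring

/-! ### Moments of hitting times as series of survival probabilities -/

/-- A time-dependent Poisson equation unrolled a times; the killed term is the part of the solution
not yet absorbed at z. -/
lemma eq_sum_surv_add_killed {c : ℕ → ℝ} {u : ℕ → Fin (n + 1) → ℝ} (hz : ∀ i, u i z = 0)
    (hu : ∀ i, ∀ x < z, u i x = c i + ∑ y, K x y * u (i + 1) y) (a i : ℕ) {x : Fin (n + 1)}
    (hx : x ≤ z) :
    u i x = ∑ k ∈ Finset.range a, c (i + k) * surv K z k x + killed K z (u (i + a)) a x := by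
  induction a generalizing i x with
  | zero =>
    rcases eq_or_lt_of_le hx with rfl | hx
    · simp [hz]
    · simp [killed_zero hx.ne]
  | succ a ih =>
    rcases eq_or_lt_of_le hx with rfl | hx
    · simp [hz]
    · rw [hu i x hx, Finset.sum_range_succ', h.sum_mul_congr_below hx fun y hy => ih (i + 1) hy,
        killed_succ hx.ne, surv_zero hx.ne]
      simp only [mul_add, Finset.sum_add_distrib, surv_succ hx.ne, Finset.mul_sum]
      rw [Finset.sum_comm, add_zero, mul_one, show i + 1 + a = i + (a + 1) by omega]
      have e : ∀ k y, K x y * (c (i + 1 + k) * surv K z k y) =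
          c (i + (k + 1)) * (K x y * surv K z k y) := fun k y => by
        rw [show i + 1 + k = i + (k + 1) by omega]; ring
      simp only [e]
      ring

/-- The partial sums are bounded by `u 0 x`, so the series converges. As `u i ≤ D * c i`, the
remainder in `eq_sum_surv_add_killed` is at most D times the a-th term of that series and vanishes
in the limit. -/
lemma hasSum_surv {c : ℕ → ℝ} {u : ℕ → Fin (n + 1) → ℝ} (hc : ∀ i, 0 ≤ c i)
    (hz : ∀ i, u i z = 0)
    (hu : ∀ i, ∀ x < z, u i x = c i + ∑ y, K x y * u (i + 1) y) {D : ℝ}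
    (hD : ∀ i, ∀ y ≤ z, u i y ∈ Set.Icc 0 (D * c i)) {x : Fin (n + 1)} (hx : x ≤ z) :
    HasSum (fun k => c k * surv K z k x) (u 0 x) := by
  have key := fun a => h.eq_sum_surv_add_killed hz hu a 0 hx
  simp only [zero_add] at key
  have hkill := fun a => h.killed_mem_Icc (hD a) a hx
  have hnn : ∀ k, 0 ≤ c k * surv K z k x := fun k => mul_nonneg (hc k) (surv_nonneg h.nonneg k x)
  have hsum : Summable fun k => c k * surv K z k x :=
    summable_of_sum_range_le (c := u 0 x) hnn fun a => by linarith [key a, (hkill a).1]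
  rw [hsum.hasSum_iff_tendsto_nat]
  have h0 : Tendsto (fun a => killed K z (u a) a x) atTop (𝓝 0) := by
    have := (hsum.tendsto_atTop_zero).const_mul D
    rw [mul_zero] at this
    exact squeeze_zero (fun a => (hkill a).1) (fun a => by linarith [(hkill a).2]) this
  have := (tendsto_const_nhds (x := u 0 x)).sub h0
  rw [sub_zero] at this
  exact this.congr fun a => by linarith [key a]

lemma hasSum_surv_upMean {x : Fin (n + 1)} (hx : x ≤ z) :
    HasSum (fun k => surv K z k x) (upMean K π z x) := by
  have := h.hasSum_surv (z := z) (c := fun _ => 1) (u := fun _ y => upMean K π z y)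
    (D := upMean K π z 0) (fun _ => zero_le_one) (fun _ => upMean_self _)
    (fun _ x hx => by rw [h.sum_mul_upMean (Fin.is_le z) (Fin.lt_def.1 hx)]; ring)
    (fun _ y _ => ⟨h.upMean_nonneg _ _, by
      rw [mul_one]; exact h.upMean_anti _ (Nat.zero_le _)⟩) hx
  simpa using this

lemma upMean_le_sq {x : Fin (n + 1)} (hx : x ≤ z) : upMean K π z x ≤ upMean K π z x ^ 2 := by
  rcases eq_or_lt_of_le hx with rfl | hx
  · simp [upMean_self]
  · have := h.one_le_upMean (Fin.is_le z) (Fin.lt_def.1 hx)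
    nlinarith

/-- The series is E[τ²], so `upVar - upMean` is the discrete time variance. -/
lemma hasSum_surv_upVar {x : Fin (n + 1)} (hx : x ≤ z) :
    HasSum (fun k : ℕ => (2 * k + 1 : ℝ) * surv K z k x)
      (upVar K π z x - upMean K π z x + upMean K π z x ^ 2) := by
  -- With τ the hitting time of z, `u k` is E[(τ + k)² - k²]; the term linear in k is what closes
  -- the recursion.
  have := h.hasSum_surv (z := z) (c := fun k => 2 * k + 1)
    (u := fun k y => upVar K π z y - upMean K π z y + upMean K π z y ^ 2 + 2 * k * upMean K π z y)
    (D := upVar K π z 0 + upMean K π z 0 ^ 2 + upMean K π z 0) (fun _ => by positivity)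
    (fun _ => by simp [upMean_self, upVar_self])
    (fun i x hx => ?_) (fun i y hy => ⟨?_, ?_⟩) hx
  · simpa using this
  · have h1 := h.sum_mul_upMean (Fin.is_le z) (Fin.lt_def.1 hx)
    have h2 := h.sum_mul_upVar_add (Fin.is_le z) (Fin.lt_def.1 hx) 1
    have e : ∑ y, K x y * (upVar K π z y - upMean K π z y + upMean K π z y ^ 2 +
        2 * ((i + 1 : ℕ) : ℝ) * upMean K π z y) =
        ∑ y, K x y * (upVar K π z y + (upMean K π z y - (1 - 1)) ^ 2) +
          (2 * i + 1) * ∑ y, K x y * upMean K π z y := by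
      rw [Finset.mul_sum, ← Finset.sum_add_distrib]
      exact Finset.sum_congr rfl fun _ _ => by push_cast; ring
    rw [e, h1, h2]; ring
  · have h1 := h.upMean_le_sq hy
    have h2 := h.upVar_nonneg z y
    have h3 := h.upMean_nonneg z y
    have : 0 ≤ 2 * (i : ℝ) * upMean K π z y := by positivity
    linarith
  · have h1 : upMean K π z y ≤ upMean K π z 0 := h.upMean_anti _ (Nat.zero_le _)
    have h2 : upVar K π z y ≤ upVar K π z 0 := h.upVar_anti _ (Nat.zero_le _)
    have h3 := h.upMean_nonneg z y
    have h4 := h.upVar_nonneg z 0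
    have h5 : upMean K π z y ^ 2 ≤ upMean K π z 0 ^ 2 := by gcongr
    have hi : (0 : ℝ) ≤ i := i.cast_nonneg
    nlinarith [mul_le_mul_of_nonneg_left h1 hi, mul_nonneg hi h4, mul_nonneg hi (sq_nonneg (upMean K π z 0))]

/-- Markov's inequality, from the series for the mean and monotonicity in time. -/
lemma mul_surv_le_upMean (a : ℕ) {x : Fin (n + 1)} (hx : x ≤ z) :
    a * surv K z a x ≤ upMean K π z x := by
  have h1 := (h.hasSum_surv_upMean hx).summable.sum_le_tsum (Finset.range a)
    fun k _ => surv_nonneg h.nonneg k x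
  rw [(h.hasSum_surv_upMean hx).tsum_eq] at h1
  have := Finset.card_nsmul_le_sum (Finset.range a) (fun k => surv K z k x)
    (surv K z a x) fun k hk => h.surv_antitone x (Finset.mem_range.1 hk).le
  simp at this
  linarith

end IsBD

end Survival

/-! ### Spectral gap, Hardy inequality and capacities -/

section Spectral

variable {ι : Type*} [Fintype ι] {K : Matrix ι ι ℝ} {π : ι → ℝ}

lemma wInner_smul_left (a : ℝ) (f g : ι → ℝ) : wInner π (a • f) g = a * wInner π f g := by
  simp only [wInner, Finset.mul_sum, Pi.smul_apply, smul_eq_mul]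
  exact Finset.sum_congr rfl fun _ _ => by ring

lemma wInner_sum_left {κ : Type*} (s : Finset κ) (f : κ → ι → ℝ) (g : ι → ℝ) :
    wInner π (∑ i ∈ s, f i) g = ∑ i ∈ s, wInner π (f i) g := by
  simp only [wInner, Finset.sum_apply, Finset.sum_mul, Finset.mul_sum]
  exact Finset.sum_comm

/-- Conjugation by √π turns K into a symmetric matrix; its orthonormal eigenvectors divided by √π
are orthonormal in L²(π). Eigenvalues are recorded as those of I - K. -/
lemma IsReversible.exists_eigenbasis [DecidableEq ι] (h : IsReversible K π) (hπ : ∀ x, 0 < π x) :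
    ∃ (μ : ι → ℝ) (b : ι → ι → ℝ), (∀ i, K.mulVec (b i) = (1 - μ i) • b i) ∧
      (∀ i, wInner π (b i) (b i) = 1) ∧ ∀ f : ι → ℝ, f = ∑ i, wInner π (b i) f • b i := by
  have hs : ∀ x, 0 < √(π x) := fun x => Real.sqrt_pos.2 (hπ x)
  have hss : ∀ x, √(π x) * √(π x) = π x := fun x => Real.mul_self_sqrt (hπ x).le
  set A : Matrix ι ι ℝ := Matrix.of fun x y => √(π x) * K x y / √(π y) with hA
  have hAh : A.IsHermitian := by
    ext x y
    have := h.balance x y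
    simp only [hA, Matrix.conjTranspose_apply, Matrix.of_apply, star_trivial]
    rw [div_eq_div_iff (hs x).ne' (hs y).ne']
    linear_combination K y x * hss y - K x y * hss x - this
  set v := hAh.eigenvectorBasis
  refine ⟨fun i => 1 - hAh.eigenvalues i, fun i x => v i x / √(π x), fun i => ?_, fun i => ?_,
    fun f => ?_⟩
  · have h1 := hAh.mulVec_eigenvectorBasis i
    ext x
    have h2 := congrFun h1 x
    simp only [Matrix.mulVec, dotProduct, hA, Matrix.of_apply, Pi.smul_apply, smul_eq_mul,
      sub_sub_cancel] at h2 ⊢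
    rw [← mul_div_assoc, eq_div_iff (hs x).ne', ← h2, Finset.sum_mul]
    refine Finset.sum_congr rfl fun y _ => ?_
    change _ = _ * v i y
    ring
  · have h1 : inner ℝ (v i) (v i) = (1 : ℝ) := by
      rw [real_inner_self_eq_norm_sq, v.orthonormal.1 i, one_pow]
    rw [← h1, PiLp.inner_apply, wInner]
    refine Finset.sum_congr rfl fun x _ => ?_
    simp only [RCLike.inner_apply, conj_trivial]
    have := hs x
    field_simp
    rw [Real.sq_sqrt (hπ x).le]; ring
  · set w : EuclideanSpace ℝ ι := WithLp.toLp 2 fun x => √(π x) * f x with hw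
    have h1 := v.sum_repr' w
    ext x
    have h2 := congrArg (fun u : EuclideanSpace ℝ ι => u x) h1
    have e : ∀ i, wInner π (fun x => v i x / √(π x)) f = inner ℝ (v i) w := fun i => by
      rw [PiLp.inner_apply, wInner]
      refine Finset.sum_congr rfl fun y _ => ?_
      simp only [RCLike.inner_apply, conj_trivial, hw]
      have := hs y
      field_simp
      rw [Real.sq_sqrt (hπ y).le]; ring
    simp only [e, Finset.sum_apply, Pi.smul_apply, smul_eq_mul]
    simp only [WithLp.ofLp_sum, Finset.sum_apply, WithLp.ofLp_smul, Pi.smul_apply, smul_eq_mul,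
      hw] at h2
    have := hs x
    rw [← mul_right_inj' this.ne', ← h2, Finset.mul_sum]
    refine Finset.sum_congr rfl fun i _ => ?_
    rw [mul_left_comm, mul_div_cancel₀ _ this.ne']

lemma dirichlet_of_mulVec {f : ι → ℝ} {μ : ℝ} (hf : K.mulVec f = (1 - μ) • f) :
    dirichlet K π f = μ * wInner π f f := by
  rw [dirichlet, wInner_sub_left, hf, wInner_smul_left]; ring

lemma hasEigenvalue_of_mulVec [DecidableEq ι] {f : ι → ℝ} {μ : ℝ}
    (hf : K.mulVec f = (1 - μ) • f) (h0 : f ≠ 0) :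
    Module.End.HasEigenvalue (Matrix.toLin' (1 - K)) μ := by
  refine Module.End.hasEigenvalue_of_hasEigenvector (x := f) ⟨?_, h0⟩
  rw [Module.End.mem_eigenspace_iff, Matrix.toLin'_apply, Matrix.sub_mulVec, Matrix.one_mulVec,
    hf, sub_smul, one_smul, sub_sub_cancel]

lemma exists_mulVec_of_hasEigenvalue [DecidableEq ι] {μ : ℝ}
    (hμ : Module.End.HasEigenvalue (Matrix.toLin' (1 - K)) μ) :
    ∃ f : ι → ℝ, f ≠ 0 ∧ K.mulVec f = (1 - μ) • f := by
  obtain ⟨f, hf, hf0⟩ := hμ.exists_hasEigenvector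
  rw [Module.End.mem_eigenspace_iff, Matrix.toLin'_apply, Matrix.sub_mulVec,
    Matrix.one_mulVec] at hf
  exact ⟨f, hf0, by rw [sub_smul, one_smul, ← hf, sub_sub_cancel]⟩

lemma IsReversible.exists_expansion [DecidableEq ι] (h : IsReversible K π) (hπ : ∀ x, 0 < π x) :
    ∃ (μ : ι → ℝ) (b : ι → ι → ℝ), (∀ i, K.mulVec (b i) = (1 - μ i) • b i) ∧
      (∀ i, wInner π (b i) (b i) = 1) ∧ (∀ f, wInner π f f = ∑ i, wInner π (b i) f ^ 2) ∧
      ∀ f, dirichlet K π f = ∑ i, μ i * wInner π (b i) f ^ 2 := by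
  obtain ⟨μ, b, hb, hb1, hf⟩ := h.exists_eigenbasis hπ
  have hexp1 : ∀ f, wInner π f f = ∑ i, wInner π (b i) f ^ 2 := fun f => by
    calc wInner π f f = wInner π (∑ i, wInner π (b i) f • b i) f := by rw [← hf f]
      _ = _ := by
        rw [wInner_sum_left]
        exact Finset.sum_congr rfl fun i _ => by rw [wInner_smul_left, sq]
  refine ⟨μ, b, hb, hb1, hexp1, fun f => ?_⟩
  have e : wInner π f (K.mulVec f) = ∑ i, (1 - μ i) * wInner π (b i) f ^ 2 := by
    calc wInner π f (K.mulVec f) = wInner π (∑ i, wInner π (b i) f • b i) (K.mulVec f) := by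
          rw [← hf f]
      _ = _ := by
        rw [wInner_sum_left]
        refine Finset.sum_congr rfl fun i _ => ?_
        rw [wInner_smul_left, ← h.wInner_mulVec_left, hb, wInner_smul_left]; ring
  rw [dirichlet, wInner_sub_left, h.wInner_mulVec_left, hexp1, e, ← Finset.sum_sub_distrib]
  exact Finset.sum_congr rfl fun i _ => by ring

lemma IsReversible.dirichlet_add_const (h : IsReversible K π) (f : ι → ℝ) (a : ℝ) :
    dirichlet K π (fun x => f x - a) = dirichlet K π f := by
  rw [h.dirichlet_eq, h.dirichlet_eq]; simp

/-- The Poincaré inequality for functions that need not be centred. -/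
lemma Poincare.le_of_sub (h : IsReversible K π) {lam : ℝ} (hP : Poincare K π lam) (f : ι → ℝ) :
    ∃ a : ℝ, lam * ∑ x, π x * (f x - a) ^ 2 ≤ dirichlet K π f := by
  refine ⟨∑ x, π x * f x, ?_⟩
  have := hP (fun x => f x - ∑ x, π x * f x) (by
    simp only [mul_sub, Finset.sum_sub_distrib, ← Finset.sum_mul, h.weight_sum]; ring)
  rw [h.dirichlet_add_const] at this
  simpa only [wInner, ← sq] using this

end Spectral

/-! ### Resistances, the Hardy inequality and the gap of a birth and death chain -/

section Capacity

variable {n : ℕ} {K : Matrix (Fin (n + 1)) (Fin (n + 1)) ℝ} {π : Fin (n + 1) → ℝ}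

lemma finite_eigenvalues (K : Matrix (Fin (n + 1)) (Fin (n + 1)) ℝ) :
    {μ : ℝ | μ ≠ 0 ∧ Module.End.HasEigenvalue (Matrix.toLin' (1 - K)) μ}.Finite := by
  have h1 : Set.Finite (Module.End.HasEigenvalue (Matrix.toLin' (1 - K))) :=
    Module.End.finite_hasEigenvalue _
  refine h1.subset fun μ hμ => ?_
  rw [Set.mem_ofPred_eq] at hμ
  exact hμ.2

/-- A finite nonempty set attains its infimum. Nonemptiness matters, since the infimum of the empty
set is 0. -/
lemma spectralGap_mem
    (hne : ∃ μ : ℝ, μ ≠ 0 ∧ Module.End.HasEigenvalue (Matrix.toLin' (1 - K)) μ) :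
    spectralGap K ≠ 0 ∧ Module.End.HasEigenvalue (Matrix.toLin' (1 - K)) (spectralGap K) :=
  Set.Nonempty.csInf_mem hne (finite_eigenvalues K)

lemma spectralGap_le {μ : ℝ} (h0 : μ ≠ 0)
    (hμ : Module.End.HasEigenvalue (Matrix.toLin' (1 - K)) μ) : spectralGap K ≤ μ :=
  csInf_le (finite_eigenvalues K).bddBelow ⟨h0, hμ⟩

/-- The weight of `[k, n]`. -/
def tailWt (π : Fin (n + 1) → ℝ) (k : ℕ) : ℝ := ∑ i ∈ Finset.Ico k (n + 1), wt π i

/-- The effective resistance between `a` and `b`. -/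
def resist (K : Matrix (Fin (n + 1)) (Fin (n + 1)) ℝ) (π : Fin (n + 1) → ℝ) (a b : ℕ) : ℝ :=
  ∑ i ∈ Finset.Ico a b, 1 / cond K π i

namespace IsBD

variable (h : IsBD K π)
include h

lemma dirichlet_eq_edges (f : ℕ → ℝ) :
    dirichlet K π (fun x => f x) =
      ∑ k ∈ Finset.range n, cond K π k * (f k - f (k + 1)) ^ 2 := by
  have e : ∀ x : Fin (n + 1), π x * ((f x - ∑ j, K x j * f j) * f x) =
      π x * (f x * (up K x * (f x - f (x + 1)) +
        if (x : ℕ) = 0 then 0 else down K (x - 1) * (f x - f (x - 1)))) := fun x => by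
    rw [h.sum_mul_eq]; split_ifs <;> ring
  have e0 : dirichlet K π (fun x => f x) =
      ∑ x : Fin (n + 1), π x * ((f x - ∑ j, K x j * f j) * f x) := rfl
  rw [e0, Finset.sum_congr rfl fun x _ => e x,
    ← sum_range_wt (fun k => f k * (up K k * (f k - f (k + 1)) +
        if k = 0 then 0 else down K (k - 1) * (f k - f (k - 1))))]
  simp only [mul_add, Finset.sum_add_distrib]
  rw [Finset.sum_range_succ, Finset.sum_range_succ']
  have hn : up K n = 0 := by simp [up]
  simp only [hn, zero_mul, mul_zero, add_zero, if_true, Nat.add_eq_zero_iff, one_ne_zero,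
    and_false, if_false, Nat.add_sub_cancel]
  rw [← Finset.sum_add_distrib]
  refine Finset.sum_congr rfl fun k _ => ?_
  have h1 := h.cond_eq k
  rw [cond] at h1 ⊢
  linear_combination (f (k + 1) * (f k - f (k + 1))) * h1

/-- `wt` serves here as extension by zero of an arbitrary function; the artificial zeros never
enter, as all edges lie inside [0, n]. -/
lemma dirichlet_eq_edges' (f : Fin (n + 1) → ℝ) :
    dirichlet K π f =
      ∑ k ∈ Finset.range n, cond K π k * (wt f k - wt f (k + 1)) ^ 2 := by
  rw [← h.dirichlet_eq_edges]; simp [wt_coe]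

/-- Every edge of the path has positive conductance, so zero energy makes all increments vanish. -/
lemma eq_zero_of_dirichlet {f : Fin (n + 1) → ℝ} (hf : dirichlet K π f = 0) (x : Fin (n + 1)) :
    f x = f 0 := by
  rw [h.dirichlet_eq_edges', Finset.sum_eq_zero_iff_of_nonneg
    fun k _ => mul_nonneg (h.cond_nonneg k) (sq_nonneg _)] at hf
  have key : ∀ k ≤ n, wt f k = wt f 0 := fun k => by
    induction k with
    | zero => simp
    | succ k ih =>
      intro hk
      have h1 := hf k (Finset.mem_range.2 hk)
      have h2 := h.cond_pos hk
      rw [mul_eq_zero, or_iff_right h2.ne', sq_eq_zero_iff] at h1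
      linarith [ih (by omega)]
  have h3 := key x (Fin.is_le x)
  have h4 : wt f 0 = f 0 := wt_coe (π := f) 0
  rwa [wt_coe, h4] at h3

lemma cum_add_tailWt_le {a b : ℕ} (hab : a < b) (hb : b ≤ n) : cum π a + tailWt π b ≤ 1 := by
  have h1 : ∑ i ∈ Finset.range (n + 1), wt π i = 1 := h.cum_last
  rw [← h1, cum, tailWt, ← Finset.sum_range_add_sum_Ico _ (by omega : b ≤ n + 1)]
  gcongr
  · exact fun i _ _ => h.wt_nonneg i
  · omega

lemma tailWt_nonneg (k : ℕ) : 0 ≤ tailWt π k := Finset.sum_nonneg fun i _ => h.wt_nonneg i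

/-- A spectral gap bounds effective resistances. -/
lemma mul_resist_le {lam : ℝ} (hlam : 0 ≤ lam) (hP : Poincare K π lam) {a b : ℕ} (hab : a ≤ b)
    (hb : b ≤ n) : lam * (cum π a * tailWt π b * resist K π a b) ≤ 1 := by
  rcases hab.eq_or_lt with rfl | hab
  · simp [resist]
  set R := resist K π a b with hR
  have hRpos : 0 < R := Finset.sum_pos (fun i hi => one_div_pos.2 (h.cond_pos (by
    have := (Finset.mem_Ico.1 hi).2; omega))) ⟨a, Finset.mem_Ico.2 ⟨le_rfl, hab⟩⟩
  -- The equilibrium potential: R on [0, a], 0 on [b, n], with unit flow between. Its energy is R.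
  set f : ℕ → ℝ := fun k => ∑ i ∈ Finset.Ico (max k a) b, 1 / cond K π i with hf
  have hfa : ∀ k ≤ a, f k = R := fun k hk => by rw [hf]; simp [max_eq_right hk, hR, resist]
  have hfb : ∀ k, b ≤ k → f k = 0 := fun k hk => by
    rw [hf]; simp only; rw [Finset.Ico_eq_empty (by omega), Finset.sum_empty]
  have hdir : dirichlet K π (fun x => f x) = R := by
    rw [h.dirichlet_eq_edges, hR, resist,
      ← Finset.sum_subset (s₁ := Finset.Ico a b) (s₂ := Finset.range n)]
    · refine Finset.sum_congr rfl fun k hk => ?_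
      have hk' := Finset.mem_Ico.1 hk
      have h1 : f k = 1 / cond K π k + f (k + 1) := by
        rw [hf]; simp only
        rw [max_eq_left hk'.1, max_eq_left (by omega), Finset.sum_eq_sum_Ico_succ_bot hk'.2]
      have h2 := h.cond_pos (by omega : k < n)
      rw [h1]; field_simp; ring
    · intro k hk; simp at hk ⊢; omega
    · intro k _ hk
      simp only [Finset.mem_Ico, not_and, not_lt] at hk
      rcases le_or_gt a k with h1 | h1
      · rw [hfb k (hk h1), hfb (k + 1) (by have := hk h1; omega)]; ring
      · rw [hfa k h1.le, hfa (k + 1) h1]; ring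
  obtain ⟨m, hm⟩ := hP.le_of_sub h.toIsReversible fun x => f x
  rw [hdir, ← sum_range_wt (fun k => (f k - m) ^ 2),
    ← Finset.sum_range_add_sum_Ico _ (by omega : b ≤ n + 1)] at hm
  have t1 : cum π a * (R - m) ^ 2 ≤ ∑ k ∈ Finset.range b, wt π k * (f k - m) ^ 2 := by
    rw [cum, Finset.sum_mul]
    refine le_trans (le_of_eq ?_) (Finset.sum_le_sum_of_subset_of_nonneg
      (Finset.range_mono (by omega : a + 1 ≤ b))
      fun i _ _ => mul_nonneg (h.wt_nonneg i) (sq_nonneg _))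
    exact Finset.sum_congr rfl fun k hk => by
      rw [hfa k (Nat.lt_succ_iff.1 (Finset.mem_range.1 hk))]
  have t2 : tailWt π b * m ^ 2 = ∑ k ∈ Finset.Ico b (n + 1), wt π k * (f k - m) ^ 2 := by
    rw [tailWt, Finset.sum_mul]
    exact Finset.sum_congr rfl fun k hk => by rw [hfb k (Finset.mem_Ico.1 hk).1]; ring
  have hS := h.cum_nonneg a
  have hT := h.tailWt_nonneg b
  have hST := h.cum_add_tailWt_le hab hb
  -- With S and T the two weights, the minimum over m of S(R - m)² + Tm² is STR²/(S + T), and S + T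
  -- ≤ 1.
  have t3 : cum π a * tailWt π b * R ^ 2 ≤ cum π a * (R - m) ^ 2 + tailWt π b * m ^ 2 := by
    set S := cum π a
    set T := tailWt π b
    nlinarith [mul_nonneg hS (sq_nonneg (R - m)), mul_nonneg hT (sq_nonneg m),
      sq_nonneg (S * (R - m) - T * m), mul_nonneg (sub_nonneg.2 hST) (mul_nonneg hS (sq_nonneg (R - m))),
      mul_nonneg (sub_nonneg.2 hST) (mul_nonneg hT (sq_nonneg m))]
  have t4 : lam * (cum π a * tailWt π b * R ^ 2) ≤ R :=
    (mul_le_mul_of_nonneg_left (by linarith) hlam).trans hm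
  by_contra hcon
  nlinarith [not_le.1 hcon]

omit h in
-- Exchange of summations in the closed form: edge y is counted once over its own conductance and
-- twice over every later one.
lemma upVar_eq (M : ℕ) : upVar K π M 0 =
    ∑ y ∈ Finset.range M, cond K π y * passMean K π y ^ 2 *
      (2 * resist K π y M - 1 / cond K π y) := by
  induction M with
  | zero => simp [upVar]
  | succ M ih =>
    have e1 : upVar K π (M + 1) 0 = upVar K π M 0 + passVar K π M := by
      simp [upVar, Finset.sum_range_succ]
    have e2 : ∀ y ∈ Finset.range M, resist K π y (M + 1) = resist K π y M + 1 / cond K π M :=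
      fun y hy => Finset.sum_Ico_succ_top (Finset.mem_range.1 hy).le _
    have e3 : resist K π M (M + 1) = 1 / cond K π M := by simp [resist]
    rw [e1, ih, Finset.sum_range_succ, e3, Finset.sum_congr rfl fun y hy =>
      congrArg (fun r => cond K π y * passMean K π y ^ 2 * (2 * r - 1 / cond K π y)) (e2 y hy),
      passVar]
    have e4 : ∀ y, cond K π y * passMean K π y ^ 2 *
        (2 * (resist K π y M + 1 / cond K π M) - 1 / cond K π y) =
        cond K π y * passMean K π y ^ 2 * (2 * resist K π y M - 1 / cond K π y) +
        2 * (cond K π y * passMean K π y ^ 2) / cond K π M := fun y => by ring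
    simp only [e4, Finset.sum_add_distrib]
    rw [← Finset.sum_div, ← Finset.mul_sum]
    ring

/-- In each term of `upVar_eq` one factor `cond * passMean` is the weight of [0, y], which together
with the far weight and the resistance is controlled by `mul_resist_le`. A single passage mean
remains. -/
lemma mul_upVar_le {lam : ℝ} (hlam : 0 ≤ lam) (hP : Poincare K π lam) {M : ℕ} (hM : M ≤ n) :
    lam * tailWt π M * upVar K π M 0 ≤ 2 * upMean K π M 0 := by
  rw [upVar_eq, upMean, ← Finset.range_eq_Ico, Finset.mul_sum, Finset.mul_sum]
  refine Finset.sum_le_sum fun y hy => ?_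
  have hy' := Finset.mem_range.1 hy
  have h1 := h.mul_resist_le hlam hP hy'.le hM
  have h2 := h.passMean_nonneg (K := K) (π := π) y
  have h3 := h.cond_pos (by omega : y < n)
  have h4 := h.tailWt_nonneg M
  have e : cond K π y * passMean K π y = cum π y := by rw [passMean]; field_simp
  calc lam * tailWt π M * (cond K π y * passMean K π y ^ 2 *
        (2 * resist K π y M - 1 / cond K π y))
      ≤ lam * tailWt π M * (cond K π y * passMean K π y ^ 2 * (2 * resist K π y M)) := by
        gcongr
        linarith [one_div_pos.2 h3]
    _ = 2 * passMean K π y * (lam * (cum π y * tailWt π M * resist K π y M)) := by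
        rw [← e]; ring
    _ ≤ 2 * passMean K π y := mul_le_of_le_one_right (by positivity) h1

lemma mul_upMean_le {lam : ℝ} (hlam : 0 ≤ lam) (hP : Poincare K π lam) {a b : ℕ} (hab : a ≤ b)
    (hb : b ≤ n) : lam * cum π a * tailWt π b * upMean K π b a ≤ 1 := by
  refine le_trans ?_ (h.mul_resist_le hlam hP hab hb)
  have h1 : upMean K π b a ≤ resist K π a b := Finset.sum_le_sum fun i hi => by
    have := (Finset.mem_Ico.1 hi).2
    exact div_le_div_of_nonneg_right (h.cum_le_one (by omega)) (h.cond_nonneg i)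
  have := h.cum_nonneg a
  have := h.tailWt_nonneg b
  calc _ ≤ lam * cum π a * tailWt π b * resist K π a b := by gcongr
    _ = _ := by ring

lemma passMean_sq_le_passVar {k : ℕ} (hk : k < n) : passMean K π k ^ 2 ≤ passVar K π k := by
  have h1 := h.cond_pos hk
  rw [passVar, le_div_iff₀ h1]
  have : 0 ≤ ∑ y ∈ Finset.range k, cond K π y * passMean K π y ^ 2 :=
    Finset.sum_nonneg fun y _ => mul_nonneg (h.cond_nonneg y) (sq_nonneg _)
  linarith

lemma upMean_le_upVar {M : ℕ} (hM : M ≤ n) (k : ℕ) : upMean K π M k ≤ upVar K π M k :=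
  Finset.sum_le_sum fun i hi => by
    have hi' : i < n := (Finset.mem_Ico.1 hi).2.trans_le hM
    have h1 := h.passMean_sq_le_passVar hi'
    have h2 := h.one_le_passMean hi'
    nlinarith

/-- Holding forces every passage mean to be at least 1/(1 - δ), which leaves at least the fraction δ
of the variance after subtraction of the mean. -/
lemma upMean_le_mul_upVar {δ : ℝ} (hδ : ∀ x, δ ≤ K x x) {M : ℕ} (hM : M ≤ n) (k : ℕ) :
    upMean K π M k ≤ (1 - δ) * upVar K π M k := by
  rw [upVar, Finset.mul_sum]
  refine Finset.sum_le_sum fun i hi => ?_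
  have hi' : i < n := (Finset.mem_Ico.1 hi).2.trans_le hM
  have h1 := h.passMean_sq_le_passVar hi'
  have h2 := h.one_le_mul_passMean hi'
  have h3 := h.up_add_le i hi'
  have h4 := hδ ⟨i, by omega⟩
  have h5 := h.passMean_nonneg (K := K) (π := π) i
  have h6 := h.up_pos' hi'
  have h7 : 1 ≤ (1 - δ) * passMean K π i := by nlinarith
  nlinarith

/-- A Hardy inequality on `[0, M]` with the Hilbert-Schmidt constant. -/
lemma hardy {M : ℕ} (hM : M ≤ n) {f : ℕ → ℝ} (hf : f M = 0) :
    (∑ x ∈ Finset.range M, wt π x * f x ^ 2) ^ 2 ≤ upVar K π M 0 *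
      (∑ k ∈ Finset.range M, cond K π k * (f k - f (k + 1)) ^ 2) ^ 2 := by
  set d : ℕ → ℝ := fun k => f k - f (k + 1) with hd
  -- As f vanishes at M, f(x) is the sum of the increments d(k) over k ≥ x. The squared norm becomes
  -- a quadratic form in d with kernel `cum π (min k l)`.
  have I1 : ∑ x ∈ Finset.range M, wt π x * f x ^ 2 =
      ∑ k ∈ Finset.range M, ∑ l ∈ Finset.range M, cum π (min k l) * (d k * d l) := by
    have e1 : ∀ x ∈ Finset.range M, f x = ∑ k ∈ Finset.range M, if x ≤ k then d k else 0 := by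
      intro x hx
      rw [← Finset.sum_filter]
      have : Finset.filter (fun k => x ≤ k) (Finset.range M) = Finset.Ico x M := by
        ext k; simp; omega
      rw [this]
      have := Finset.sum_Ico_sub (fun k => -f k) (Finset.mem_range.1 hx).le
      simp only [neg_sub_neg, hf] at this
      rw [hd, this]; ring
    have e2 : ∀ x ∈ Finset.range M, wt π x * f x ^ 2 = ∑ k ∈ Finset.range M,
        ∑ l ∈ Finset.range M, if x ≤ min k l then wt π x * (d k * d l) else 0 := by
      intro x hx
      rw [e1 x hx, sq, Finset.sum_mul_sum, Finset.mul_sum]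
      refine Finset.sum_congr rfl fun k _ => ?_
      rw [Finset.mul_sum]
      refine Finset.sum_congr rfl fun l _ => ?_
      by_cases h1 : x ≤ k <;> by_cases h2 : x ≤ l <;> simp [h1, h2]
    rw [Finset.sum_congr rfl e2, Finset.sum_comm]
    refine Finset.sum_congr rfl fun k hk => ?_
    rw [Finset.sum_comm]
    refine Finset.sum_congr rfl fun l hl => ?_
    rw [← Finset.sum_filter, ← Finset.sum_mul, cum]
    congr 1
    refine Finset.sum_congr ?_ fun _ _ => rfl
    ext x; simp at hk hl ⊢; omega
  -- Normalised by the conductances, this kernel has squared Hilbert-Schmidt norm equal to the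
  -- hitting time variance. In the induction the new row, column and corner of the square add up to
  -- `passVar`.
  have I2 : ∀ M ≤ n, ∑ k ∈ Finset.range M, ∑ l ∈ Finset.range M,
      cum π (min k l) ^ 2 / (cond K π k * cond K π l) = upVar K π M 0 := by
    intro M
    induction M with
    | zero => simp [upVar]
    | succ M ih =>
      intro hM
      have e1 : upVar K π (M + 1) 0 = upVar K π M 0 + passVar K π M := by
        simp [upVar, Finset.sum_range_succ]
      have e2 : ∑ k ∈ Finset.range M, cum π (min k M) ^ 2 / (cond K π k * cond K π M) =
          (∑ y ∈ Finset.range M, cond K π y * passMean K π y ^ 2) / cond K π M := by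
        rw [Finset.sum_div]
        refine Finset.sum_congr rfl fun k hk => ?_
        have hk' := Finset.mem_range.1 hk
        have h1 := h.cond_pos (by omega : k < n)
        rw [min_eq_left hk'.le, passMean]; field_simp
      have e3 : ∑ k ∈ Finset.range M, cum π (min M k) ^ 2 / (cond K π M * cond K π k) =
          (∑ y ∈ Finset.range M, cond K π y * passMean K π y ^ 2) / cond K π M := by
        rw [← e2]
        exact Finset.sum_congr rfl fun k _ => by rw [min_comm, mul_comm (cond K π M)]
      have h1 := h.cond_pos (by omega : M < n)
      rw [Finset.sum_range_succ, Finset.sum_congr rfl fun k _ => Finset.sum_range_succ _ _,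
        Finset.sum_add_distrib, ih (by omega), Finset.sum_range_succ, e1, e2, e3, min_self,
        passVar]
      have e5 : cum π M ^ 2 / (cond K π M * cond K π M) =
          cond K π M * passMean K π M ^ 2 / cond K π M := by
        rw [passMean]; field_simp
      rw [e5]; ring
  rw [I1, ← I2 M hM, sq (∑ k ∈ Finset.range M, cond K π k * d k ^ 2), Finset.sum_mul_sum]
  simp only [← Finset.sum_product']
  refine Finset.sum_sq_le_sum_mul_sum_of_sq_le_mul _ (fun p hp => ?_) (fun p hp => ?_)
    fun p hp => ?_
  · exact div_nonneg (sq_nonneg _) (mul_nonneg (h.cond_nonneg _) (h.cond_nonneg _))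
  · exact mul_nonneg (mul_nonneg (h.cond_nonneg _) (sq_nonneg _))
      (mul_nonneg (h.cond_nonneg _) (sq_nonneg _))
  · rw [Finset.mem_product, Finset.mem_range, Finset.mem_range] at hp
    have h1 := h.cond_pos (by omega : p.1 < n)
    have h2 := h.cond_pos (by omega : p.2 < n)
    refine le_of_eq ?_
    field_simp

/-- Expansion in eigenfunctions: those with eigenvalue 0 have zero energy, hence are constant and
invisible to centred functions; the others have eigenvalue at least the gap. Were all eigenvalues 0,
the indicator of 0 would have zero energy and be constant, impossible for n ≥ 1. -/
lemma poincare_spectralGap (hn : 1 ≤ n) :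
    0 < spectralGap K ∧ Poincare K π (spectralGap K) ∧
      ∃ f : Fin (n + 1) → ℝ, f ≠ 0 ∧ ∑ x, π x * f x = 0 ∧
        K.mulVec f = (1 - spectralGap K) • f := by
  obtain ⟨μ, b, hb, hb1, hexp1, hexp2⟩ := h.exists_expansion h.weight_pos
  have hmem : ∀ i, μ i ≠ 0 →
      μ i ≠ 0 ∧ Module.End.HasEigenvalue (Matrix.toLin' (1 - K)) (μ i) := fun i hi => by
    refine ⟨hi, hasEigenvalue_of_mulVec (hb i) fun h0 => ?_⟩
    have := hb1 i
    rw [h0] at this; simp [wInner] at this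
  obtain ⟨hne, hev⟩ := spectralGap_mem (K := K) <| by
    by_contra! hcon
    have h0 : ∀ i, μ i = 0 := fun i => by
      by_contra hi
      exact hcon _ hi (hmem i hi).2
    have := h.eq_zero_of_dirichlet (f := fun x => if x = 0 then 1 else 0)
      (by rw [hexp2]; simp [h0]) (Fin.last n)
    simp [Fin.ext_iff] at this
    omega
  obtain ⟨f, hf0, hKf⟩ := exists_mulVec_of_hasEigenvalue hev
  have hmean : ∑ x, π x * f x = 0 := by
    have h1 := h.sum_mulVec f
    rw [hKf] at h1
    have h2 : ∑ x, π x * ((1 - spectralGap K) • f) x =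
        (1 - spectralGap K) * ∑ x, π x * f x := by
      rw [Finset.mul_sum]
      exact Finset.sum_congr rfl fun _ _ => by rw [Pi.smul_apply, smul_eq_mul]; ring
    rw [h2] at h1
    have h3 : spectralGap K * ∑ x, π x * f x = 0 := by linarith
    exact (mul_eq_zero.1 h3).resolve_left hne
  have hpos : 0 < wInner π f f := by
    refine lt_of_le_of_ne (wInner_self_nonneg h.weight_nonneg f) fun h0 => hf0 ?_
    rw [wInner, eq_comm, Finset.sum_eq_zero_iff_of_nonneg
      fun x _ => mul_nonneg (h.weight_nonneg x) (mul_self_nonneg _)] at h0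
    ext x
    have := h0 x (Finset.mem_univ x)
    rw [mul_eq_zero, or_iff_right (h.weight_pos x).ne', mul_self_eq_zero] at this
    exact this
  have hgap : 0 < spectralGap K := by
    have h1 := dirichlet_of_mulVec (π := π) hKf
    have h2 := h.dirichlet_nonneg f
    rw [h1] at h2
    exact lt_of_le_of_ne (nonneg_of_mul_nonneg_left h2 hpos) hne.symm
  refine ⟨hgap, fun g hg => ?_, f, hf0, hmean, hKf⟩
  rw [hexp1, hexp2, Finset.mul_sum]
  refine Finset.sum_le_sum fun i _ => ?_
  by_cases hi : μ i = 0
  · have h1 := dirichlet_of_mulVec (π := π) (hb i)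
    rw [hi, zero_mul] at h1
    have h2 : wInner π (b i) g = 0 := by
      rw [wInner]
      have : ∀ x, π x * (b i x * g x) = b i 0 * (π x * g x) := fun x => by
        rw [h.eq_zero_of_dirichlet h1 x]; ring
      rw [Finset.sum_congr rfl fun x _ => this x, ← Finset.mul_sum, hg, mul_zero]
    rw [h2]; simp
  · exact mul_le_mul_of_nonneg_right (spectralGap_le hi (hmem i hi).2) (sq_nonneg _)

end IsBD

end Capacity

/-! ### Constructions: irreducible chains, reversal, half-lazy version -/

section Constructions

variable {n : ℕ} {K : Matrix (Fin (n + 1)) (Fin (n + 1)) ℝ} {π : Fin (n + 1) → ℝ}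

/-- With a zero birth rate at i the set [0, i] is closed, which contradicts irreducibility; hence
`up_pos` in `isBD`. -/
lemma BirthDeathChain.pow_eq_zero (C : BirthDeathChain n) {i : Fin n}
    (hi : C.K i.castSucc i.succ = 0) (k : ℕ) (a b : Fin (n + 1)) (ha : a ≤ i.castSucc)
    (hb : i.castSucc < b) : (C.K ^ k) a b = 0 := by
  induction k generalizing b with
  | zero => rw [pow_zero, Matrix.one_apply_ne (ha.trans_lt hb).ne]
  | succ k ih =>
    rw [pow_succ, Matrix.mul_apply]
    refine Finset.sum_eq_zero fun j _ => ?_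
    rcases lt_or_ge i.castSucc j with hj | hj
    · rw [ih j hj, zero_mul]
    · have : C.K j b = 0 := by
        by_cases h : j = i.castSucc ∧ b = i.succ
        · rw [h.1, h.2, hi]
        · refine C.nearest j b (Or.inl ?_)
          simp only [Fin.ext_iff, Fin.le_def, Fin.lt_def, Fin.val_castSucc, Fin.val_succ] at *
          omega
      rw [this, mul_zero]

/-- Stationarity says that the net flux out of every vertex is zero. On a path this propagates from
the end 0 along the edges and makes every edge flux zero, which is detailed balance. -/
lemma BirthDeathChain.isBD (C : BirthDeathChain n) (hπ : IsStationary C.K π) : IsBD C.K π := by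
  have hpow := (Matrix.isIrreducible_iff_exists_pow_pos C.nonneg).1 C.irreducible
  have hpownn : ∀ k i j, 0 ≤ (C.K ^ k) i j := fun k => by
    induction k with
    | zero => intro i j; rw [pow_zero, Matrix.one_apply]; split_ifs <;> norm_num
    | succ k ih =>
      intro i j
      rw [pow_succ, Matrix.mul_apply]
      exact Finset.sum_nonneg fun l _ => mul_nonneg (ih _ _) (C.nonneg _ _)
  have hstat : ∀ k, Matrix.vecMul π (C.K ^ k) = π := fun k => by
    induction k with
    | zero => simp
    | succ k ih => rw [pow_succ, ← Matrix.vecMul_vecMul, ih, hπ.stationary]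
  have hpos : ∀ x, 0 < π x := fun x => by
    obtain ⟨y, hy⟩ : ∃ y, 0 < π y := by
      by_contra! hcon
      have h0 : ∑ i, π i = 0 := Finset.sum_eq_zero fun i _ => le_antisymm (hcon i) (hπ.nonneg i)
      linarith [hπ.sum_one]
    obtain ⟨k, -, hk⟩ := hpow y x
    rw [← hstat k]
    exact (mul_pos hy hk).trans_le (Finset.single_le_sum (f := fun i => π i * (C.K ^ k) i x)
      (fun i _ => mul_nonneg (hπ.nonneg i) (hpownn k i x)) (Finset.mem_univ y))
  have hflux : ∀ x, ∑ y, (π x * C.K x y - π y * C.K y x) = 0 := fun x => by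
    have h1 : ∑ y, π y * C.K y x = π x := congrFun hπ.stationary x
    rw [Finset.sum_sub_distrib, h1, ← Finset.mul_sum, C.row_sum, mul_one, sub_self]
  have hadj : ∀ k (hk : k < n), π ⟨k, by omega⟩ * C.K ⟨k, by omega⟩ ⟨k + 1, by omega⟩ -
      π ⟨k + 1, by omega⟩ * C.K ⟨k + 1, by omega⟩ ⟨k, by omega⟩ = 0 := fun k => by
    induction k with
    | zero =>
      intro hk
      rw [← hflux ⟨0, by omega⟩, eq_comm]
      refine Finset.sum_eq_single _ (fun y _ hy => ?_) (by simp)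
      rcases Nat.eq_zero_or_pos y with h0 | h0
      · rw [show y = ⟨0, by omega⟩ from Fin.ext h0]
        ring
      · have : 1 < (y : ℕ) := by
          rw [Ne, Fin.ext_iff] at hy; simp at hy; omega
        rw [C.nearest _ y (Or.inl (by simpa using this)),
          C.nearest y _ (Or.inr (by simpa using this))]; ring
    | succ k ih =>
      intro hk
      rw [← hflux ⟨k + 1, by omega⟩, eq_comm]
      refine Finset.sum_eq_single _ (fun y _ hy => ?_) (by simp)
      rw [Ne, Fin.ext_iff] at hy
      simp only at hy
      by_cases h0 : (y : ℕ) = k + 1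
      · rw [show y = ⟨k + 1, by omega⟩ from Fin.ext h0]
        ring
      by_cases h1 : (y : ℕ) = k
      · rw [show y = ⟨k, by omega⟩ from Fin.ext h1]
        linarith [ih (by omega)]
      rw [C.nearest _ y (by simp only; omega), C.nearest y _ (by simp only; omega)]; ring
  refine { nonneg := C.nonneg, row_sum := C.row_sum, weight_nonneg := hπ.nonneg,
           weight_sum := hπ.sum_one, balance := fun x y => ?_, weight_pos := hpos,
           nearest := C.nearest, up_pos := fun i => ?_ }
  · obtain ⟨x, hx⟩ := x
    obtain ⟨y, hy⟩ := y
    by_cases h1 : y = x + 1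
    · subst h1; linarith [hadj x (by omega)]
    by_cases h2 : x = y + 1
    · subst h2; linarith [hadj y (by omega)]
    by_cases h3 : x = y
    · subst h3; rfl
    rw [C.nearest ⟨x, hx⟩ ⟨y, hy⟩ (by simp only; omega),
      C.nearest ⟨y, hy⟩ ⟨x, hx⟩ (by simp only; omega)]; ring
  · refine lt_of_le_of_ne (C.nonneg _ _) fun h0 => ?_
    obtain ⟨k, -, hk⟩ := hpow i.castSucc i.succ
    rw [C.pow_eq_zero h0.symm k _ _ le_rfl (by simp)] at hk
    exact lt_irrefl _ hk

/-- The matrix of the reflected chain. -/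
def revK (K : Matrix (Fin (n + 1)) (Fin (n + 1)) ℝ) : Matrix (Fin (n + 1)) (Fin (n + 1)) ℝ :=
  K.submatrix Fin.rev Fin.rev

/-- The weights of the reflected chain. -/
def revW (π : Fin (n + 1) → ℝ) : Fin (n + 1) → ℝ := π ∘ Fin.rev

/-- The matrix of the half-lazy chain. -/
def halfK (K : Matrix (Fin (n + 1)) (Fin (n + 1)) ℝ) : Matrix (Fin (n + 1)) (Fin (n + 1)) ℝ :=
  (1 / 2 : ℝ) • (1 + K)

lemma revK_apply (x y : Fin (n + 1)) : revK K x y = K x.rev y.rev := rfl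

lemma revW_apply (x : Fin (n + 1)) : revW π x = π x.rev := rfl

lemma revK_revK : revK (revK K) = K := by ext x y; simp [revK_apply]

lemma revW_revW : revW (revW π) = π := by ext x; simp [revW_apply]

lemma sum_rev (f : Fin (n + 1) → ℝ) : ∑ x : Fin (n + 1), f x.rev = ∑ x, f x :=
  Equiv.sum_comp Fin.revPerm f

lemma revK_pow (m : ℕ) : revK K ^ m = revK (K ^ m) := by
  induction m with
  | zero => ext x y; simp [revK_apply, Matrix.one_apply]
  | succ m ih =>
    ext x y
    rw [pow_succ, ih, Matrix.mul_apply, revK_apply, pow_succ, Matrix.mul_apply, ← sum_rev]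
    simp [revK_apply]

lemma revK_mulVec (f : Fin (n + 1) → ℝ) : (revK K).mulVec (f ∘ Fin.rev) = K.mulVec f ∘ Fin.rev := by
  ext x
  rw [mulVec_eq_sum, Function.comp_apply, mulVec_eq_sum, ← sum_rev]
  simp [revK_apply]

lemma wInner_rev (f g : Fin (n + 1) → ℝ) :
    wInner (revW π) (f ∘ Fin.rev) (g ∘ Fin.rev) = wInner π f g := by
  rw [wInner, wInner, ← sum_rev fun x => π x * (f x * g x)]
  rfl

lemma Poincare.rev {lam : ℝ} (hP : Poincare K π lam) : Poincare (revK K) (revW π) lam := by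
  intro f hf
  obtain ⟨g, rfl⟩ : ∃ g, f = g ∘ Fin.rev := ⟨f ∘ Fin.rev, by ext x; simp⟩
  have := hP g (by rw [← sum_rev]; exact hf)
  rw [wInner_rev, dirichlet, revK_mulVec]
  convert this using 1
  exact wInner_rev (g - K.mulVec g) g

lemma wt_rev {k : ℕ} (hk : k ≤ n) : wt (revW π) k = wt π (n - k) := by
  rw [wt, wt, dif_pos (by omega), dif_pos (by omega), revW_apply]
  congr 1; ext; simp [Fin.val_rev]

lemma halfK_apply (x y : Fin (n + 1)) :
    halfK K x y = (if x = y then 1 / 2 else 0) + K x y / 2 := by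
  rw [halfK, Matrix.smul_apply, Matrix.add_apply, Matrix.one_apply, smul_eq_mul]
  split_ifs <;> ring

lemma halfK_mulVec (f : Fin (n + 1) → ℝ) :
    (halfK K).mulVec f = (1 / 2 : ℝ) • (f + K.mulVec f) := by
  rw [halfK, Matrix.smul_mulVec, Matrix.add_mulVec, Matrix.one_mulVec]

lemma Poincare.half {lam : ℝ} (hP : Poincare K π lam) : Poincare (halfK K) π (lam / 2) := by
  intro f hf
  have h1 := hP f hf
  have : dirichlet (halfK K) π f = dirichlet K π f / 2 := by
    simp only [dirichlet, halfK_mulVec, wInner_sub_left, wInner_smul_left, wInner_add_left]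
    ring
  rw [this]; linarith

namespace IsBD

variable (h : IsBD K π)
include h

lemma rev : IsBD (revK K) (revW π) where
  nonneg x y := h.nonneg _ _
  row_sum x := by
    rw [← h.row_sum x.rev, ← sum_rev]; simp [revK_apply]
  weight_nonneg x := h.weight_nonneg _
  weight_sum := by rw [← h.weight_sum, ← sum_rev π]; rfl
  balance x y := h.balance _ _
  weight_pos x := h.weight_pos _
  nearest i j hij := h.nearest _ _ (by simp only [Fin.val_rev]; omega)
  up_pos i := by
    rw [revK_apply, Fin.rev_castSucc, Fin.rev_succ]
    have := h.down_pos i.rev.2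
    rwa [down, dif_pos i.rev.2] at this

lemma half : IsBD (halfK K) π where
  nonneg x y := by
    rw [halfK_apply]; have := h.nonneg x y; split_ifs <;> linarith
  row_sum x := by
    simp only [halfK_apply, Finset.sum_add_distrib, ← Finset.sum_div, h.row_sum]
    simp; norm_num
  weight_nonneg := h.weight_nonneg
  weight_sum := h.weight_sum
  balance x y := by
    have := h.balance x y
    rcases eq_or_ne x y with rfl | hxy
    · rfl
    · rw [halfK_apply, halfK_apply, if_neg hxy, if_neg hxy.symm]; linarith
  weight_pos := h.weight_pos
  nearest i j hij := by
    rw [halfK_apply, h.nearest i j hij, if_neg (by rintro rfl; omega)]; simp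
  up_pos i := by
    rw [halfK_apply, if_neg (by simp [Fin.ext_iff])]
    linarith [h.up_pos i]

omit h in
lemma cond_half (k : ℕ) : cond (halfK K) π k = cond K π k / 2 := by
  rw [cond, cond, up, up]
  split_ifs
  · rw [halfK_apply, if_neg (by simp [Fin.ext_iff])]; ring
  · simp

omit h in
lemma passMean_half (k : ℕ) : passMean (halfK K) π k = 2 * passMean K π k := by
  rw [passMean, passMean, cond_half]; field_simp

omit h in
lemma passVar_half (k : ℕ) : passVar (halfK K) π k = 4 * passVar K π k := by
  have e : ∀ k, cond (halfK K) π k * passMean (halfK K) π k ^ 2 =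
      2 * (cond K π k * passMean K π k ^ 2) := fun k => by rw [passMean_half, cond_half]; ring
  rw [passVar, passVar, e, cond_half]
  simp only [e, ← Finset.mul_sum]
  ring

omit h in
lemma upMean_half (z k : ℕ) : upMean (halfK K) π z k = 2 * upMean K π z k := by
  simp only [upMean, passMean_half, Finset.mul_sum]

omit h in
lemma upVar_half (z k : ℕ) : upVar (halfK K) π z k = 4 * upVar K π z k := by
  simp only [upVar, passVar_half, Finset.mul_sum]

lemma half_lazy (x : Fin (n + 1)) : 1 / 2 ≤ halfK K x x := by
  rw [halfK_apply, if_pos rfl]; linarith [h.nonneg x x]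

lemma cond_rev {k : ℕ} (hk : k < n) : cond (revK K) (revW π) k = cond K π (n - (k + 1)) := by
  rw [h.rev.cond_eq, wt_rev (by omega), cond, down, up, dif_pos hk, dif_pos (by omega), revK_apply]
  congr 2
  · ext; simp [Fin.val_rev]
  · ext; simp [Fin.val_rev]; omega

lemma hardy_le {M : ℕ} (hM : M ≤ n) {f : ℕ → ℝ} (hf : f M = 0) {α : ℝ} (hα : 0 ≤ α)
    (hV : upVar K π M 0 ≤ α ^ 2) :
    ∑ x ∈ Finset.range M, wt π x * f x ^ 2 ≤
      α * ∑ k ∈ Finset.range M, cond K π k * (f k - f (k + 1)) ^ 2 := by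
  have h1 := h.hardy hM hf
  have h2 : 0 ≤ ∑ k ∈ Finset.range M, cond K π k * (f k - f (k + 1)) ^ 2 :=
    Finset.sum_nonneg fun k _ => mul_nonneg (h.cond_nonneg k) (sq_nonneg _)
  refine le_of_sq_le_sq (h1.trans ?_) (by positivity)
  rw [mul_pow]
  gcongr

/-- Poincaré inequality with the variance of the hitting times of `M` from both ends. -/
lemma poincare_of_upVar {M : ℕ} (hM : M ≤ n) {α : ℝ} (hα : 0 < α) (hL : upVar K π M 0 ≤ α ^ 2)
    (hR : upVar (revK K) (revW π) (n - M) 0 ≤ α ^ 2) : Poincare K π (1 / α) := by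
  intro f hf
  -- Centring at the value at M, not at the mean, only enlarges the second moment of a centred f. A
  -- function vanishing at M splits into two sides, and Hardy's inequality applies to each, on the
  -- right after reflection.
  set a : ℝ := wt f M with ha
  set g : ℕ → ℝ := fun k => wt f k - a with hg
  have e0 : wInner π f f ≤ ∑ k ∈ Finset.range (n + 1), wt π k * g k ^ 2 := by
    rw [sum_range_wt fun k => g k ^ 2]
    have : ∑ x, π x * g x ^ 2 = wInner π f f + (-2 * a) * ∑ x, π x * f x + a ^ 2 * ∑ x, π x := by
      rw [wInner, Finset.mul_sum, Finset.mul_sum, ← Finset.sum_add_distrib,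
        ← Finset.sum_add_distrib]
      refine Finset.sum_congr rfl fun x _ => ?_
      simp only [hg, wt_coe]; ring
    rw [this, hf, h.weight_sum]
    nlinarith [sq_nonneg a]
  have e1 : ∑ k ∈ Finset.range (n + 1), wt π k * g k ^ 2 =
      ∑ k ∈ Finset.range M, wt π k * g k ^ 2 +
      ∑ j ∈ Finset.range (n - M), wt (revW π) j * g (n - j) ^ 2 := by
    rw [← Finset.sum_range_add_sum_Ico _ (by omega : M ≤ n + 1)]
    congr 1
    have h1 := Finset.sum_Ico_reflect (fun k => wt π k * g k ^ 2) 0 (m := n - M + 1) (n := n)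
      (by omega)
    rw [show n + 1 - (n - M + 1) = M by omega, Nat.sub_zero] at h1
    rw [← h1, ← Finset.range_eq_Ico, Finset.sum_range_succ, show n - (n - M) = M by omega]
    have : g M = 0 := by simp [hg, ha]
    rw [this]
    simp only [ne_eq, OfNat.ofNat_ne_zero, not_false_eq_true, zero_pow, mul_zero, add_zero]
    refine Finset.sum_congr rfl fun j hj => ?_
    rw [wt_rev (by have := Finset.mem_range.1 hj; omega)]
  have e2 : dirichlet K π f = ∑ k ∈ Finset.range M, cond K π k * (g k - g (k + 1)) ^ 2 +
      ∑ j ∈ Finset.range (n - M),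
        cond (revK K) (revW π) j * (g (n - j) - g (n - (j + 1))) ^ 2 := by
    rw [h.dirichlet_eq_edges', ← Finset.sum_range_add_sum_Ico _ hM]
    congr 1
    · exact Finset.sum_congr rfl fun k _ => by simp [hg]
    · rcases Nat.eq_zero_or_pos n with rfl | hn
      · simp
      have h1 := Finset.sum_Ico_reflect (fun k => cond K π k * (wt f k - wt f (k + 1)) ^ 2) 0
        (m := n - M) (n := n - 1) (by omega)
      rw [show n - 1 + 1 - (n - M) = M by omega, show n - 1 + 1 - 0 = n by omega] at h1
      rw [← h1, ← Finset.range_eq_Ico]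
      refine Finset.sum_congr rfl fun j hj => ?_
      have hj' := Finset.mem_range.1 hj
      rw [h.cond_rev (by omega), show n - 1 - j = n - (j + 1) by omega,
        show n - (j + 1) + 1 = n - j by omega]
      simp only [hg]; ring
  have l1 := h.hardy_le hM (f := g) (by simp [hg, ha]) hα.le hL
  have l2 := h.rev.hardy_le (M := n - M) (Nat.sub_le _ _) (f := fun j => g (n - j))
    (by simp [hg, ha, show n - (n - M) = M by omega]) hα.le hR
  rw [one_div, inv_mul_le_iff₀ hα, e2, mul_add]
  linarith

end IsBD

end Constructions

/-! ### Mixing after and before the hitting times -/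

section Mixing

lemma pow_mulVec_succ {ι : Type*} [Fintype ι] [DecidableEq ι] (K : Matrix ι ι ℝ) (g : ι → ℝ)
    (k : ℕ) : (K ^ (k + 1)).mulVec g = K.mulVec ((K ^ k).mulVec g) := by
  rw [Matrix.mulVec_mulVec, pow_succ']

lemma wInner_self_le_one {ι : Type*} [Fintype ι] {K : Matrix ι ι ℝ} {π g : ι → ℝ}
    (h : IsReversible K π) (hg : ∀ x, |g x| ≤ 1) : wInner π g g ≤ 1 := by
  rw [← h.weight_sum]
  refine Finset.sum_le_sum fun x _ => mul_le_of_le_one_right (h.weight_nonneg x) ?_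
  rw [← abs_mul_abs_self]
  exact mul_le_one₀ (hg x) (abs_nonneg _) (hg x)

/-- The constant in `exists_maximal` tends to 0 as A grows. -/
lemma exists_large_maximal_const (δ c : ℝ) {ε : ℝ} (hε : 0 < ε) :
    ∃ A : ℝ, 0 < A ∧ c * (1 / (2 * δ * A) + (1 / √A) * (1 / (4 * δ ^ 2) + 1 / δ)) ≤ ε := by
  have h1 : Tendsto (fun A : ℝ => c * (1 / (2 * δ) * A⁻¹ + (√A)⁻¹ * (1 / (4 * δ ^ 2) + 1 / δ)))
      atTop (𝓝 (c * (1 / (2 * δ) * 0 + 0 * (1 / (4 * δ ^ 2) + 1 / δ)))) :=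
    ((tendsto_inv_atTop_zero.const_mul _).add
      ((tendsto_inv_atTop_zero.comp Real.tendsto_sqrt_atTop).mul_const _)).const_mul _
  simp only [mul_zero, zero_mul, add_zero] at h1
  obtain ⟨A, hA, hA0⟩ := ((h1.eventually (gt_mem_nhds hε)).and (eventually_gt_atTop 0)).exists
  refine ⟨A, hA0, le_trans (le_of_eq ?_) hA.le⟩
  simp only [one_div, mul_inv]

namespace IsBD

variable {n : ℕ} {K : Matrix (Fin (n + 1)) (Fin (n + 1)) ℝ} {π : Fin (n + 1) → ℝ}

/-- The last w whose tail is still at least c/2: the next tail is smaller, so [M, w] carries the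
rest of the mass c. This stretch supplies the targets z of `orbit_le_of_mixing`. -/
lemma exists_quantile {c : ℝ} (hc : 0 < c) {M : Fin (n + 1)} (hM : c ≤ tailWt π M) :
    ∃ w : Fin (n + 1), M ≤ w ∧ c / 2 ≤ tailWt π w ∧ c / 2 ≤ ∑ z ∈ Finset.Icc M w, π z := by
  classical
  set P : ℕ → Prop := fun k => c / 2 ≤ tailWt π k
  have hPM : P M := by change c / 2 ≤ _; linarith
  set w := Nat.findGreatest P n
  have hMw : (M : ℕ) ≤ w := Nat.le_findGreatest (Fin.is_le M) hPM
  have hw : P w := Nat.findGreatest_spec (Fin.is_le M) hPM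
  have hwn : w ≤ n := Nat.findGreatest_le n
  have hnext : tailWt π (w + 1) < c / 2 := by
    rcases hwn.eq_or_lt with h1 | h1
    · rw [h1]; simp [tailWt]; exact hc
    · exact not_le.1 (Nat.findGreatest_is_greatest (P := P) (Nat.lt_succ_self w) h1)
  refine ⟨⟨w, by omega⟩, hMw, hw, ?_⟩
  have h1 : tailWt π M = ∑ i ∈ Finset.Ico (M : ℕ) (w + 1), wt π i + tailWt π (w + 1) :=
    (Finset.sum_Ico_consecutive _ (by omega) (by omega)).symm
  have h2 : ∑ i ∈ Finset.Ico (M : ℕ) (w + 1), wt π i =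
      ∑ z ∈ Finset.Icc M ⟨w, by omega⟩, π z := by
    rw [← Finset.sum_map (Finset.Icc M ⟨w, by omega⟩) Fin.valEmbedding (wt π) |>.trans
      (Finset.sum_congr rfl fun z _ => wt_coe z)]
    refine Finset.sum_congr ?_ fun _ _ => rfl
    rw [Fin.map_valEmbedding_Icc]
    ext i; simp
  linarith

lemma surv_le_of_late (h : IsBD K π) {M x : Fin (n + 1)} (hx : x ≤ M) {α B : ℝ} (hα : 0 < α)
    (hB : 0 < B) (hV : upVar K π M 0 ≤ α ^ 2) {a : ℕ} (ha : upMean K π M 0 + B * α ≤ a) :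
    surv K M a x ≤ 1 / B ^ 2 := by
  have hxM : upMean K π M x ≤ upMean K π M 0 := h.upMean_anti _ (Nat.zero_le _)
  have hxV : upVar K π M x ≤ α ^ 2 := (h.upVar_anti _ (Nat.zero_le _)).trans hV
  have hBα : 0 < B * α := by positivity
  have h1 := h.surv_mul_sq_le a (t := upMean K π M x) (by linarith) hx
  rw [sub_self, sq (0 : ℝ), mul_zero, add_zero] at h1
  have h2 : B * α ≤ a + 1 - upMean K π M x := by linarith
  have h3 : (B * α) ^ 2 ≤ (a + 1 - upMean K π M x) ^ 2 := by gcongr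
  have h5 := mul_le_mul_of_nonneg_left h3 (surv_nonneg h.nonneg (z := M) a x)
  have h6 : surv K M a x * B ^ 2 * α ^ 2 ≤ 1 * α ^ 2 := by
    rw [mul_pow, ← mul_assoc] at h5; linarith
  rw [le_div_iff₀ (by positivity)]
  exact le_of_mul_le_mul_right h6 (by positivity)

/-- The mean travel time from M to w is at most 2/(c² lam), because both sides of [M, w] have weight
of order c; then Markov's inequality. -/
lemma surv_le_of_quantile (h : IsBD K π) {lam c J : ℝ} (hlam : 0 < lam) (hP : Poincare K π lam)
    (hc : 0 < c) (hJ : 0 < J) {M z w : Fin (n + 1)} (hcM : c ≤ cum π M) (hw : c / 2 ≤ tailWt π w)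
    (hMz : M ≤ z) (hzw : z ≤ w) {b : ℕ} (hb : J * (1 / lam) ≤ b) :
    surv K z b M ≤ 2 / (c ^ 2 * J) := by
  have h1 := h.mul_surv_le_upMean b hMz
  have h2 : upMean K π z M ≤ upMean K π w M := h.upMean_mono hzw _
  have h3 := h.mul_upMean_le hlam.le hP (a := M) (b := w) (hMz.trans hzw) (Fin.is_le w)
  have h4 := surv_nonneg h.nonneg (z := z) b M
  have h5 : lam * (c * (c / 2)) * upMean K π w M ≤ 1 := by
    refine le_trans ?_ h3
    rw [mul_assoc lam (cum π M)]
    have := h.upMean_nonneg w M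
    have := h.cum_nonneg M
    gcongr
  have h6 : J * (1 / lam) * surv K z b M ≤ upMean K π w M :=
    (mul_le_mul_of_nonneg_right hb h4).trans (h1.trans h2)
  have h7 : lam * (c * (c / 2)) * (J * (1 / lam) * surv K z b M) ≤ 1 :=
    (mul_le_mul_of_nonneg_left h6 (by positivity)).trans h5
  have h8 : lam * (c * (c / 2)) * (J * (1 / lam) * surv K z b M) =
      surv K z b M * (c ^ 2 * J) / 2 := by
    field_simp
  rw [le_div_iff₀ (by positivity)]
  linarith

/-- Orbits of centred functions are small after the hitting time of `M` from the left. -/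
theorem orbit_le_of_mixing {c δ ε : ℝ} (hc : 0 < c) (hδ0 : 0 < δ) (hε : 0 < ε) :
    ∃ D : ℝ, 0 < D ∧ ∀ {n : ℕ} {K : Matrix (Fin (n + 1)) (Fin (n + 1)) ℝ} {π : Fin (n + 1) → ℝ}
      (_ : IsBD K π) {lam θ α : ℝ} {M : Fin (n + 1)}, Poincare K π lam → 0 < lam →
      (∀ x, δ ≤ K x x) → c ≤ cum π M → c ≤ tailWt π M → upMean K π M 0 ≤ θ →
      upVar K π M 0 ≤ α ^ 2 → 1 ≤ α → 1 ≤ lam * α →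
      ∀ m : ℕ, θ + D * α ≤ m → ∀ g : Fin (n + 1) → ℝ, (∀ x, |g x| ≤ 1) → ∑ x, π x * g x = 0 →
        ∀ x ≤ M, (K ^ m).mulVec g x ≤ ε := by
  obtain ⟨A, hA0, hA⟩ := exists_large_maximal_const δ (2 / c * (4 / ε)) (by linarith : 0 < ε / 4)
  -- B1 and J make the failure to reach M, and then z, at most ε/4 each; A does the same for the
  -- maximal function averaged over [M, w]. In D the 3 pays for three roundings up, each at most α.
  set B1 : ℝ := 4 / ε + 1 with hB1
  set J : ℝ := 8 / (c ^ 2 * ε) with hJ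
  have hB1p : 0 < B1 := by positivity
  have hJp : 0 < J := by positivity
  refine ⟨B1 + J + A + 3, by positivity, ?_⟩
  intro n K π h lam θ α M hP hlam hδ hcM hcM' hθ hα hα1 hla m hm g hg1 hg0 x hx
  have hinv : 1 / lam ≤ α := by rw [div_le_iff₀ hlam]; linarith
  have hθ0 : 0 ≤ θ := (h.upMean_nonneg _ _).trans hθ
  obtain ⟨w, hMw, hw, hmass⟩ := exists_quantile hc hcM'
  set a := ⌈θ + B1 * α⌉₊ with ha
  set b := ⌈J * (1 / lam)⌉₊ with hb
  set s := ⌈A * (1 / lam)⌉₊ with hs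
  have hα0 : 0 < α := by linarith
  have ha1 : θ + B1 * α ≤ a := Nat.le_ceil _
  have ha2 : (a : ℝ) < θ + B1 * α + 1 := Nat.ceil_lt_add_one (by positivity)
  have hb1 : J * (1 / lam) ≤ b := Nat.le_ceil _
  have hb2 : (b : ℝ) < J * (1 / lam) + 1 := Nat.ceil_lt_add_one (by positivity)
  have hs1 : A * (1 / lam) ≤ s := Nat.le_ceil _
  have hs2 : (s : ℝ) < A * (1 / lam) + 1 := Nat.ceil_lt_add_one (by positivity)
  have hsum : s + (a + b) ≤ m := by
    have h1 : J * (1 / lam) ≤ J * α := by gcongr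
    have h2 : A * (1 / lam) ≤ A * α := by gcongr
    have : ((s + (a + b) : ℕ) : ℝ) ≤ m := by push_cast; linarith
    exact_mod_cast this
  set φ : ℕ → Fin (n + 1) → ℝ := fun k => (K ^ k).mulVec g with hφd
  have hφ : ∀ k, φ (k + 1) = K.mulVec (φ k) := pow_mulVec_succ K g
  have hφ0 : φ 0 = g := by simp [hφd]
  obtain ⟨B, hB, hBsum⟩ := h.toIsReversible.exists_maximal hδ0 hδ hlam hP hA0 hφ (by rwa [hφ0])
    (s := s) (m := m) (by omega) (by
      rw [mul_one_div, div_le_iff₀ hlam] at hs1; linarith)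
  have hN0 : wInner π (φ 0) (φ 0) ≤ 1 := by
    rw [hφ0]; exact wInner_self_le_one h.toIsReversible hg1
  have hB0 : ∀ z, 0 ≤ B z := fun z => (sq_nonneg _).trans (hB m (by omega) le_rfl z)
  have hBle : 2 / c * (4 / ε) * ∑ z, π z * B z ≤ ε / 4 := by
    refine le_trans (mul_le_mul_of_nonneg_left (hBsum.trans ?_) (by positivity)) hA
    exact mul_le_of_le_one_left (by positivity) hN0
  have ht1 : surv K M a x ≤ ε / 4 := by
    have h1 := h.surv_le_of_late hx hα0 hB1p hα (a := a) (by linarith)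
    refine h1.trans ?_
    have h7 : 4 / ε ≤ B1 ^ 2 := by
      have : 0 < 4 / ε := by positivity
      rw [hB1]
      generalize 4 / ε = y at this
      nlinarith
    rw [one_div_le (by positivity) (by positivity), one_div_div]
    exact h7
  have ht2 : ∀ z ∈ Finset.Icc M w, surv K z b M ≤ ε / 4 := fun z hz => by
    obtain ⟨hz1, hz2⟩ := Finset.mem_Icc.1 hz
    refine (h.surv_le_of_quantile hlam hP hc hJp hcM hw hz1 hz2 hb1).trans (le_of_eq ?_)
    rw [hJ]; field_simp; norm_num
  -- The chain has hit z by time a + b except with probability ε/2, and at least s steps remain. At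
  -- z the orbit is bounded at all these remaining times by the maximal function.
  have key : ∀ z ∈ Finset.Icc M w, φ m x ≤ 3 * (ε / 4) + 4 / ε * B z := fun z hz => by
    obtain ⟨hz1, hz2⟩ := Finset.mem_Icc.1 hz
    have hbz := hB0 z
    have h1 := h.toIsReversible.orbit_le_add_surv hφ
      (fun y => by rw [hφ0]; exact (abs_le.1 (hg1 y)).2)
      (b := ε / 4 + 4 / ε * B z) (by positivity) (s := s) (m := m) (z := z)
      (fun k hk1 hk2 => by
        have h2 := hB k hk1 hk2 z
        -- Passage from the linear quantity to the square that the maximal inequality controls.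
        have h3 : φ k z ≤ ε / 4 + 4 / ε * φ k z ^ 2 := by
          have e : ε / 4 + 4 / ε * φ k z ^ 2 - φ k z =
              4 / ε * ((φ k z - ε / 8) ^ 2 + 3 * ε ^ 2 / 64) := by field_simp; ring
          have : 0 ≤ 4 / ε * ((φ k z - ε / 8) ^ 2 + 3 * ε ^ 2 / 64) := by positivity
          linarith
        have h4 : 4 / ε * φ k z ^ 2 ≤ 4 / ε * B z := by gcongr
        linarith) (a + b) m hsum le_rfl x
    have h2 := h.surv_add_le hz1 a b hx
    linarith [ht2 z hz]
  -- The left side of `key` does not depend on z, so z may be averaged over [M, w] with weights π.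
  have havg : (∑ z ∈ Finset.Icc M w, π z) * φ m x ≤
      (∑ z ∈ Finset.Icc M w, π z) * (3 * (ε / 4)) + 4 / ε * ∑ z, π z * B z := by
    have h1 : ∑ z ∈ Finset.Icc M w, π z * B z ≤ ∑ z, π z * B z :=
      Finset.sum_le_sum_of_subset_of_nonneg (Finset.subset_univ _)
        fun z _ _ => mul_nonneg (h.weight_nonneg z) (hB0 z)
    have h2 : 4 / ε * ∑ z ∈ Finset.Icc M w, π z * B z ≤ 4 / ε * ∑ z, π z * B z := by gcongr
    refine le_trans ?_ (add_le_add_right h2 _)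
    rw [Finset.sum_mul, Finset.sum_mul, Finset.mul_sum, ← Finset.sum_add_distrib]
    refine Finset.sum_le_sum fun z hz => ?_
    have := mul_le_mul_of_nonneg_left (key z hz) (h.weight_nonneg z)
    linarith
  set p := ∑ z ∈ Finset.Icc M w, π z
  have hp : 0 < p := by linarith
  have hfin : 4 / ε * ∑ z, π z * B z ≤ p * (ε / 4) := by
    have h1 : 4 / ε * ∑ z, π z * B z = c / 2 * (2 / c * (4 / ε) * ∑ z, π z * B z) := by
      field_simp
    rw [h1]
    exact mul_le_mul hmass hBle (mul_nonneg (by positivity)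
      (Finset.sum_nonneg fun z _ => mul_nonneg (h.weight_nonneg z) (hB0 z))) hp.le
  have : p * φ m x ≤ p * ε := by linarith
  exact le_of_mul_le_mul_left this hp

/-- The chain started at `0` stays in a set of small weight before the hitting time of `M`. -/
theorem orbit_le_of_early {c η : ℝ} (hc : 0 < c) (hη : 0 < η) :
    ∃ D : ℝ, 0 < D ∧ ∀ {n : ℕ} {K : Matrix (Fin (n + 1)) (Fin (n + 1)) ℝ} {π : Fin (n + 1) → ℝ}
      (_ : IsBD K π) {lam α : ℝ} {M : Fin (n + 1)}, Poincare K π lam → 0 < lam →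
      c ≤ cum π M → c ≤ tailWt π M → upVar K π M 0 ≤ α ^ 2 → 0 < α → 1 ≤ lam * α →
      ∃ z : Fin (n + 1), ∑ x ∈ Finset.Iio z, π x ≤ η ∧
        ∀ m : ℕ, (m : ℝ) ≤ upMean K π M 0 - D * α →
          (K ^ m).mulVec (fun x => if z ≤ x then 1 else 0) 0 ≤ η := by
  -- The minimum with c places the quantile z at or below M; the minimum with η makes the weight
  -- strictly below z small.
  set η' := min c η with hη'
  have hη'0 : 0 < η' := lt_min hc hη
  refine ⟨1 / (η' * c) + (1 / η + 1), by positivity, ?_⟩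
  intro n K π h lam α M hP hlam hcM hcM' hV hα hla
  classical
  have hex : ∃ k, η' ≤ cum π k := ⟨M, (min_le_left _ _).trans hcM⟩
  set k := Nat.find hex with hk
  have hkM : k ≤ M := Nat.find_min' hex ((min_le_left _ _).trans hcM)
  have hkc : η' ≤ cum π k := Nat.find_spec hex
  set z : Fin (n + 1) := ⟨k, by omega⟩
  refine ⟨z, ?_, fun m hm => ?_⟩
  · have e : ∑ x ∈ Finset.Iio z, π x = ∑ i ∈ Finset.range k, wt π i := by
      rw [← Finset.sum_map (Finset.Iio z) Fin.valEmbedding (wt π) |>.trans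
        (Finset.sum_congr rfl fun z _ => wt_coe z)]
      refine Finset.sum_congr ?_ fun _ _ => rfl
      rw [Fin.map_valEmbedding_Iio]
      ext i; simp [z]
    rw [e]
    rcases Nat.eq_zero_or_pos k with h0 | h0
    · rw [h0]; simpa using hη.le
    · have := Nat.find_min hex (m := k - 1) (by omega)
      rw [cum, Nat.sub_add_cancel h0] at this
      exact (not_le.1 this).le.trans (min_le_right _ _)
  · have h1 := h.orbit_add_surv_le_one (z := z)
      (φ := fun k => (K ^ k).mulVec (fun x => if z ≤ x then 1 else 0)) (pow_mulVec_succ K _)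
      (fun x => by simp; split_ifs <;> norm_num)
      (fun x hx => by simp [not_le.2 hx]) m (x := 0) (Fin.zero_le _)
    -- The price of stopping at z: the mean time from z to M is at most 1/(lam η' c), and 1/lam ≤ α.
    have h2 : upMean K π M 0 - α * (1 / (η' * c)) ≤ upMean K π k 0 := by
      have e := upMean_add (K := K) (π := π) (Nat.zero_le k) hkM
      have h3 := h.mul_upMean_le hlam.le hP hkM (Fin.is_le M)
      have h4 := h.upMean_nonneg M k
      have h5 : lam * (η' * c) * upMean K π M k ≤ 1 := by
        refine le_trans ?_ h3
        rw [mul_assoc lam (cum π k)]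
        have := h.cum_nonneg k
        gcongr
      have h6 : upMean K π M k ≤ α * (1 / (η' * c)) := by
        have h7 : lam * ((η' * c) * upMean K π M k) ≤ lam * α := by linarith
        have h8 := le_of_mul_le_mul_left h7 hlam
        rw [mul_one_div, le_div_iff₀ (by positivity)]
        linarith
      linarith
    have h3 : (1 / η + 1) * α ≤ upMean K π k 0 - m := by linarith
    have h3' : 0 < (1 / η + 1) * α := by positivity
    have h4 := h.one_sub_surv_mul_sq_le (z := z) m (t := upMean K π k 0) (by linarith)
      (x := 0) (Fin.zero_le _)
    have h5 : upVar K π k 0 ≤ α ^ 2 := (h.upVar_mono hkM 0).trans hV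
    have h6 : (1 - surv K z m 0) * ((1 / η + 1) * α) ^ 2 ≤ α ^ 2 := by
      have e : ((0 : Fin (n + 1)) : ℕ) = 0 := rfl
      simp only [z, e, sub_self] at h4
      have h7 := h.surv_le_one (z := z) m 0
      have h8 : ((1 / η + 1) * α) ^ 2 ≤ (upMean K π k 0 - m) ^ 2 := by gcongr
      have h9 := mul_le_mul_of_nonneg_left h8 (sub_nonneg.2 h7)
      simp only [z] at h9 ⊢
      linarith
    have h7 : (1 - surv K z m 0) * (1 / η + 1) ^ 2 ≤ 1 := by
      rw [mul_pow, ← mul_assoc] at h6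
      exact le_of_mul_le_mul_right (by linarith) (by positivity : 0 < α ^ 2)
    have h8 : 1 / η ≤ (1 / η + 1) ^ 2 := by
      have : 0 < 1 / η := by positivity
      nlinarith
    have h9 : (1 - surv K z m 0) * (1 / η) ≤ 1 :=
      (mul_le_mul_of_nonneg_left h8 (sub_nonneg.2 (h.surv_le_one (z := z) m 0))).trans h7
    rw [mul_one_div, div_le_one hη] at h9
    linarith

end IsBD

end Mixing

/-! ### Total variation bounds in discrete time -/

section TotalVariation

variable {n : ℕ}

/-- The larger of the mean hitting times of `M` from the two ends. -/
def hitMean (K : Matrix (Fin (n + 1)) (Fin (n + 1)) ℝ) (π : Fin (n + 1) → ℝ)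
    (M : Fin (n + 1)) : ℝ :=
  max (upMean K π M 0) (upMean (revK K) (revW π) M.rev 0)

/-- The larger of the variances of the hitting times of `M` from the two ends, for the continuous
time chain. -/
def hitVar (K : Matrix (Fin (n + 1)) (Fin (n + 1)) ℝ) (π : Fin (n + 1) → ℝ)
    (M : Fin (n + 1)) : ℝ :=
  max (upVar K π M 0) (upVar (revK K) (revW π) M.rev 0)

variable {K : Matrix (Fin (n + 1)) (Fin (n + 1)) ℝ} {π : Fin (n + 1) → ℝ} {M : Fin (n + 1)}

lemma cum_eq_sum_Iic (M : Fin (n + 1)) : cum π M = ∑ i ∈ Finset.Iic M, π i := by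
  rw [← Finset.sum_map (Finset.Iic M) Fin.valEmbedding (wt π) |>.trans
    (Finset.sum_congr rfl fun z _ => wt_coe z)]
  refine Finset.sum_congr ?_ fun _ _ => rfl
  rw [Fin.map_valEmbedding_Iic]
  ext i; simp

lemma tailWt_eq_sum_Ici (M : Fin (n + 1)) : tailWt π M = ∑ i ∈ Finset.Ici M, π i := by
  rw [← Finset.sum_map (Finset.Ici M) Fin.valEmbedding (wt π) |>.trans
    (Finset.sum_congr rfl fun z _ => wt_coe z)]
  refine Finset.sum_congr ?_ fun _ _ => rfl
  ext i
  simp only [Finset.mem_Ico, Finset.mem_map, Finset.mem_Ici, Fin.valEmbedding_apply]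
  constructor
  · rintro ⟨h1, h2⟩
    exact ⟨⟨i, h2⟩, h1, rfl⟩
  · rintro ⟨j, h1, rfl⟩
    exact ⟨h1, j.2⟩

lemma cum_rev (M : Fin (n + 1)) : cum (revW π) M.rev = tailWt π M := by
  rw [cum_eq_sum_Iic, tailWt_eq_sum_Ici]
  refine Finset.sum_equiv Fin.revPerm (fun i => ?_) fun i _ => rfl
  simp [Fin.le_rev_iff]

lemma tailWt_rev (M : Fin (n + 1)) : tailWt (revW π) M.rev = cum π M := by
  have := cum_rev (π := revW π) M.rev
  rw [revW_revW, Fin.rev_rev] at this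
  exact this.symm

lemma hitVar_rev : hitVar (revK K) (revW π) M.rev = hitVar K π M := by
  rw [hitVar, hitVar, revK_revK, revW_revW, Fin.rev_rev, max_comm]

lemma revK_halfK : revK (halfK K) = halfK (revK K) := by
  ext x y; simp [revK_apply, halfK_apply]

lemma hitMean_half : hitMean (halfK K) π M = 2 * hitMean K π M := by
  rw [hitMean, hitMean, revK_halfK, IsBD.upMean_half, IsBD.upMean_half,
    mul_max_of_nonneg _ _ zero_le_two]

lemma hitVar_half : hitVar (halfK K) π M = 4 * hitVar K π M := by
  rw [hitVar, hitVar, revK_halfK, IsBD.upVar_half, IsBD.upVar_half,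
    mul_max_of_nonneg _ _ (by norm_num)]

namespace IsBD

variable (h : IsBD K π)
include h

/-- Every passage takes at least one step and the distances from M to the two ends add up to n.
Hence θ tends to infinity with n. -/
lemma half_le_hitMean : (n : ℝ) / 2 ≤ hitMean K π M := by
  have h1 := h.sub_le_upMean (Fin.is_le M) (Nat.zero_le _)
  have h2 := h.rev.sub_le_upMean (Fin.is_le M.rev) (Nat.zero_le _)
  have e : ((M.rev : ℕ) : ℝ) = n - M := by
    rw [Fin.val_rev, Nat.cast_sub (by omega)]; push_cast; ring
  rw [e] at h2
  have := le_max_left (upMean K π M 0) (upMean (revK K) (revW π) M.rev 0)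
  have := le_max_right (upMean K π M 0) (upMean (revK K) (revW π) M.rev 0)
  rw [hitMean]
  push_cast at *
  linarith

lemma one_le_hitMean (hn : 1 ≤ n) : 1 ≤ hitMean K π M := by
  rcases Nat.eq_zero_or_pos (M : ℕ) with h0 | h0
  · refine le_max_of_le_right (h.rev.one_le_upMean (Fin.is_le M.rev) ?_)
    rw [Fin.val_rev]; omega
  · exact le_max_of_le_left (h.one_le_upMean (Fin.is_le M) h0)

lemma hitMean_le_hitVar : hitMean K π M ≤ hitVar K π M :=
  max_le_max (h.upMean_le_upVar (Fin.is_le M) 0) (h.rev.upMean_le_upVar (Fin.is_le M.rev) 0)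

lemma one_le_sqrt_hitVar (hn : 1 ≤ n) : 1 ≤ √(hitVar K π M) := by
  rw [Real.one_le_sqrt]
  exact (h.one_le_hitMean hn).trans h.hitMean_le_hitVar

lemma sq_sqrt_hitVar : √(hitVar K π M) ^ 2 = hitVar K π M :=
  Real.sq_sqrt ((h.upVar_nonneg _ _).trans (le_max_left _ _))

lemma poincare_hitVar (hn : 1 ≤ n) : Poincare K π (1 / √(hitVar K π M)) := by
  have h1 := h.one_le_sqrt_hitVar (M := M) hn
  refine h.poincare_of_upVar (Fin.is_le M) (by linarith) ?_ ?_
  · rw [h.sq_sqrt_hitVar]; exact le_max_left _ _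
  · rw [h.sq_sqrt_hitVar]
    have : n - (M : ℕ) = (M.rev : ℕ) := by rw [Fin.val_rev]; omega
    rw [this]; exact le_max_right _ _

/-- The Poincaré inequality with constant 1/α, tested on a gap eigenfunction. -/
lemma one_le_spectralGap_mul (hn : 1 ≤ n) : 1 ≤ spectralGap K * √(hitVar K π M) := by
  obtain ⟨hpos, -, f, hf0, hf, hKf⟩ := h.poincare_spectralGap hn
  have h1 := h.poincare_hitVar (M := M) hn f hf
  rw [dirichlet_of_mulVec hKf] at h1
  have h2 : 0 < wInner π f f := by
    refine lt_of_le_of_ne (wInner_self_nonneg h.weight_nonneg f) fun h0 => hf0 ?_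
    rw [wInner, eq_comm, Finset.sum_eq_zero_iff_of_nonneg
      fun x _ => mul_nonneg (h.weight_nonneg x) (mul_self_nonneg _)] at h0
    ext x
    have := h0 x (Finset.mem_univ x)
    rw [mul_eq_zero, or_iff_right (h.weight_pos x).ne', mul_self_eq_zero] at this
    exact this
  have h3 := le_of_mul_le_mul_right h1 h2
  have h4 := h.one_le_sqrt_hitVar (M := M) hn
  rwa [div_le_iff₀ (by linarith)] at h3

lemma mul_hitVar_le {c lam : ℝ} (hc : 0 < c) (hlam : 0 < lam) (hP : Poincare K π lam)
    (hL : c ≤ cum π M) (hR : c ≤ tailWt π M) :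
    lam * c * hitVar K π M ≤ 2 * hitMean K π M := by
  rw [hitVar, mul_max_of_nonneg _ _ (by positivity)]
  refine max_le ?_ ?_
  · refine le_trans ?_ ((h.mul_upVar_le hlam.le hP (Fin.is_le M)).trans
      (mul_le_mul_of_nonneg_left (le_max_left _ _) zero_le_two))
    have := h.upVar_nonneg M 0
    gcongr
  · refine le_trans ?_ ((h.rev.mul_upVar_le hlam.le hP.rev (Fin.is_le M.rev)).trans
      (mul_le_mul_of_nonneg_left (le_max_right _ _) zero_le_two))
    have := h.rev.upVar_nonneg M.rev 0
    rw [tailWt_rev]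
    gcongr

end IsBD

lemma revK_pow_mulVec (m : ℕ) (g : Fin (n + 1) → ℝ) (x : Fin (n + 1)) :
    (revK K ^ m).mulVec (g ∘ Fin.rev) x.rev = (K ^ m).mulVec g x := by
  rw [revK_pow, revK_mulVec]; simp

lemma IsReversible.pow_row_sum {ι : Type*} [Fintype ι] [DecidableEq ι] {K : Matrix ι ι ℝ}
    {π : ι → ℝ} (h : IsReversible K π) (m : ℕ) (x : ι) : ∑ y, (K ^ m) x y = 1 := by
  induction m with
  | zero => simp [Matrix.one_apply]
  | succ m ih =>
    simp_rw [pow_succ, Matrix.mul_apply]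
    rw [Finset.sum_comm]
    simp_rw [← Finset.mul_sum, h.row_sum, mul_one]
    exact ih

lemma IsReversible.pow_nonneg {ι : Type*} [Fintype ι] [DecidableEq ι] {K : Matrix ι ι ℝ}
    {π : ι → ℝ} (h : IsReversible K π) (m : ℕ) (x y : ι) : 0 ≤ (K ^ m) x y := by
  induction m generalizing y with
  | zero => rw [pow_zero, Matrix.one_apply]; split_ifs <;> norm_num
  | succ m ih =>
    rw [pow_succ, Matrix.mul_apply]
    exact Finset.sum_nonneg fun l _ => mul_nonneg (ih _) (h.nonneg _ _)

lemma sum_mem_eq_mulVec (A : Finset (Fin (n + 1))) (m : ℕ) (x : Fin (n + 1)) :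
    (K ^ m).mulVec (fun y => if y ∈ A then 1 else 0) x = ∑ y ∈ A, (K ^ m) x y := by
  rw [mulVec_eq_sum]; simp

/-- Upper bound on the total variation distance of lazy chains after the hitting times. -/
theorem IsBD.sum_sub_le_of_late {c δ ε : ℝ} (hc : 0 < c) (hδ0 : 0 < δ) (hε : 0 < ε) :
    ∃ D : ℝ, 0 < D ∧ ∀ {n : ℕ} {K : Matrix (Fin (n + 1)) (Fin (n + 1)) ℝ} {π : Fin (n + 1) → ℝ}
      (_ : IsBD K π) {lam α : ℝ} {M : Fin (n + 1)}, Poincare K π lam → 0 < lam →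
      (∀ x, δ ≤ K x x) → c ≤ cum π M → c ≤ tailWt π M →
      hitVar K π M ≤ α ^ 2 → 1 ≤ α → 1 ≤ lam * α →
      ∀ m : ℕ, hitMean K π M + D * α ≤ m → ∀ x A,
        ∑ y ∈ A, (K ^ m) x y - ∑ y ∈ A, π y ≤ ε := by
  obtain ⟨D, hD, H⟩ := IsBD.orbit_le_of_mixing hc hδ0 hε
  refine ⟨D, hD, ?_⟩
  intro n K π h lam α M hP hlam hδ hL hR hV hα hla m hm x A
  set a := ∑ y ∈ A, π y with ha
  have ha0 : 0 ≤ a := Finset.sum_nonneg fun y _ => h.weight_nonneg y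
  have ha1 : a ≤ 1 := by
    rw [← h.weight_sum]
    exact Finset.sum_le_sum_of_subset_of_nonneg (Finset.subset_univ _)
      fun y _ _ => h.weight_nonneg y
  set g : Fin (n + 1) → ℝ := fun y => (if y ∈ A then 1 else 0) - a with hg
  have hg1 : ∀ y, |g y| ≤ 1 := fun y => by
    rw [abs_le]; simp only [hg]; split_ifs <;> constructor <;> linarith
  have hg0 : ∑ y, π y * g y = 0 := by
    simp [hg, mul_sub, Finset.sum_sub_distrib, ← Finset.sum_mul, h.weight_sum, ha]
  have hval : (K ^ m).mulVec g x = ∑ y ∈ A, (K ^ m) x y - a := by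
    rw [mulVec_eq_sum]
    simp [hg, mul_sub, Finset.sum_sub_distrib, ← Finset.sum_mul, h.toIsReversible.pow_row_sum]
  rw [← hval]
  rcases le_total x M with hx | hx
  · exact H h hP hlam hδ hL hR (le_max_left _ _) ((le_max_left _ _).trans hV) hα hla m hm g hg1
      hg0 x hx
  -- A start to the right of M is a start to the left of the reflected M for the reflected chain.
  · rw [← revK_pow_mulVec]
    refine H h.rev hP.rev hlam (fun y => hδ y.rev) (M := M.rev) (by rwa [cum_rev])
      (by rwa [tailWt_rev]) (le_max_right _ _) ((le_max_right _ _).trans hV) hα hla m hm _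
      (fun y => hg1 _) ?_ x.rev (by rwa [Fin.rev_le_rev])
    rw [← hg0, ← sum_rev fun y => π y * g y]
    rfl

/-- Before the hitting times the chain started at one of the ends is concentrated on a set of small
weight. -/
theorem IsBD.exists_sum_le_of_early {c η : ℝ} (hc : 0 < c) (hη : 0 < η) :
    ∃ D : ℝ, 0 < D ∧ ∀ {n : ℕ} {K : Matrix (Fin (n + 1)) (Fin (n + 1)) ℝ} {π : Fin (n + 1) → ℝ}
      (_ : IsBD K π) {lam α : ℝ} {M : Fin (n + 1)}, Poincare K π lam → 0 < lam →
      c ≤ cum π M → c ≤ tailWt π M → hitVar K π M ≤ α ^ 2 → 0 < α → 1 ≤ lam * α →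
      ∃ (x : Fin (n + 1)) (B : Finset (Fin (n + 1))), 1 - η ≤ ∑ y ∈ B, π y ∧
        ∀ m : ℕ, (m : ℝ) ≤ hitMean K π M - D * α → ∑ y ∈ B, (K ^ m) x y ≤ η := by
  obtain ⟨D, hD, H⟩ := IsBD.orbit_le_of_early hc hη
  refine ⟨D, hD, ?_⟩
  intro n K π h lam α M hP hlam hL hR hV hα hla
  have main : ∀ {K : Matrix (Fin (n + 1)) (Fin (n + 1)) ℝ} {π : Fin (n + 1) → ℝ}
      {M : Fin (n + 1)} (_ : IsBD K π), Poincare K π lam → c ≤ cum π M → c ≤ tailWt π M →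
      hitVar K π M ≤ α ^ 2 →
      ∃ (x : Fin (n + 1)) (B : Finset (Fin (n + 1))), 1 - η ≤ ∑ y ∈ B, π y ∧
        ∀ m : ℕ, (m : ℝ) ≤ upMean K π M 0 - D * α → ∑ y ∈ B, (K ^ m) x y ≤ η := by
    intro K π M h hP hL hR hV
    obtain ⟨z, hz, hm⟩ := H h hP hlam hL hR ((le_max_left _ _).trans hV) hα hla
    refine ⟨0, Finset.Ici z, ?_, fun m hmm => ?_⟩
    · have := Finset.sum_add_sum_compl (Finset.Iio z) π
      have e : (Finset.Iio z)ᶜ = Finset.Ici z := by ext y; simp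
      rw [e, h.weight_sum] at this
      linarith
    · have := hm m hmm
      rw [← sum_mem_eq_mulVec]
      simpa using this
  -- The end with the larger mean hitting time is the bad starting point.
  rcases le_total (upMean (revK K) (revW π) M.rev 0) (upMean K π M 0) with hle | hle
  · rw [hitMean, max_eq_left hle]
    exact main h hP hL hR hV
  · rw [hitMean, max_eq_right hle]
    obtain ⟨x, B, hB, hm⟩ := main (M := M.rev) h.rev hP.rev (by rwa [cum_rev])
      (by rwa [tailWt_rev]) (by rwa [hitVar_rev])
    refine ⟨x.rev, B.map Fin.revPerm.toEmbedding, ?_, fun m hmm => ?_⟩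
    · rw [Finset.sum_map]; exact hB
    · rw [Finset.sum_map]
      have := hm m hmm
      rw [revK_pow] at this
      exact this

/-! ### Total variation tested on sets and eigenfunctions -/

lemma le_tvDist (μ ν : Fin (n + 1) → ℝ) (A : Finset (Fin (n + 1))) :
    ∑ x ∈ A, μ x - ∑ x ∈ A, ν x ≤ tvDist μ ν :=
  le_ciSup (f := fun A : Finset (Fin (n + 1)) => ∑ x ∈ A, μ x - ∑ x ∈ A, ν x)
    (Set.finite_range _).bddAbove A

lemma sum_abs_sub_le_tvDist {μ ν : Fin (n + 1) → ℝ} (h : ∑ x, μ x = ∑ x, ν x) :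
    ∑ x, |μ x - ν x| ≤ 2 * tvDist μ ν := by
  classical
  have h1 := le_tvDist μ ν (Finset.univ.filter fun x => ν x ≤ μ x)
  rw [← Finset.sum_sub_distrib] at h1
  have h2 : ∑ x, (μ x - ν x) = 0 := by rw [Finset.sum_sub_distrib, h, sub_self]
  have h3 : ∑ x, |μ x - ν x| = ∑ x, (2 * (if ν x ≤ μ x then μ x - ν x else 0) - (μ x - ν x)) := by
    refine Finset.sum_congr rfl fun x _ => ?_
    split_ifs with hx
    · rw [abs_of_nonneg (by linarith)]; ring
    · rw [abs_of_nonpos (by linarith [not_le.1 hx])]; ring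
  rw [h3, Finset.sum_sub_distrib, h2, ← Finset.mul_sum, ← Finset.sum_filter]
  linarith

/-- Eigenfunctions bound the total variation distance from below. -/
lemma abs_le_iSup_tvDist {P : Matrix (Fin (n + 1)) (Fin (n + 1)) ℝ} {π f : Fin (n + 1) → ℝ}
    {b : ℝ} (hP : ∀ x, ∑ y, P x y = 1) (hπ : ∑ x, π x = 1) (hf0 : f ≠ 0)
    (hf : ∑ x, π x * f x = 0) (hPf : ∀ x, ∑ y, P x y * f y = b * f x) :
    |b| ≤ 2 * ⨆ x, tvDist (P x) π := by
  obtain ⟨x, -, hx⟩ := Finset.exists_max_image Finset.univ (fun x => |f x|) Finset.univ_nonempty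
  have hpos : 0 < |f x| := by
    rw [abs_pos]
    intro h0
    refine hf0 (funext fun y => ?_)
    have := hx y (Finset.mem_univ y)
    rw [h0, abs_zero] at this
    exact abs_nonpos_iff.1 this
  have h1 : |b| * |f x| ≤ (∑ y, |P x y - π y|) * |f x| := by
    rw [← abs_mul, ← hPf x, Finset.sum_mul]
    have : ∑ y, P x y * f y = ∑ y, (P x y - π y) * f y := by
      simp only [sub_mul, Finset.sum_sub_distrib, hf, sub_zero]
    rw [this]
    refine (Finset.abs_sum_le_sum_abs _ _).trans (Finset.sum_le_sum fun y hy => ?_)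
    rw [abs_mul]
    exact mul_le_mul_of_nonneg_left (hx y hy) (abs_nonneg _)
  refine (le_of_mul_le_mul_right h1 hpos).trans ((sum_abs_sub_le_tvDist (by rw [hP, hπ])).trans ?_)
  exact mul_le_mul_of_nonneg_left (le_ciSup (f := fun x => tvDist (P x) π)
    (Set.finite_range _).bddAbove x) zero_le_two

lemma pow_mulVec_eigen {f : Fin (n + 1) → ℝ} {b : ℝ} (hf : K.mulVec f = b • f) (m : ℕ) :
    (K ^ m).mulVec f = b ^ m • f := by
  induction m with
  | zero => simp
  | succ m ih => rw [pow_mulVec_succ, ih, Matrix.mulVec_smul, hf, smul_smul, pow_succ]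

lemma IsBD.abs_pow_le_maxTV (h : IsBD K π) (hn : 1 ≤ n) (m : ℕ) :
    |(1 - spectralGap K) ^ m| ≤ 2 * maxTV K π m := by
  obtain ⟨-, -, f, hf0, hf, hKf⟩ := h.poincare_spectralGap hn
  refine abs_le_iSup_tvDist (h.toIsReversible.pow_row_sum m) h.weight_sum hf0 hf fun x => ?_
  have := congrFun (pow_mulVec_eigen hKf m) x
  rwa [mulVec_eq_sum] at this

end TotalVariation

/-! ### Poissonization -/

section Poissonization

lemma hasSum_of_eq {f g : ℕ → ℝ} {a b : ℝ} (h : HasSum f a) (hf : ∀ k, g k = f k) (hb : b = a) :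
    HasSum g b := by
  rw [show g = f from funext hf, hb]; exact h

/-- The Poisson weights. -/
def poissonWt (t : ℝ) (k : ℕ) : ℝ := Real.exp (-t) * (t ^ k / k.factorial)

lemma poissonWt_nonneg {t : ℝ} (ht : 0 ≤ t) (k : ℕ) : 0 ≤ poissonWt t k := by
  unfold poissonWt; positivity

lemma hasSum_poissonWt_mul_pow (t b : ℝ) :
    HasSum (fun k => poissonWt t k * b ^ k) (Real.exp (-(1 - b) * t)) := by
  have h1 : HasSum (fun k : ℕ => (t * b) ^ k / k.factorial) (Real.exp (t * b)) := by
    rw [Real.exp_eq_exp_ℝ]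
    exact NormedSpace.expSeries_div_hasSum_exp (t * b)
  have h2 := h1.mul_left (Real.exp (-t))
  rw [← Real.exp_add] at h2
  refine hasSum_of_eq h2 (fun k => ?_) ?_
  · rw [poissonWt, mul_pow]; ring
  · congr 1; ring

lemma hasSum_poissonWt (t : ℝ) : HasSum (poissonWt t) 1 := by
  simpa using hasSum_poissonWt_mul_pow t 1

lemma succ_mul_poissonWt (t : ℝ) (k : ℕ) :
    ((k + 1 : ℕ) : ℝ) * poissonWt t (k + 1) = t * poissonWt t k := by
  rw [poissonWt, poissonWt, Nat.factorial_succ]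
  push_cast
  field_simp
  ring

lemma hasSum_mul_poissonWt (t : ℝ) : HasSum (fun k : ℕ => (k : ℝ) * poissonWt t k) t := by
  rw [← hasSum_nat_add_iff' 1]
  refine hasSum_of_eq ((hasSum_poissonWt t).mul_left t) (fun k => succ_mul_poissonWt t k) ?_
  simp

lemma hasSum_sq_mul_poissonWt (t : ℝ) :
    HasSum (fun k : ℕ => (k : ℝ) ^ 2 * poissonWt t k) (t ^ 2 + t) := by
  rw [← hasSum_nat_add_iff' 1]
  have h1 := (hasSum_mul_poissonWt t).add (hasSum_poissonWt t)
  have h2 := h1.mul_left t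
  refine hasSum_of_eq h2 (fun k => ?_) ?_
  · have := succ_mul_poissonWt t k
    push_cast at this ⊢
    linear_combination ((k : ℝ) + 1) * this
  · simp; ring

lemma hasSum_sub_sq_mul_poissonWt (t : ℝ) :
    HasSum (fun k : ℕ => ((k : ℝ) - t) ^ 2 * poissonWt t k) t := by
  have := ((hasSum_sq_mul_poissonWt t).sub ((hasSum_mul_poissonWt t).mul_left (2 * t))).add
    ((hasSum_poissonWt t).mul_left (t ^ 2))
  exact hasSum_of_eq this (fun k => by ring) (by ring)

/-- Averages with Poisson weights are controlled by the values near the mean. -/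
lemma poisson_average_le {t s b S : ℝ} {a : ℕ → ℝ} (ht : 0 ≤ t) (hs : 0 < s) (hb : 0 ≤ b)
    (ha : ∀ k, a k ≤ 1) (hab : ∀ k : ℕ, |(k : ℝ) - t| < s → a k ≤ b)
    (hS : HasSum (fun k => poissonWt t k * a k) S) : S ≤ b + t / s ^ 2 := by
  have h1 := ((hasSum_poissonWt t).mul_left b).add
    ((hasSum_sub_sq_mul_poissonWt t).div_const (s ^ 2))
  rw [mul_one] at h1
  refine hasSum_le (fun k => ?_) hS h1
  have hp := poissonWt_nonneg ht k
  have : a k ≤ b + ((k : ℝ) - t) ^ 2 / s ^ 2 := by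
    rcases lt_or_ge |(k : ℝ) - t| s with hk | hk
    · exact (hab k hk).trans (le_add_of_nonneg_right (by positivity))
    · have : 1 ≤ ((k : ℝ) - t) ^ 2 / s ^ 2 := by
        rw [one_le_div (by positivity), ← sq_abs ((k : ℝ) - t)]
        gcongr
      linarith [ha k]
  calc poissonWt t k * a k ≤ poissonWt t k * (b + ((k : ℝ) - t) ^ 2 / s ^ 2) := by gcongr
    _ = _ := by ring

variable {n : ℕ} {K : Matrix (Fin (n + 1)) (Fin (n + 1)) ℝ} {π : Fin (n + 1) → ℝ}
  {M : Fin (n + 1)}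

/-- Uniformisation: exp(-t(I - K)) = exp(-t)·exp(tK), and the exponential series is read entrywise.
-/
lemma hasSum_heat (K : Matrix (Fin (n + 1)) (Fin (n + 1)) ℝ) (t : ℝ) (x y : Fin (n + 1)) :
    HasSum (fun k => poissonWt t k * (K ^ k) x y) (heat K t x y) := by
  let _ : NormedRing (Matrix (Fin (n + 1)) (Fin (n + 1)) ℝ) := Matrix.linftyOpNormedRing
  let _ : NormedAlgebra ℝ (Matrix (Fin (n + 1)) (Fin (n + 1)) ℝ) := Matrix.linftyOpNormedAlgebra
  have h1 : HasSum (fun k : ℕ => (k.factorial⁻¹ : ℝ) • (t • K) ^ k) (NormedSpace.exp (t • K)) :=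
    NormedSpace.exp_series_hasSum_exp' (𝕂 := ℝ) (t • K)
  have h2 : heat K t = Real.exp (-t) • NormedSpace.exp (t • K) := by
    have e : -t • (1 - K) = (-t) • (1 : Matrix (Fin (n + 1)) (Fin (n + 1)) ℝ) + t • K := by
      rw [smul_sub, neg_smul, neg_smul]; abel
    have e2 : NormedSpace.exp ((-t) • (1 : Matrix (Fin (n + 1)) (Fin (n + 1)) ℝ)) =
        Real.exp (-t) • (1 : Matrix (Fin (n + 1)) (Fin (n + 1)) ℝ) := by
      rw [← Algebra.algebraMap_eq_smul_one, ← Algebra.algebraMap_eq_smul_one,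
        Real.exp_eq_exp_ℝ]
      exact (NormedSpace.algebraMap_exp_comm (𝕂 := ℝ) (-t)).symm
    rw [heat, e, Matrix.exp_add_of_commute, e2, smul_mul_assoc, one_mul]
    exact (Commute.one_left _).smul_left _
  have h3 := (h1.const_smul (Real.exp (-t)))
  rw [← h2] at h3
  have h4 : Continuous fun A : Matrix (Fin (n + 1)) (Fin (n + 1)) ℝ => A x y :=
    (continuous_id).matrix_elem x y
  have h5 := h3.map (Matrix.entryAddMonoidHom ℝ x y) h4
  refine hasSum_of_eq h5 (fun k => ?_) rfl
  simp [poissonWt, smul_pow]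
  ring

/-- The continuous time chain is also the half-lazy chain at the events of a clock of rate 2, so the
estimates that need holding apply to it unconditionally. -/
lemma heat_half (t : ℝ) : heat K t = heat (halfK K) (2 * t) := by
  rw [heat, heat]
  congr 1
  rw [halfK]
  ext x y
  simp only [Matrix.smul_apply, Matrix.sub_apply, Matrix.add_apply, smul_eq_mul]
  ring

lemma hasSum_sum_heat (K : Matrix (Fin (n + 1)) (Fin (n + 1)) ℝ) (t : ℝ) (x : Fin (n + 1))
    (A : Finset (Fin (n + 1))) :
    HasSum (fun k => poissonWt t k * ∑ y ∈ A, (K ^ k) x y) (∑ y ∈ A, heat K t x y) := by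
  simp_rw [Finset.mul_sum]
  exact hasSum_sum fun y _ => hasSum_heat K t x y

lemma IsReversible.heat_row_sum (h : IsReversible K π) (t : ℝ) (x : Fin (n + 1)) :
    ∑ y, heat K t x y = 1 := by
  have h1 := hasSum_sum_heat K t x Finset.univ
  simp only [h.pow_row_sum, mul_one] at h1
  exact h1.unique (hasSum_poissonWt t)

lemma IsReversible.sum_pow_le_one (h : IsReversible K π) (m : ℕ) (x : Fin (n + 1))
    (A : Finset (Fin (n + 1))) : ∑ y ∈ A, (K ^ m) x y ≤ 1 := by
  rw [← h.pow_row_sum m x]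
  exact Finset.sum_le_sum_of_subset_of_nonneg (Finset.subset_univ _)
    fun y _ _ => h.pow_nonneg m x y

/-- Upper bound on the total variation distance in continuous time. -/
theorem IsBD.sum_heat_sub_le_of_late {c ε : ℝ} (hc : 0 < c) (hε : 0 < ε) :
    ∃ D : ℝ, 0 < D ∧ ∀ {n : ℕ} {K : Matrix (Fin (n + 1)) (Fin (n + 1)) ℝ} {π : Fin (n + 1) → ℝ}
      (_ : IsBD K π) {lam α : ℝ} {M : Fin (n + 1)}, Poincare K π lam → 0 < lam →
      c ≤ cum π M → c ≤ tailWt π M → hitVar K π M = α ^ 2 → 1 ≤ α → 1 ≤ lam * α →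
      ∀ x A, ∑ y ∈ A, heat K (hitMean K π M + D * α) x y - ∑ y ∈ A, π y ≤ ε := by
  obtain ⟨D, hD, H⟩ := IsBD.sum_sub_le_of_late hc (δ := 1 / 2) (by norm_num) (half_pos hε)
  -- E is the extra room for Poisson fluctuations, large enough that the Chebyshev error (1 + D +
  -- E)/E² is at most ε.
  set E : ℝ := 1 + (2 + D) / ε with hE
  have hE0 : 0 < E := by positivity
  have hE1 : 1 ≤ E := le_add_of_nonneg_right (by positivity)
  have hEε : (1 + D + E) / E ^ 2 ≤ ε := by
    have h1 : 2 + D ≤ ε * E := by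
      rw [hE, mul_add, mul_div_cancel₀ _ hε.ne']; linarith
    rw [div_le_iff₀ (by positivity)]
    nlinarith
  refine ⟨D + E, by positivity, ?_⟩
  intro n K π h lam α M hP hlam hL hR hV hα hla x A
  have hθ0 : 0 ≤ hitMean K π M := (h.upMean_nonneg _ _).trans (le_max_left _ _)
  have hα0 : 0 < α := by linarith
  set t := hitMean K π M + (D + E) * α with ht
  have ht0 : 0 ≤ t := by positivity
  -- Since the mean is at most the variance α², the Poisson standard deviation √t is O(α) and fits
  -- into the window.
  have htα : t ≤ (1 + D + E) * α ^ 2 := by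
    have h1 : hitMean K π M ≤ α ^ 2 := hV ▸ h.hitMean_le_hitVar
    have h2 : α ≤ α ^ 2 := by nlinarith
    have h3 := mul_le_mul_of_nonneg_left h2 (by positivity : 0 ≤ D + E)
    linarith
  have hsum := hasSum_sum_heat (halfK K) (2 * t) x A
  rw [← heat_half] at hsum
  have hπ0 : 0 ≤ ∑ y ∈ A, π y := Finset.sum_nonneg fun y _ => h.weight_nonneg y
  have h1 := hsum.sub ((hasSum_poissonWt (2 * t)).mul_right (∑ y ∈ A, π y))
  simp only [← mul_sub, one_mul] at h1
  have h2 := poisson_average_le (s := 2 * E * α) (b := ε / 2) (by positivity) (by positivity)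
    (by positivity) (fun k => by
      have := h.half.toIsReversible.sum_pow_le_one k x A
      linarith) (fun k hk => by
      refine H h.half hP.half (by positivity) h.half_lazy (M := M) hL hR (α := 2 * α) ?_
        (by linarith) (by linarith) k ?_ x A
      · rw [hitVar_half, hV]; nlinarith
      · rw [hitMean_half]
        have := (abs_lt.1 hk).1
        linarith) h1
  refine h2.trans ?_
  have h3 : 2 * t / (2 * E * α) ^ 2 ≤ ε / 2 := by
    calc 2 * t / (2 * E * α) ^ 2 ≤ 2 * ((1 + D + E) * α ^ 2) / (2 * E * α) ^ 2 := by gcongr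
      _ = (1 + D + E) / E ^ 2 / 2 := by field_simp
      _ ≤ ε / 2 := by gcongr
  linarith

/-- Lower bound on the total variation distance in continuous time. -/
theorem IsBD.exists_sum_heat_le_of_early {c η : ℝ} (hc : 0 < c) (hη : 0 < η) :
    ∃ D : ℝ, 0 < D ∧ ∀ {n : ℕ} {K : Matrix (Fin (n + 1)) (Fin (n + 1)) ℝ} {π : Fin (n + 1) → ℝ}
      (_ : IsBD K π) {lam α : ℝ} {M : Fin (n + 1)}, Poincare K π lam → 0 < lam →
      c ≤ cum π M → c ≤ tailWt π M → hitVar K π M = α ^ 2 → 0 < α → 1 ≤ lam * α →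
      ∃ (x : Fin (n + 1)) (B : Finset (Fin (n + 1))), 1 - η ≤ ∑ y ∈ B, π y ∧
        ∀ t : ℝ, 0 ≤ t → t ≤ hitMean K π M - D * α → ∑ y ∈ B, heat K t x y ≤ η := by
  obtain ⟨D, hD, H⟩ := IsBD.exists_sum_le_of_early hc (half_pos hη)
  set E : ℝ := 1 + 2 / η with hE
  have hE0 : 0 < E := by positivity
  refine ⟨D + E, by positivity, ?_⟩
  intro n K π h lam α M hP hlam hL hR hV hα hla
  obtain ⟨x, B, hB, hm⟩ := H h hP hlam hL hR hV.le hα hla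
  refine ⟨x, B, by linarith, fun t ht0 ht => ?_⟩
  have h2 := poisson_average_le (s := E * α) (b := η / 2) ht0 (by positivity)
    (by positivity) (fun k => h.toIsReversible.sum_pow_le_one k x B) (fun k hk => by
      refine hm k ?_
      have := (abs_lt.1 hk).2
      linarith) (hasSum_sum_heat K t x B)
  refine h2.trans ?_
  have h3 : t / (E * α) ^ 2 ≤ η / 2 := by
    have h1 : t ≤ α ^ 2 := by
      have h1 : hitMean K π M ≤ α ^ 2 := hV ▸ h.hitMean_le_hitVar
      have : 0 ≤ (D + E) * α := by positivity
      linarith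
    calc t / (E * α) ^ 2 ≤ α ^ 2 / (E * α) ^ 2 := by gcongr
      _ = 1 / E ^ 2 := by field_simp
      _ ≤ η / 2 := by
        rw [one_div_le (by positivity) (by positivity), one_div_div, hE]
        have : 0 < 2 / η := by positivity
        generalize 2 / η = y at this
        nlinarith
  linarith

lemma IsBD.exp_le_maxTVc (h : IsBD K π) (hn : 1 ≤ n) (t : ℝ) :
    Real.exp (-spectralGap K * t) ≤ 2 * maxTVc K π t := by
  obtain ⟨-, -, f, hf0, hf, hKf⟩ := h.poincare_spectralGap hn
  rw [← abs_of_pos (Real.exp_pos (-spectralGap K * t))]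
  refine abs_le_iSup_tvDist (h.toIsReversible.heat_row_sum t) h.weight_sum hf0 hf fun x => ?_
  have h1 := hasSum_sum (s := Finset.univ) (f := fun y k => poissonWt t k * (K ^ k) x y * f y)
    fun y _ => (hasSum_heat K t x y).mul_right (f y)
  have h2 := (hasSum_poissonWt_mul_pow t (1 - spectralGap K)).mul_right (f x)
  rw [sub_sub_cancel] at h2
  refine h1.unique ?_
  refine hasSum_of_eq h2 (fun k => ?_) rfl
  have h3 := congrFun (pow_mulVec_eigen hKf k) x
  rw [mulVec_eq_sum] at h3
  simp only [mul_assoc, ← Finset.mul_sum]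
  rw [h3]
  simp

end Poissonization

/-! ### The law of the hitting times of the discrete time chain -/

section PathSpace

variable {n : ℕ} (C : BirthDeathChain n) {z : Fin (n + 1)}

instance (x : Fin (n + 1)) : IsProbabilityMeasure (chainLaw C x) := by
  unfold chainLaw; infer_instance

/-- The definition of `killed` peels off the first step; the Markov property of the trajectory law
needs the last step instead. -/
lemma killed_succ' (K : Matrix (Fin (n + 1)) (Fin (n + 1)) ℝ) (f : Fin (n + 1) → ℝ) (m : ℕ)
    (x : Fin (n + 1)) :
    killed K z f (m + 1) x =
      killed K z (fun y => ∑ w, K y w * if w = z then 0 else f w) m x := by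
  induction m generalizing x with
  | zero => simp [killed]
  | succ m ih => rw [killed, killed]; simp only [ih]

lemma lintegral_stepKernel (x : Fin (n + 1)) (g : Fin (n + 1) → ENNReal) :
    ∫⁻ y, g y ∂(stepKernel C x) = ∑ y, ENNReal.ofReal (C.K x y) * g y := by
  change ∫⁻ y, g y ∂(∑ y, ENNReal.ofReal (C.K x y) • Measure.dirac y) = _
  rw [lintegral_finsetSum_measure]
  simp

/-- The trajectories avoiding `z` up to time `m`. -/
def avoid (z : Fin (n + 1)) (m : ℕ) : Set (ℕ → Fin (n + 1)) := {X | ∀ k ≤ m, X k ≠ z}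

lemma measurableSet_avoid (z : Fin (n + 1)) (m : ℕ) : MeasurableSet (avoid z m) := by
  have : avoid z m = ⋂ k, ⋂ _ : k ≤ m, (fun X : ℕ → Fin (n + 1) => X k) ⁻¹' {z}ᶜ := by
    ext X; simp [avoid]
  rw [this]
  exact MeasurableSet.iInter fun k => MeasurableSet.iInter fun _ =>
    (measurable_pi_apply k) (MeasurableSet.of_discrete)

/-- The Markov property at time `m`. -/
lemma lintegral_chainLaw_succ (x : Fin (n + 1)) (m : ℕ) (z : Fin (n + 1))
    (g : Fin (n + 1) → ENNReal) :
    ∫⁻ X, (avoid z m).indicator (fun X => g (X (m + 1))) X ∂(chainLaw C x) =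
      ∫⁻ X, (avoid z m).indicator
        (fun X => ∑ y, ENNReal.ofReal (C.K (X m) y) * g y) X ∂(chainLaw C x) := by
  set κ := historyKernel C
  set x₀ : (i : Finset.Iic 0) → (fun _ : ℕ => Fin (n + 1)) i := fun _ => x
  let S : Set ((i : Finset.Iic m) → (fun _ : ℕ => Fin (n + 1)) i) := {h | ∀ k, h k ≠ z}
  have hSm : MeasurableSet S := MeasurableSet.of_discrete
  have hS : ∀ X : ℕ → Fin (n + 1), X ∈ avoid z m ↔
      (Preorder.frestrictLe (π := fun _ : ℕ => Fin (n + 1)) m X) ∈ S := by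
    intro X
    exact ⟨fun H k => H k (Finset.mem_Iic.1 k.2), fun H k hk => H ⟨k, Finset.mem_Iic.2 hk⟩⟩
  -- The joint law of the history up to m and the next state is the law of the history composed with
  -- the step kernel.
  have e1 := Kernel.partialTraj_compProd_eq_map_traj (X := fun _ => Fin (n + 1)) (κ := κ) (Nat.zero_le m)
    (x₀ := x₀)
  have e2 := Kernel.traj_map_frestrictLe_apply (X := fun _ => Fin (n + 1)) (κ := κ) 0 m x₀
  let F : ((i : Finset.Iic m) → (fun _ : ℕ => Fin (n + 1)) i) × Fin (n + 1) → ENNReal :=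
    fun p => S.indicator (fun _ => g p.2) p.1
  have hF : Measurable F := measurable_of_countable F
  have h1 : ∫⁻ X, (avoid z m).indicator (fun X => g (X (m + 1))) X ∂(chainLaw C x) =
      ∫⁻ p, F p ∂((Kernel.traj κ 0 x₀).map
        (fun X => (Preorder.frestrictLe (π := fun _ : ℕ => Fin (n + 1)) m X, X (m + 1)))) := by
    rw [lintegral_map hF (by fun_prop)]
    refine lintegral_congr fun X => ?_
    simp only [F, Set.indicator, hS]
  have h2 : ∫⁻ X, (avoid z m).indicator
        (fun X => ∑ y, ENNReal.ofReal (C.K (X m) y) * g y) X ∂(chainLaw C x) =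
      ∫⁻ h, S.indicator (fun h => ∑ y, ENNReal.ofReal
        (C.K (h ⟨m, Finset.mem_Iic.2 le_rfl⟩) y) * g y) h ∂((Kernel.traj κ 0 x₀).map
        (Preorder.frestrictLe (π := fun _ : ℕ => Fin (n + 1)) m)) := by
    rw [lintegral_map (measurable_of_countable _) (by fun_prop)]
    refine lintegral_congr fun X => ?_
    simp only [Set.indicator, hS]
    rfl
  rw [h1, h2, e2, ← e1, Measure.lintegral_compProd hF]
  refine lintegral_congr fun h => ?_
  by_cases hh : h ∈ S
  · simp only [F, Set.indicator_of_mem hh]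
    exact lintegral_stepKernel C _ g
  · simp [F, Set.indicator_of_notMem hh]

lemma ae_start (x : Fin (n + 1)) : ∀ᵐ X ∂(chainLaw C x), X 0 = x := by
  have e2 := Kernel.traj_map_frestrictLe_apply (X := fun _ => Fin (n + 1))
    (κ := historyKernel C) 0 0 (fun _ => x)
  rw [Kernel.partialTraj_self, Kernel.id_apply] at e2
  have h : ∀ᵐ h ∂((chainLaw C x).map (Preorder.frestrictLe (π := fun _ : ℕ => Fin (n + 1)) 0)),
      h ⟨0, Finset.mem_Iic.2 le_rfl⟩ = x := by
    rw [chainLaw, e2, ae_dirac_eq]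
    rfl
  exact ae_of_ae_map (by fun_prop) h

/-- The bridge from the trajectory law to the matrix recursion for `killed`. -/
lemma lintegral_avoid (x : Fin (n + 1)) (z : Fin (n + 1)) (m : ℕ) (f : Fin (n + 1) → ℝ)
    (hf : ∀ y, 0 ≤ f y) :
    ∫⁻ X, (avoid z m).indicator (fun X => ENNReal.ofReal (f (X m))) X ∂(chainLaw C x) =
      ENNReal.ofReal (killed C.K z f m x) := by
  induction m generalizing f with
  | zero =>
    have : ∀ᵐ X ∂(chainLaw C x), (avoid z 0).indicator (fun X => ENNReal.ofReal (f (X 0))) X =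
        ENNReal.ofReal (killed C.K z f 0 x) := by
      filter_upwards [ae_start C x] with X hX
      simp only [Set.indicator, avoid, Set.mem_ofPred_eq, Nat.le_zero, forall_eq, hX, killed]
      by_cases hx : x = z <;> simp [hx]
    rw [lintegral_congr_ae this]
    simp
  | succ m ih =>
    rw [killed_succ', ← ih _ (fun y => Finset.sum_nonneg fun w _ => mul_nonneg (C.nonneg y w)
      (by split_ifs <;> simp [hf]))]
    have := lintegral_chainLaw_succ C x m z (fun w => ENNReal.ofReal (if w = z then 0 else f w))
    have h1 : ∀ X, (avoid z (m + 1)).indicator (fun X => ENNReal.ofReal (f (X (m + 1)))) X =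
        (avoid z m).indicator
          (fun X => ENNReal.ofReal (if X (m + 1) = z then 0 else f (X (m + 1)))) X := by
      intro X
      have hiff : X ∈ avoid z (m + 1) ↔ X ∈ avoid z m ∧ X (m + 1) ≠ z := by
        refine ⟨fun H => ⟨fun k hk => H k (by omega), H _ le_rfl⟩, fun H k hk => ?_⟩
        rcases Nat.lt_or_ge m k with h | h
        · rw [show k = m + 1 by omega]; exact H.2
        · exact H.1 k h
      by_cases h1 : X ∈ avoid z m <;> by_cases h2 : X (m + 1) = z <;>
        simp [Set.indicator, hiff, h1, h2]
    simp_rw [h1]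
    rw [this]
    refine lintegral_congr fun X => ?_
    congr 1
    ext X
    rw [ENNReal.ofReal_sum_of_nonneg]
    · exact Finset.sum_congr rfl fun y _ => (ENNReal.ofReal_mul (C.nonneg _ _)).symm
    · exact fun w _ => mul_nonneg (C.nonneg _ w) (by split_ifs <;> simp [hf])

lemma chainLaw_avoid (x z : Fin (n + 1)) (m : ℕ) :
    chainLaw C x (avoid z m) = ENNReal.ofReal (surv C.K z m x) := by
  have := lintegral_avoid C x z m (fun _ => 1) (by simp)
  rw [surv, ← this]
  simp [lintegral_indicator (measurableSet_avoid z m)]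

/-- The hitting time as a natural number. -/
def hitNat (z : Fin (n + 1)) (X : ℕ → Fin (n + 1)) : ℕ := sInf {m : ℕ | X m = z}

/-- A visit to z has to be assumed: for a trajectory missing z the infimum takes the default value
0. -/
lemma lt_hitNat_iff {X : ℕ → Fin (n + 1)} (hX : ∃ m, X m = z) (k : ℕ) :
    k < hitNat z X ↔ X ∈ avoid z k := by
  constructor
  · intro h j hj hz
    exact absurd (Nat.sInf_le (s := {m : ℕ | X m = z}) hz) (by simp only [hitNat] at h; omega)
  · intro h
    by_contra! hk
    exact h _ hk (Nat.sInf_mem (s := {m : ℕ | X m = z}) hX)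

lemma measurable_hitNat (z : Fin (n + 1)) : Measurable (hitNat z) := by
  classical
  have hA : MeasurableSet {X : ℕ → Fin (n + 1) | ∃ m, X m = z} := by
    have : {X : ℕ → Fin (n + 1) | ∃ m, X m = z} =
        ⋃ m, (fun X : ℕ → Fin (n + 1) => X m) ⁻¹' {z} := by ext; simp
    rw [this]
    exact MeasurableSet.iUnion fun m => measurable_pi_apply m (MeasurableSet.of_discrete)
  refine measurable_of_Ioi fun k => ?_
  have : hitNat z ⁻¹' Set.Ioi k = {X | ∃ m, X m = z} ∩ avoid z k := by
    ext X
    simp only [Set.mem_preimage, Set.mem_Ioi, Set.mem_inter_iff, Set.mem_ofPred_eq]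
    by_cases hX : ∃ m, X m = z
    · simp only [lt_hitNat_iff hX, hX, true_and]
    · have : hitNat z X = 0 := by
        rw [hitNat, Nat.sInf_eq_zero]
        right
        ext m
        simpa using fun h => hX ⟨m, h⟩
      simp [this, hX]
  rw [this]
  exact hA.inter (measurableSet_avoid z k)

lemma measurable_hit (z : Fin (n + 1)) : Measurable (hit z) :=
  measurable_from_nat.comp (measurable_hitNat z)

lemma ae_exists_hit {x : Fin (n + 1)} (h : Tendsto (fun m => surv C.K z m x) atTop (𝓝 0)) :
    ∀ᵐ X ∂(chainLaw C x), ∃ m, X m = z := by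
  rw [ae_iff]
  have h1 : ∀ m, chainLaw C x {X | ¬ ∃ m, X m = z} ≤ ENNReal.ofReal (surv C.K z m x) := by
    intro m
    rw [← chainLaw_avoid]
    exact measure_mono fun X hX k _ hk => hX ⟨k, hk⟩
  have h2 := ENNReal.tendsto_ofReal h
  rw [ENNReal.ofReal_zero] at h2
  exact le_antisymm (ge_of_tendsto' h2 h1) bot_le

/-- Layer cake formula for the hitting time. -/
lemma lintegral_hitNat {x : Fin (n + 1)} (h : Tendsto (fun m => surv C.K z m x) atTop (𝓝 0))
    {a : ℕ → ℝ} {S : ℝ} (ha : ∀ k, 0 ≤ a k) (hS : HasSum (fun k => a k * surv C.K z k x) S) :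
    ∫⁻ X, ENNReal.ofReal (∑ k ∈ Finset.range (hitNat z X), a k) ∂(chainLaw C x) =
      ENNReal.ofReal S := by
  have hs := surv_nonneg (z := z) C.nonneg
  have h1 : ∀ᵐ X ∂(chainLaw C x), ENNReal.ofReal (∑ k ∈ Finset.range (hitNat z X), a k) =
      ∑' k, (avoid z k).indicator (fun _ => ENNReal.ofReal (a k)) X := by
    filter_upwards [ae_exists_hit C h] with X hX
    rw [ENNReal.ofReal_sum_of_nonneg fun k _ => ha k, tsum_eq_sum (s := Finset.range (hitNat z X))]
    · refine Finset.sum_congr rfl fun k hk => ?_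
      rw [Set.indicator_of_mem ((lt_hitNat_iff hX k).1 (Finset.mem_range.1 hk))]
    · intro k hk
      exact Set.indicator_of_notMem
        (fun h => hk (Finset.mem_range.2 ((lt_hitNat_iff hX k).2 h))) _
  rw [lintegral_congr_ae h1, lintegral_tsum
    fun k => (measurable_const.indicator (measurableSet_avoid z k)).aemeasurable]
  rw [← hS.tsum_eq, ENNReal.ofReal_tsum_of_nonneg (fun k => mul_nonneg (ha k) (hs k x))
    hS.summable]
  refine tsum_congr fun k => ?_
  rw [lintegral_indicator (measurableSet_avoid z k), setLIntegral_const, chainLaw_avoid,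
    ENNReal.ofReal_mul (ha k)]

/-- A mean formula for a nonnegative random variable from its Lebesgue integral. -/
lemma integral_of_lintegral {Ω : Type*} [MeasurableSpace Ω] {μ : Measure Ω} {f : Ω → ℝ}
    (hf : AEStronglyMeasurable f μ) (h0 : ∀ᵐ x ∂μ, 0 ≤ f x) {S : ℝ} (hS : 0 ≤ S)
    (h : ∫⁻ x, ENNReal.ofReal (f x) ∂μ = ENNReal.ofReal S) :
    Integrable f μ ∧ ∫ x, f x ∂μ = S := by
  refine ⟨⟨hf, ?_⟩, ?_⟩
  · rw [hasFiniteIntegral_iff_ofReal h0, h]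
    exact ENNReal.ofReal_lt_top
  · rw [integral_eq_lintegral_of_nonneg_ae h0 hf, h, ENNReal.toReal_ofReal hS]

/-- The first two moments of the hitting time. -/
lemma hit_moments {x : Fin (n + 1)} {a b : ℝ} (h1 : HasSum (fun k => surv C.K z k x) a)
    (h2 : HasSum (fun k : ℕ => (2 * k + 1 : ℝ) * surv C.K z k x) b) :
    (∀ᵐ X ∂(chainLaw C x), ∃ m, X m = z) ∧ Integrable (hit z) (chainLaw C x) ∧
      Integrable (fun X => hit z X ^ 2) (chainLaw C x) ∧
      ∫ X, hit z X ∂(chainLaw C x) = a ∧ ∫ X, hit z X ^ 2 ∂(chainLaw C x) = b := by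
  have hs := surv_nonneg (z := z) C.nonneg
  have h0 := h1.summable.tendsto_atTop_zero
  have e1 := lintegral_hitNat C h0 (a := fun _ => 1) (by simp) (by simpa using h1)
  have e2 := lintegral_hitNat C h0 (a := fun k => 2 * k + 1) (fun k => by positivity) h2
  have s2 : ∀ m : ℕ, ∑ k ∈ Finset.range m, (2 * k + 1 : ℝ) = (m : ℝ) ^ 2 := by
    intro m
    induction m with
    | zero => simp
    | succ m ih => rw [Finset.sum_range_succ, ih]; push_cast; ring
  simp only [s2] at e2
  simp only [Finset.sum_const, Finset.card_range, nsmul_eq_mul, mul_one] at e1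
  obtain ⟨i1, m1⟩ := integral_of_lintegral (f := hit z) (measurable_hit z).aestronglyMeasurable
    (ae_of_all _ fun X => Nat.cast_nonneg _) (h1.nonneg fun k => hs k x) e1
  obtain ⟨i2, m2⟩ := integral_of_lintegral (f := fun X => hit z X ^ 2)
    ((measurable_hit z).pow_const 2).aestronglyMeasurable
    (ae_of_all _ fun X => sq_nonneg _) (h2.nonneg fun k => mul_nonneg (by positivity) (hs k x)) e2
  exact ⟨ae_exists_hit C h0, i1, i2, m1, m2⟩

end PathSpace

/-! ### The Poisson clock and the hitting times in continuous time -/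

section Clock

instance : IsProbabilityMeasure (expMeasure 1) := isProbabilityMeasure_expMeasure one_pos

instance : IsProbabilityMeasure clockLaw := by unfold clockLaw; infer_instance

lemma ae_pos_expMeasure : ∀ᵐ x ∂(expMeasure 1), 0 < x := by
  have h : expMeasure 1 (Set.Iic 0) = 0 := by
    rw [← ofReal_cdf, cdf_expMeasure_eq one_pos]
    simp
  rw [ae_iff]
  convert h using 2
  ext x
  simp

/-- Moments without integration by parts: a power of x times the exponential density is a multiple
of a gamma density, whose total mass is 1. -/
lemma lintegral_mul_expMeasure {a c : ℝ} (ha : 0 < a) (hc : 0 ≤ c) (g : ℝ → ℝ) (hg : Measurable g)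
    (h : ∀ x, 0 ≤ x → g x * gammaPDFReal 1 1 x = c * gammaPDFReal a 1 x) :
    ∫⁻ x, ENNReal.ofReal (g x) ∂(expMeasure 1) = ENNReal.ofReal c := by
  have hm : Measurable (gammaPDF 1 1) := (measurable_gammaPDFReal 1 1).ennreal_ofReal
  rw [expMeasure, gammaMeasure, lintegral_withDensity_eq_lintegral_mul _ hm hg.ennreal_ofReal]
  have : ∀ x, (gammaPDF 1 1 * fun x => ENNReal.ofReal (g x)) x =
      ENNReal.ofReal c * gammaPDF a 1 x := by
    intro x
    rcases lt_or_ge x 0 with hx | hx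
    · simp [gammaPDF_of_neg hx]
    · rw [Pi.mul_apply, gammaPDF, gammaPDF,
        ← ENNReal.ofReal_mul (gammaPDFReal_nonneg one_pos one_pos x),
        ← ENNReal.ofReal_mul hc, ← h x hx, mul_comm]
  simp_rw [this]
  have hma : Measurable (gammaPDF a 1) := (measurable_gammaPDFReal a 1).ennreal_ofReal
  rw [lintegral_const_mul _ hma,
    lintegral_gammaPDF_eq_one ha one_pos, mul_one]

lemma expMeasure_mean : Integrable (fun x : ℝ => x) (expMeasure 1) ∧ ∫ x, x ∂(expMeasure 1) = 1 := by
  refine integral_of_lintegral measurable_id.aestronglyMeasurable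
    (ae_pos_expMeasure.mono fun x hx => hx.le) zero_le_one
    (lintegral_mul_expMeasure (a := 2) two_pos zero_le_one _ measurable_id fun x hx => ?_)
  simp only [gammaPDFReal, if_pos hx]
  norm_num [Real.Gamma_two]

lemma expMeasure_second : Integrable (fun x : ℝ => x ^ 2) (expMeasure 1) ∧
    ∫ x, x ^ 2 ∂(expMeasure 1) = 2 := by
  refine integral_of_lintegral (by fun_prop)
    (ae_of_all _ fun x => sq_nonneg x) zero_le_two
    (lintegral_mul_expMeasure (a := 3) three_pos zero_le_two _ (by fun_prop) fun x hx => ?_)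
  simp only [gammaPDFReal, if_pos hx]
  have : Real.Gamma 3 = 2 := by
    have := Real.Gamma_nat_eq_factorial 2
    rw [show ((2 : ℕ) : ℝ) + 1 = 3 by norm_num] at this
    rw [this]
    norm_num [Nat.factorial]
  norm_num [this]
  ring

lemma ae_clock_pos : ∀ᵐ ξ ∂clockLaw, ∀ l, 0 < ξ l := by
  rw [ae_all_iff]
  intro l
  have := (measurePreserving_eval_infinitePi (fun _ : ℕ => expMeasure 1) l)
  exact this.quasiMeasurePreserving.ae ae_pos_expMeasure

lemma memLp_clock (l : ℕ) : MemLp (fun ξ : ℕ → ℝ => ξ l) 2 clockLaw := by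
  have h1 : MemLp (fun x : ℝ => x) 2 (expMeasure 1) :=
    (memLp_two_iff_integrable_sq measurable_id.aestronglyMeasurable).2 expMeasure_second.1
  exact h1.comp_measurePreserving (measurePreserving_eval_infinitePi (fun _ : ℕ => expMeasure 1) l)

lemma integral_clock (l : ℕ) : ∫ ξ, ξ l ∂clockLaw = 1 := by
  have h := measurePreserving_eval_infinitePi (fun _ : ℕ => expMeasure 1) l
  rw [← expMeasure_mean.2, ← h.map_eq, integral_map h.aemeasurable (by fun_prop)]
  rfl

lemma variance_clock (l : ℕ) : variance (fun ξ : ℕ → ℝ => ξ l) clockLaw = 1 := by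
  have h := measurePreserving_eval_infinitePi (fun _ : ℕ => expMeasure 1) l
  rw [variance_eq_sub (memLp_clock l), integral_clock]
  have : ∫ ξ, ((fun ξ : ℕ → ℝ => ξ l) ^ 2) ξ ∂clockLaw = 2 := by
    rw [← expMeasure_second.2, ← h.map_eq, integral_map h.aemeasurable (by fun_prop)]
    rfl
  rw [this]; norm_num

/-- The arrival times of the Poisson process. -/
def arrival (k : ℕ) (ξ : ℕ → ℝ) : ℝ := ∑ l ∈ Finset.range k, ξ l

lemma memLp_arrival (k : ℕ) : MemLp (arrival k) 2 clockLaw :=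
  memLp_finsetSum _ fun l _ => memLp_clock l

lemma integral_arrival (k : ℕ) : ∫ ξ, arrival k ξ ∂clockLaw = k := by
  simp only [arrival]
  rw [integral_finsetSum _ fun l _ => (memLp_clock l).integrable one_le_two]
  simp [integral_clock]

lemma integral_arrival_sq (k : ℕ) : ∫ ξ, arrival k ξ ^ 2 ∂clockLaw = (k : ℝ) ^ 2 + k := by
  have hi : iIndepFun (fun (l : ℕ) (ξ : ℕ → ℝ) => ξ l) clockLaw :=
    iIndepFun_infinitePi (P := fun _ : ℕ => expMeasure 1) (X := fun _ x => x)
      (fun _ => measurable_id)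
  have hv : variance (arrival k) clockLaw = k := by
    have := IndepFun.variance_sum (s := Finset.range k) (fun l _ => memLp_clock l)
      (fun i _ j _ hij => hi.indepFun hij)
    simp only [variance_clock, Finset.sum_const, Finset.card_range, nsmul_eq_mul, mul_one] at this
    rw [← this]
    congr 1
    ext ξ
    simp [arrival]
  have h2 := variance_eq_sub (memLp_arrival k)
  rw [hv, integral_arrival] at h2
  change _ = ∫ ξ, arrival k ξ ^ 2 ∂clockLaw - _ at h2
  linarith

lemma arrival_succ (k : ℕ) (ξ : ℕ → ℝ) : arrival (k + 1) ξ = arrival k ξ + ξ k :=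
  Finset.sum_range_succ _ _

lemma arrival_strictMono {ξ : ℕ → ℝ} (hξ : ∀ l, 0 < ξ l) : StrictMono fun k => arrival k ξ :=
  strictMono_nat_of_lt_succ fun k => by simp only [arrival_succ]; linarith [hξ k]

lemma arrival_nonneg {ξ : ℕ → ℝ} (hξ : ∀ l, 0 < ξ l) (k : ℕ) : 0 ≤ arrival k ξ :=
  Finset.sum_nonneg fun l _ => (hξ l).le

lemma poissonProcess_arrival {ξ : ℕ → ℝ} (hξ : ∀ l, 0 < ξ l) (k : ℕ) :
    poissonProcess ξ (arrival k ξ) = k := by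
  have : {j : ℕ | ∑ l ∈ Finset.range (j + 1), ξ l ≤ arrival k ξ} = (Finset.range k : Set ℕ) := by
    ext j
    rw [Finset.mem_coe, Finset.mem_range, ← Nat.succ_le_iff]
    exact (arrival_strictMono hξ).le_iff_le
  rw [poissonProcess, this, Set.ncard_coe_finset, Finset.card_range]

lemma poissonProcess_lt {ξ : ℕ → ℝ} (hξ : ∀ l, 0 < ξ l) {k : ℕ} {t : ℝ} (ht0 : 0 ≤ t)
    (ht : t < arrival k ξ) : poissonProcess ξ t < k := by
  have hk : 0 < k := by
    rcases Nat.eq_zero_or_pos k with rfl | hk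
    · simp [arrival] at ht; linarith
    · exact hk
  have : {j : ℕ | ∑ l ∈ Finset.range (j + 1), ξ l ≤ t} ⊆ (Finset.range (k - 1) : Set ℕ) := by
    intro j hj
    have h1 : arrival (j + 1) ξ < arrival k ξ := lt_of_le_of_lt hj ht
    have := (arrival_strictMono hξ).lt_iff_lt.1 h1
    rw [Finset.mem_coe, Finset.mem_range]
    omega
  have h2 := Set.ncard_le_ncard this (Finset.finite_toSet _)
  rw [Set.ncard_coe_finset, Finset.card_range] at h2
  rw [poissonProcess]
  omega

variable {n : ℕ} (C : BirthDeathChain n) {z : Fin (n + 1)}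

instance (x : Fin (n + 1)) : IsProbabilityMeasure (jointLaw C x) := by
  unfold jointLaw; infer_instance

/-- The clock shows exactly k at the k-th arrival and less before, so the first visit occurs at the
arrival numbered by the discrete hitting time. -/
lemma hitc_eq {X : ℕ → Fin (n + 1)} {ξ : ℕ → ℝ} (hX : ∃ m, X m = z) (hξ : ∀ l, 0 < ξ l) :
    (∃ t, 0 ≤ t ∧ X (poissonProcess ξ t) = z) ∧ hitc z (X, ξ) = arrival (hitNat z X) ξ := by
  have hz : X (hitNat z X) = z := Nat.sInf_mem (s := {m : ℕ | X m = z}) hX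
  have h1 : X (poissonProcess ξ (arrival (hitNat z X) ξ)) = z := by
    rw [poissonProcess_arrival hξ, hz]
  refine ⟨⟨_, arrival_nonneg hξ _, h1⟩, ?_⟩
  refine IsLeast.csInf_eq ⟨⟨arrival_nonneg hξ _, h1⟩, ?_⟩
  rintro t ⟨ht0, ht⟩
  by_contra! hlt
  have h2 := poissonProcess_lt hξ ht0 hlt
  have h3 : hitNat z X ≤ poissonProcess ξ t := Nat.sInf_le ht
  omega

/-- The first two moments of the hitting time in continuous time. -/
lemma hitc_moments {x : Fin (n + 1)} {a b : ℝ} (h1 : HasSum (fun k => surv C.K z k x) a)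
    (h2 : HasSum (fun k : ℕ => (2 * k + 1 : ℝ) * surv C.K z k x) b) :
    (∀ᵐ ω ∂(jointLaw C x), ∃ t, 0 ≤ t ∧ ω.1 (poissonProcess ω.2 t) = z) ∧
      MemLp (hitc z) 2 (jointLaw C x) ∧
      ∫ ω, hitc z ω ∂(jointLaw C x) = a ∧ ∫ ω, hitc z ω ^ 2 ∂(jointLaw C x) = b + a := by
  have hs := surv_nonneg (z := z) C.nonneg
  obtain ⟨hex, i1, i2, m1, m2⟩ := hit_moments C h1 h2
  have ha : 0 ≤ a := h1.nonneg fun k => hs k x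
  have hb : 0 ≤ b := h2.nonneg fun k => mul_nonneg (by positivity) (hs k x)
  have hae : ∀ᵐ ω ∂(jointLaw C x), (∃ m, ω.1 m = z) ∧ ∀ l, 0 < ω.2 l := by
    rw [jointLaw]
    exact (Measure.quasiMeasurePreserving_fst.ae hex).and
      (Measure.quasiMeasurePreserving_snd.ae ae_clock_pos)
  have heq : ∀ᵐ ω ∂(jointLaw C x), hitc z ω = arrival (hitNat z ω.1) ω.2 :=
    hae.mono fun ω hω => (hitc_eq hω.1 hω.2).2
  have h0 : ∀ᵐ ω ∂(jointLaw C x), 0 ≤ arrival (hitNat z ω.1) ω.2 :=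
    hae.mono fun ω hω => arrival_nonneg hω.2 _
  have hm : Measurable fun ω : (ℕ → Fin (n + 1)) × (ℕ → ℝ) => arrival (hitNat z ω.1) ω.2 := by
    have h : Measurable fun p : ℕ × (ℕ → ℝ) => arrival p.1 p.2 :=
      measurable_from_prod_countable_right fun k => by
        change Measurable fun ξ : ℕ → ℝ => ∑ l ∈ Finset.range k, ξ l
        fun_prop
    exact h.comp (((measurable_hitNat z).comp measurable_fst).prodMk measurable_snd)
  have L1 : ∫⁻ ω, ENNReal.ofReal (arrival (hitNat z ω.1) ω.2) ∂(jointLaw C x) =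
      ENNReal.ofReal a := by
    rw [jointLaw, lintegral_prod _ hm.ennreal_ofReal.aemeasurable]
    simp only
    rw [← m1, ofReal_integral_eq_lintegral_ofReal i1 (ae_of_all _ fun X => Nat.cast_nonneg _)]
    refine lintegral_congr fun X => ?_
    rw [← ofReal_integral_eq_lintegral_ofReal ((memLp_arrival _).integrable one_le_two)
      (ae_clock_pos.mono fun ξ hξ => arrival_nonneg hξ _), integral_arrival]
    rfl
  -- Given the trajectory, a sum of k standard exponentials has second moment k² + k. The second
  -- moment thus gains exactly one mean over discrete time.
  have L2 : ∫⁻ ω, ENNReal.ofReal (arrival (hitNat z ω.1) ω.2 ^ 2) ∂(jointLaw C x) =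
      ENNReal.ofReal (b + a) := by
    rw [jointLaw, lintegral_prod _ (hm.pow_const 2).ennreal_ofReal.aemeasurable]
    simp only
    rw [← m1, ← m2, ← integral_add i2 i1, ofReal_integral_eq_lintegral_ofReal
      (f := fun X => hit z X ^ 2 + hit z X) (i2.add i1)
      (ae_of_all _ fun X => add_nonneg (sq_nonneg _) (Nat.cast_nonneg _))]
    refine lintegral_congr fun X => ?_
    rw [← ofReal_integral_eq_lintegral_ofReal ((memLp_arrival _).integrable_sq)
      (ae_of_all _ fun ξ => sq_nonneg _), integral_arrival_sq]
    rfl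
  obtain ⟨-, M1⟩ := integral_of_lintegral hm.aestronglyMeasurable h0 ha L1
  obtain ⟨I2, M2⟩ := integral_of_lintegral (hm.pow_const 2).aestronglyMeasurable
    (ae_of_all _ fun ω => sq_nonneg _) (add_nonneg hb ha) L2
  refine ⟨hae.mono fun ω hω => (hitc_eq hω.1 hω.2).1, ?_, ?_, ?_⟩
  · exact (memLp_congr_ae heq).2
      ((memLp_two_iff_integrable_sq hm.aestronglyMeasurable).2 I2)
  · rw [integral_congr_ae heq, M1]
  · rw [← M2]
    exact integral_congr_ae (heq.mono fun ω hω => by simp only [hω])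

end Clock

/-! ### Hitting times of the chain in terms of its rates -/

section Hitting

variable {n : ℕ} {C : BirthDeathChain n} {π : Fin (n + 1) → ℝ}

lemma hit_summary {x z : Fin (n + 1)} {a v : ℝ}
    (h1 : HasSum (fun k => surv C.K z k x) a)
    (h2 : HasSum (fun k : ℕ => (2 * k + 1 : ℝ) * surv C.K z k x) (v - a + a ^ 2)) :
    HitRegular C x z ∧ ∫ X, hit z X ∂(chainLaw C x) = a ∧
      ∫ ω, hitc z ω ∂(jointLaw C x) = a ∧ variance (hit z) (chainLaw C x) = v - a ∧
      variance (hitc z) (jointLaw C x) = v := by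
  obtain ⟨e1, i1, i2, m1, m2⟩ := hit_moments C h1 h2
  obtain ⟨f1, p, n1, n2⟩ := hitc_moments C h1 h2
  have q : MemLp (hit z) 2 (chainLaw C x) :=
    (memLp_two_iff_integrable_sq (measurable_hit z).aestronglyMeasurable).2 i2
  refine ⟨⟨e1, f1, q, p⟩, m1, n1, ?_, ?_⟩
  · rw [variance_eq_sub q, m1]
    change ∫ X, hit z X ^ 2 ∂(chainLaw C x) - _ = _
    rw [m2]; ring
  · rw [variance_eq_sub p, n1]
    change ∫ X, hitc z X ^ 2 ∂(jointLaw C x) - _ = _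
    rw [n2]; ring

/-- The larger of the variances of the hitting times in discrete time. -/
def stepVar (K : Matrix (Fin (n + 1)) (Fin (n + 1)) ℝ) (π : Fin (n + 1) → ℝ) (M : Fin (n + 1)) :
    ℝ :=
  max (upVar K π M 0 - upMean K π M 0)
    (upVar (revK K) (revW π) M.rev 0 - upMean (revK K) (revW π) M.rev 0)

/-- The hitting times of `M` from both ends. -/
lemma hitting_times (h : IsBD C.K π) (M : Fin (n + 1)) :
    HitRegular C 0 M ∧ HitRegular C (Fin.last n) M ∧ theta C M = hitMean C.K π M ∧
      thetac C M = hitMean C.K π M ∧ alpha C M = √(hitVar C.K π M) ∧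
      beta C M = √(stepVar C.K π M) := by
  have hr := h.rev
  have e : ∀ k, surv (revK C.K) M.rev k 0 = surv C.K M k (Fin.last n) := fun k => by
    rw [← surv_rev (K := C.K) (z := M) k (Fin.last n), Fin.rev_last]; rfl
  have a1 := h.hasSum_surv_upMean (z := M) (x := 0) (Fin.zero_le _)
  have a2 := h.hasSum_surv_upVar (z := M) (x := 0) (Fin.zero_le _)
  have b1 := hr.hasSum_surv_upMean (z := M.rev) (x := 0) (Fin.zero_le _)
  have b2 := hr.hasSum_surv_upVar (z := M.rev) (x := 0) (Fin.zero_le _)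
  simp only [e] at b1 b2
  obtain ⟨r1, t1, c1, v1, w1⟩ := hit_summary a1 a2
  obtain ⟨r2, t2, c2, v2, w2⟩ := hit_summary b1 b2
  refine ⟨r1, r2, ?_, ?_, ?_, ?_⟩
  · rw [theta, t1, t2]; rfl
  · rw [thetac, c1, c2]; rfl
  · rw [alpha, w1, w2]; rfl
  · rw [beta, v1, v2]; rfl

lemma IsBD.stepVar_le {K : Matrix (Fin (n + 1)) (Fin (n + 1)) ℝ} (h : IsBD K π)
    (M : Fin (n + 1)) : stepVar K π M ≤ hitVar K π M := by
  have h1 := h.upMean_nonneg M 0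
  have h2 := h.rev.upMean_nonneg M.rev 0
  exact max_le_max (by linarith) (by linarith)

lemma IsBD.mul_hitVar_le_stepVar {K : Matrix (Fin (n + 1)) (Fin (n + 1)) ℝ} (h : IsBD K π)
    {δ : ℝ} (hδ0 : 0 ≤ δ) (hδ : ∀ x, δ ≤ K x x) (M : Fin (n + 1)) :
    δ * hitVar K π M ≤ stepVar K π M := by
  have h1 := h.upMean_le_mul_upVar hδ (M := M) (by omega) 0
  have h2 := h.rev.upMean_le_mul_upVar (δ := δ) (fun x => hδ _) (M := M.rev) (by omega) 0
  rw [hitVar, mul_max_of_nonneg _ _ hδ0]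
  exact max_le_max (by linarith) (by linarith)

end Hitting

/-! ### Mixing times -/

section MixingTimes

variable {n : ℕ} {K : Matrix (Fin (n + 1)) (Fin (n + 1)) ℝ} {π : Fin (n + 1) → ℝ}
  {M : Fin (n + 1)}

lemma tvDist_le {μ ν : Fin (n + 1) → ℝ} {ε : ℝ}
    (h : ∀ A : Finset (Fin (n + 1)), ∑ x ∈ A, μ x - ∑ x ∈ A, ν x ≤ ε) : tvDist μ ν ≤ ε :=
  ciSup_le h

lemma one_sub_le_tvDist {μ ν : Fin (n + 1) → ℝ} (hμ : ∑ x, μ x = 1) (hν : ∑ x, ν x = 1) {η : ℝ}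
    {B : Finset (Fin (n + 1))} (h1 : ∑ x ∈ B, μ x ≤ η) (h2 : 1 - η ≤ ∑ x ∈ B, ν x) :
    1 - 2 * η ≤ tvDist μ ν := by
  classical
  have := le_tvDist μ ν Bᶜ
  rw [← Finset.sum_add_sum_compl B] at hμ hν
  linarith

lemma tvDist_le_maxTV (K : Matrix (Fin (n + 1)) (Fin (n + 1)) ℝ) (π : Fin (n + 1) → ℝ) (m : ℕ)
    (x : Fin (n + 1)) : tvDist ((K ^ m) x) π ≤ maxTV K π m :=
  le_ciSup (f := fun x => tvDist ((K ^ m) x) π) (Set.finite_range _).bddAbove x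

lemma tvDist_le_maxTVc (K : Matrix (Fin (n + 1)) (Fin (n + 1)) ℝ) (π : Fin (n + 1) → ℝ) (t : ℝ)
    (x : Fin (n + 1)) : tvDist (heat K t x) π ≤ maxTVc K π t :=
  le_ciSup (f := fun x => tvDist (heat K t x) π) (Set.finite_range _).bddAbove x

/-- Two sided bounds on the discrete time mixing time. -/
theorem abs_mixTime_sub_le {c δ ε : ℝ} (hc : 0 < c) (hδ : 0 < δ) (hε : ε ∈ Set.Ioo (0 : ℝ) 1) :
    ∃ D : ℝ, ∀ {n : ℕ} {K : Matrix (Fin (n + 1)) (Fin (n + 1)) ℝ} {π : Fin (n + 1) → ℝ}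
      {M : Fin (n + 1)}, IsBD K π → 1 ≤ n → (∀ x, δ ≤ K x x) → c ≤ cum π M → c ≤ tailWt π M →
      |(mixTime K π ε : ℝ) - hitMean K π M| ≤ D * √(hitVar K π M) ∧
        (Real.log (1 / (2 * ε)) ≤ 2 * (spectralGap K * mixTime K π ε) ∨
          1 / 2 ≤ spectralGap K) := by
  obtain ⟨D₁, hD₁, H₁⟩ := IsBD.sum_sub_le_of_late hc hδ hε.1
  -- With this η the distance before the hitting times is at least 1 - 2η = (1 + ε)/2, which exceeds
  -- ε.
  obtain ⟨D₂, hD₂, H₂⟩ := IsBD.exists_sum_le_of_early (η := (1 - ε) / 4) hc (by linarith [hε.2])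
  refine ⟨D₁ + 1 + D₂, fun {n K π M} h hn hK hL hR => ?_⟩
  obtain ⟨hlam, hP, -⟩ := h.poincare_spectralGap hn
  set α := √(hitVar K π M) with hα
  have hα1 : 1 ≤ α := h.one_le_sqrt_hitVar hn
  have hV : hitVar K π M ≤ α ^ 2 := h.sq_sqrt_hitVar.ge
  have hla := h.one_le_spectralGap_mul (M := M) hn
  have hθ := h.one_le_hitMean (M := M) hn
  have hmem : ⌈hitMean K π M + D₁ * α⌉₊ ∈ {m : ℕ | maxTV K π m ≤ ε} :=
    ciSup_le fun x => tvDist_le fun A =>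
      H₁ h hP hlam hK hL hR hV hα1 hla _ (Nat.le_ceil _) x A
  have hT : maxTV K π (mixTime K π ε) ≤ ε := Nat.sInf_mem (s := {m : ℕ | maxTV K π m ≤ ε}) ⟨_, hmem⟩
  refine ⟨?_, ?_⟩
  · rw [abs_le]
    constructor
    · obtain ⟨x, B, hB, hx⟩ := H₂ h hP hlam hL hR hV (by linarith) hla
      by_contra! hlt
      have h1 : (mixTime K π ε : ℝ) ≤ hitMean K π M - D₂ * α := by
        have : 0 ≤ (D₁ + 1) * α := by positivity
        linarith
      have h2 := one_sub_le_tvDist (h.toIsReversible.pow_row_sum _ x) h.weight_sum (hx _ h1) hB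
      have h3 := h2.trans ((tvDist_le_maxTV K π _ x).trans hT)
      linarith [hε.2]
    · have h1 : (mixTime K π ε : ℝ) ≤ ⌈hitMean K π M + D₁ * α⌉₊ :=
        Nat.cast_le.2 (Nat.sInf_le hmem)
      have h2 := Nat.ceil_lt_add_one (a := hitMean K π M + D₁ * α) (by positivity)
      have h3 : 0 ≤ D₂ * α := by positivity
      linarith
  -- Below 1/2 one has exp(-2λ) ≤ 1 - λ, which turns powers of 1 - λ into exponentials. A larger gap
  -- needs no estimate, since θ tends to infinity.
  · rcases le_or_gt (1 / 2) (spectralGap K) with hl | hl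
    · exact Or.inr hl
    · left
      have h1 := (h.abs_pow_le_maxTV hn (mixTime K π ε)).trans
        (mul_le_mul_of_nonneg_left hT zero_le_two)
      have h2 : Real.exp (-(2 * spectralGap K)) ≤ 1 - spectralGap K := by
        have h3 := Real.add_one_le_exp (2 * spectralGap K)
        rw [Real.exp_neg, inv_le_comm₀ (Real.exp_pos _) (by linarith)]
        refine le_trans ?_ h3
        rw [inv_le_iff_one_le_mul₀ (by linarith)]
        nlinarith
      have h4 : Real.exp (-(2 * (spectralGap K * mixTime K π ε))) ≤ 2 * ε := by
        calc _ = Real.exp (-(2 * spectralGap K)) ^ (mixTime K π ε) := by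
              rw [← Real.exp_nat_mul]; congr 1; ring
          _ ≤ (1 - spectralGap K) ^ (mixTime K π ε) := by gcongr
          _ ≤ _ := (le_abs_self _).trans h1
      rw [one_div, Real.log_inv, neg_le, Real.le_log_iff_exp_le (by linarith [hε.1])]
      exact h4

/-- Two sided bounds on the continuous time mixing time. -/
theorem abs_mixTimec_sub_le {c ε : ℝ} (hc : 0 < c) (hε : ε ∈ Set.Ioo (0 : ℝ) 1) :
    ∃ D : ℝ, ∀ {n : ℕ} {K : Matrix (Fin (n + 1)) (Fin (n + 1)) ℝ} {π : Fin (n + 1) → ℝ}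
      {M : Fin (n + 1)}, IsBD K π → 1 ≤ n → c ≤ cum π M → c ≤ tailWt π M →
      |mixTimec K π ε - hitMean K π M| ≤ D * √(hitVar K π M) ∧
        Real.log (1 / (2 * ε)) ≤ 2 * (spectralGap K * mixTimec K π ε) := by
  obtain ⟨D₁, hD₁, H₁⟩ := IsBD.sum_heat_sub_le_of_late hc hε.1
  obtain ⟨D₂, hD₂, H₂⟩ := IsBD.exists_sum_heat_le_of_early (η := (1 - ε) / 4) hc
    (by linarith [hε.2])
  refine ⟨D₁ + D₂, fun {n K π M} h hn hL hR => ?_⟩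
  obtain ⟨hlam, hP, -⟩ := h.poincare_spectralGap hn
  set α := √(hitVar K π M) with hα
  have hα1 : 1 ≤ α := h.one_le_sqrt_hitVar hn
  have hV : hitVar K π M = α ^ 2 := h.sq_sqrt_hitVar.symm
  have hla := h.one_le_spectralGap_mul (M := M) hn
  have hθ := h.one_le_hitMean (M := M) hn
  have hmem : hitMean K π M + D₁ * α ∈ {t : ℝ | 0 ≤ t ∧ maxTVc K π t ≤ ε} :=
    ⟨by positivity, ciSup_le fun x => tvDist_le fun A => H₁ h hP hlam hL hR hV hα1 hla x A⟩
  have h0 : 0 ≤ mixTimec K π ε := le_csInf ⟨_, hmem⟩ fun t ht => ht.1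
  refine ⟨?_, ?_⟩
  · rw [abs_le]
    constructor
    · obtain ⟨x, B, hB, hx⟩ := H₂ h hP hlam hL hR hV (by linarith) hla
      have : hitMean K π M - D₂ * α ≤ mixTimec K π ε := by
        refine le_csInf ⟨_, hmem⟩ fun t ht => ?_
        by_contra! hlt
        have h2 := one_sub_le_tvDist (h.toIsReversible.heat_row_sum _ x) h.weight_sum
          (hx _ ht.1 hlt.le) hB
        have h3 := h2.trans ((tvDist_le_maxTVc K π _ x).trans ht.2)
        linarith [hε.2]
      have h3 : 0 ≤ D₁ * α := by positivity
      linarith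
    · have h1 : mixTimec K π ε ≤ hitMean K π M + D₁ * α :=
        csInf_le ⟨0, fun t ht => ht.1⟩ hmem
      have h3 : 0 ≤ D₂ * α := by positivity
      linarith
  · have h1 : Real.log (1 / (2 * ε)) / spectralGap K ≤ mixTimec K π ε := by
      refine le_csInf ⟨_, hmem⟩ fun t ht => ?_
      have h2 := (h.exp_le_maxTVc hn t).trans (mul_le_mul_of_nonneg_left ht.2 zero_le_two)
      rw [div_le_iff₀ hlam, one_div, Real.log_inv, neg_le,
        Real.le_log_iff_exp_le (by linarith [hε.1])]
      rwa [show -(t * spectralGap K) = -spectralGap K * t by ring]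
    rw [div_le_iff₀ hlam] at h1
    have := mul_nonneg hlam.le h0
    linarith

end MixingTimes

/-! ### Cutoff criteria for sequences of mixing times -/

section Sequences

lemma tendsto_div_of_tendsto_div_atTop {θ b : ℕ → ℝ}
    (h : Tendsto (fun n => θ n / b n) atTop atTop) :
    Tendsto (fun n => b n / θ n) atTop (𝓝 0) :=
  h.inv_tendsto_atTop.congr fun n => by simp

/-- Quantities controlling a family of mixing times `S`: the mean `θ` of the hitting times, the
square root `α` of their variance, the spectral gap `lam` and a window size `b`. -/
structure CutoffData (S : ℕ → ℝ → ℝ) (θ α lam b : ℕ → ℝ) (c ρ : ℝ) : Prop where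
  c_pos : 0 < c
  ρ_pos : 0 < ρ
  gap_pos : ∀ n, 1 ≤ n → 0 < lam n
  one_le_scale : ∀ n, 1 ≤ n → 1 ≤ α n
  half_le_mean : ∀ n : ℕ, 1 ≤ n → (n : ℝ) / 2 ≤ θ n
  one_le_gap_mul : ∀ n, 1 ≤ n → 1 ≤ lam n * α n
  gap_mul_sq_le : ∀ n, 1 ≤ n → lam n * c * α n ^ 2 ≤ 2 * θ n
  window_le : ∀ n, 1 ≤ n → b n ≤ α n
  le_window : ∀ n, 1 ≤ n → ρ * α n ≤ b n
  mixing : ∀ ε ∈ Set.Ioo (0 : ℝ) 1, ∃ D : ℝ, ∀ n, 1 ≤ n → |S n ε - θ n| ≤ D * α n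
  relaxation : ∀ ε ∈ Set.Ioo (0 : ℝ) 1, ∀ n, 1 ≤ n →
    Real.log (1 / (2 * ε)) ≤ 2 * (lam n * S n ε) ∨ 1 / 2 ≤ lam n

namespace CutoffData

variable {S : ℕ → ℝ → ℝ} {θ α lam b : ℕ → ℝ} {c ρ : ℝ} (H : CutoffData S θ α lam b c ρ)
include H

lemma mean_pos {n : ℕ} (hn : 1 ≤ n) : 0 < θ n := by
  have := H.half_le_mean n hn
  have : (1 : ℝ) ≤ n := by exact_mod_cast hn
  linarith

lemma scale_pos {n : ℕ} (hn : 1 ≤ n) : 0 < α n := by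
  linarith [H.one_le_scale n hn]

lemma window_pos {n : ℕ} (hn : 1 ≤ n) : 0 < b n :=
  (mul_pos H.ρ_pos (H.scale_pos hn)).trans_le (H.le_window n hn)

lemma tendsto_mean : Tendsto θ atTop atTop := by
  have : Tendsto (fun n : ℕ => (n : ℝ) / 2) atTop atTop :=
    tendsto_natCast_atTop_atTop.atTop_div_const two_pos
  exact tendsto_atTop_mono' _ ((eventually_ge_atTop 1).mono H.half_le_mean) this

/-- θλ ≥ ρ·θ/b because 1 ≤ λα and ρα ≤ b; conversely (θ/b)² ≥ (θ/α)² ≥ (c/2)θλ. -/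
lemma tendsto_mul_gap_iff :
    Tendsto (fun n => θ n * lam n) atTop atTop ↔ Tendsto (fun n => θ n / b n) atTop atTop := by
  have hρ := H.ρ_pos
  have hc := H.c_pos
  constructor
  · intro h
    rw [tendsto_atTop] at h ⊢
    intro B
    filter_upwards [h (2 * B ^ 2 / c), eventually_ge_atTop 1] with n h1 hn
    have hb := H.window_pos hn
    have hα := H.scale_pos hn
    have hθ := H.mean_pos hn
    have h2 : B * α n ≤ θ n := by
      refine le_of_sq_le_sq ?_ hθ.le
      have h3 := H.gap_mul_sq_le n hn
      rw [div_le_iff₀ hc] at h1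
      have h4 : 2 * (B ^ 2 * α n ^ 2) ≤ 2 * θ n ^ 2 := by
        calc 2 * (B ^ 2 * α n ^ 2) = 2 * B ^ 2 * α n ^ 2 := by ring
          _ ≤ θ n * lam n * c * α n ^ 2 := by gcongr
          _ = θ n * (lam n * c * α n ^ 2) := by ring
          _ ≤ θ n * (2 * θ n) := by gcongr
          _ = _ := by ring
      rw [mul_pow]; linarith
    rw [le_div_iff₀ hb]
    rcases le_or_gt B 0 with hB | hB
    · exact (mul_nonpos_of_nonpos_of_nonneg hB hb.le).trans hθ.le
    · exact (mul_le_mul_of_nonneg_left (H.window_le n hn) hB.le).trans h2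
  · intro h
    have h' := h.const_mul_atTop hρ
    refine tendsto_atTop_mono' _ ((eventually_ge_atTop 1).mono fun n hn => ?_) h'
    have hb := H.window_pos hn
    rw [mul_div_assoc', div_le_iff₀ hb]
    have h1 : ρ * (lam n * α n) ≤ lam n * b n := by
      have := mul_le_mul_of_nonneg_left (H.le_window n hn) (H.gap_pos n hn).le
      linarith
    have h2 : ρ ≤ lam n * b n :=
      (le_mul_of_one_le_right hρ.le (H.one_le_gap_mul n hn)).trans h1
    calc ρ * θ n = θ n * ρ := mul_comm _ _
      _ ≤ θ n * (lam n * b n) := mul_le_mul_of_nonneg_left h2 (H.mean_pos hn).le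
      _ = _ := by ring

lemma exists_window (ε : ℝ) (hε : ε ∈ Set.Ioo (0 : ℝ) 1) :
    ∃ D : ℝ, ∀ n, 1 ≤ n → |S n ε - θ n| ≤ D * b n := by
  obtain ⟨D, hD⟩ := H.mixing ε hε
  refine ⟨D / ρ, fun n hn => ?_⟩
  have hα := H.scale_pos hn
  have h1 := hD n hn
  have hD0 : 0 ≤ D := by
    by_contra! h
    linarith [abs_nonneg (S n ε - θ n), mul_neg_of_neg_of_pos h hα]
  calc _ ≤ D * α n := h1
    _ = D / ρ * (ρ * α n) := by have := H.ρ_pos; field_simp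
    _ ≤ D / ρ * b n := mul_le_mul_of_nonneg_left (H.le_window n hn) (div_nonneg hD0 H.ρ_pos.le)

lemma tendsto_div_mean (h : Tendsto (fun n => θ n / b n) atTop atTop) (ε : ℝ)
    (hε : ε ∈ Set.Ioo (0 : ℝ) 1) : Tendsto (fun n => S n ε / θ n) atTop (𝓝 1) := by
  obtain ⟨D, hD⟩ := H.exists_window ε hε
  have h1 := (tendsto_div_of_tendsto_div_atTop h).const_mul D
  rw [mul_zero] at h1
  rw [tendsto_iff_dist_tendsto_zero]
  refine squeeze_zero' (Eventually.of_forall fun n => dist_nonneg)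
    ((eventually_ge_atTop 1).mono fun n hn => ?_) h1
  have hθ := H.mean_pos hn
  have e : S n ε / θ n - 1 = (S n ε - θ n) / θ n := by field_simp
  rw [Real.dist_eq, e, abs_div, abs_of_pos hθ, mul_div_assoc']
  gcongr
  exact hD n hn

lemma hasWindow (h : Tendsto (fun n => θ n / b n) atTop atTop) : HasWindow S θ b := by
  refine ⟨fun n hn => ⟨H.mean_pos hn, H.window_pos hn⟩, tendsto_div_of_tendsto_div_atTop h, fun ε hε => ?_⟩
  obtain ⟨D, hD⟩ := H.exists_window ε hε
  exact ⟨D, (eventually_ge_atTop 1).mono fun n hn =>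
    (div_le_iff₀ (H.window_pos hn)).2 (hD n hn)⟩

lemma tendsto_mul_gap_of_hasCutoffc (h : HasCutoffc S) :
    Tendsto (fun n => θ n * lam n) atTop atTop := by
  obtain ⟨t, ht, hS⟩ := h
  have hc := H.c_pos
  obtain ⟨D, hD⟩ := H.mixing (1 / 4) (by norm_num)
  have hD0 : 0 ≤ D := by
    have := (abs_nonneg _).trans (hD 1 le_rfl)
    exact nonneg_of_mul_nonneg_left this (H.scale_pos le_rfl)
  rw [tendsto_atTop]
  intro B
  -- R is the value that λ·S(1/4) must exceed to force θλ ≥ |B|, and ε makes log(1/(2ε)) ≥ 8R. Of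
  -- the factor 8, relaxation uses 2 and the comparison of S(ε) with S(1/4) uses 4.
  set R : ℝ := D + (1 + 2 * D / c) * |B| with hR
  have hR0 : 0 ≤ R := by positivity
  set ε : ℝ := Real.exp (-(8 * R)) / 4 with hε
  have hε0 : 0 < ε := by positivity
  have hε1 : ε < 1 := by
    have : Real.exp (-(8 * R)) ≤ 1 := Real.exp_le_one_iff.2 (by linarith)
    linarith
  have hlog : 8 * R ≤ Real.log (1 / (2 * ε)) := by
    rw [Real.le_log_iff_exp_le (by positivity), hε, Real.exp_neg]
    field_simp
    norm_num
  have e1 := (hS ε ⟨hε0, hε1⟩).eventually (gt_mem_nhds (by norm_num : (1 : ℝ) < 2))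
  have e2 := (hS (1 / 4) (by norm_num)).eventually (lt_mem_nhds (by norm_num : (1 / 2 : ℝ) < 1))
  -- Used only in the case of a gap at least 1/2.
  have e3 := H.tendsto_mean.eventually_ge_atTop (2 * |B|)
  filter_upwards [e1, e2, e3, eventually_ge_atTop 1] with n h1 h2 h3 hn
  have hlam := H.gap_pos n hn
  have hα := H.scale_pos hn
  have htn := ht n hn
  refine (le_abs_self B).trans ?_
  rcases H.relaxation ε ⟨hε0, hε1⟩ n hn with h4 | h4
  · rw [div_lt_iff₀ htn] at h1
    rw [lt_div_iff₀ htn] at h2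
    have h5 : S n ε ≤ 4 * S n (1 / 4) := by linarith
    have h6 : R ≤ lam n * S n (1 / 4) := by
      have := mul_le_mul_of_nonneg_left h5 hlam.le
      linarith
    have h7 : S n (1 / 4) ≤ θ n + D * α n := by linarith [(abs_le.1 (hD n hn)).2]
    have h8 : lam n * α n ≤ 1 + 2 / c * (θ n * lam n) := by
      have h9 : (lam n * α n) ^ 2 ≤ 2 / c * (θ n * lam n) := by
        have := mul_le_mul_of_nonneg_left (H.gap_mul_sq_le n hn) hlam.le
        rw [div_mul_eq_mul_div, le_div_iff₀ hc]
        linarith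
      nlinarith [sq_nonneg (lam n * α n - 1)]
    have h10 : R ≤ D + (1 + 2 * D / c) * (θ n * lam n) := by
      calc R ≤ lam n * (θ n + D * α n) := h6.trans (mul_le_mul_of_nonneg_left h7 hlam.le)
        _ = θ n * lam n + D * (lam n * α n) := by ring
        _ ≤ θ n * lam n + D * (1 + 2 / c * (θ n * lam n)) := by gcongr
        _ = _ := by ring
    have h11 : (1 + 2 * D / c) * |B| ≤ (1 + 2 * D / c) * (θ n * lam n) := by linarith
    exact le_of_mul_le_mul_left h11 (by positivity)
  · have := mul_le_mul h3 h4 (by norm_num) (H.mean_pos hn).le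
    linarith

theorem hasCutoffc_iff :
    HasCutoffc S ↔ Tendsto (fun n => θ n * lam n) atTop atTop :=
  ⟨H.tendsto_mul_gap_of_hasCutoffc, fun h =>
    ⟨θ, fun _ hn => H.mean_pos hn, H.tendsto_div_mean (H.tendsto_mul_gap_iff.1 h)⟩⟩

theorem hasWindow_of_hasCutoffc (h : HasCutoffc S) : HasWindow S θ b :=
  H.hasWindow (H.tendsto_mul_gap_iff.1 (H.tendsto_mul_gap_of_hasCutoffc h))

end CutoffData

/-- Integer cutoff times are obtained by rounding θ up, which is harmless because θ tends to
infinity. -/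
lemma CutoffData.hasCutoff_iff_hasCutoffc {T : ℕ → ℝ → ℕ} {θ α lam b : ℕ → ℝ} {c ρ : ℝ}
    (H : CutoffData (fun n ε => (T n ε : ℝ)) θ α lam b c ρ) :
    HasCutoff T ↔ HasCutoffc fun n ε => (T n ε : ℝ) := by
  constructor
  · rintro ⟨t, ht, h⟩
    exact ⟨fun n => t n, fun n hn => Nat.cast_pos.2 (ht n hn), h⟩
  · intro h
    have h1 := H.tendsto_mul_gap_iff.1 (H.tendsto_mul_gap_of_hasCutoffc h)
    refine ⟨fun n => ⌈θ n⌉₊, fun n hn => Nat.ceil_pos.2 (H.mean_pos hn), fun ε hε => ?_⟩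
    have h2 := (tendsto_nat_ceil_div_atTop (R := ℝ)).comp H.tendsto_mean
    have h3 := (H.tendsto_div_mean h1 ε hε).div h2 one_ne_zero
    rw [div_one] at h3
    refine h3.congr' ((eventually_ge_atTop 1).mono fun n hn => ?_)
    have := (H.mean_pos hn).ne'
    simp only [Pi.div_apply, Function.comp]
    field_simp

end Sequences

end BDCutoff

end

/-! ### The theorem -/

theorem theorem1p6
    (C : (n : ℕ) → BDCutoff.BirthDeathChain n)
    (π : (n : ℕ) → Fin (n + 1) → ℝ)
    (hπ : ∀ n, 1 ≤ n → BDCutoff.IsStationary (C n).K (π n))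
    (M : (n : ℕ) → Fin (n + 1))
    (hleft : ∃ c : ℝ, 0 < c ∧ ∀ n, 1 ≤ n → c ≤ ∑ i ∈ Finset.Iic (M n), π n i)
    (hright : ∃ c : ℝ, 0 < c ∧ ∀ n, 1 ≤ n → c ≤ ∑ i ∈ Finset.Ici (M n), π n i) :
    -- the hitting times are regular, and the two expressions for `θ_n` agree
    (∀ n, 1 ≤ n →
      BDCutoff.HitRegular (C n) 0 (M n) ∧
      BDCutoff.HitRegular (C n) (Fin.last n) (M n) ∧
      BDCutoff.theta (C n) (M n) = BDCutoff.thetac (C n) (M n)) ∧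
    -- continuous time
    ((BDCutoff.HasCutoffc (fun n => BDCutoff.mixTimec (C n).K (π n)) ↔
        Tendsto (fun n => BDCutoff.theta (C n) (M n) * BDCutoff.spectralGap (C n).K)
          atTop atTop) ∧
      (Tendsto (fun n => BDCutoff.theta (C n) (M n) * BDCutoff.spectralGap (C n).K)
          atTop atTop ↔
        Tendsto (fun n => BDCutoff.theta (C n) (M n) / BDCutoff.alpha (C n) (M n))
          atTop atTop) ∧
      (BDCutoff.HasCutoffc (fun n => BDCutoff.mixTimec (C n).K (π n)) →
        BDCutoff.HasWindow (fun n => BDCutoff.mixTimec (C n).K (π n))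
          (fun n => BDCutoff.theta (C n) (M n)) (fun n => BDCutoff.alpha (C n) (M n)))) ∧
    -- discrete time
    ((∃ δ : ℝ, 0 < δ ∧ ∀ n, 1 ≤ n → ∀ i, δ ≤ (C n).K i i) →
      (BDCutoff.HasCutoff (fun n => BDCutoff.mixTime (C n).K (π n)) ↔
        Tendsto (fun n => BDCutoff.theta (C n) (M n) * BDCutoff.spectralGap (C n).K)
          atTop atTop) ∧
      (Tendsto (fun n => BDCutoff.theta (C n) (M n) * BDCutoff.spectralGap (C n).K)
          atTop atTop ↔
        Tendsto (fun n => BDCutoff.theta (C n) (M n) / BDCutoff.beta (C n) (M n))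
          atTop atTop) ∧
      (BDCutoff.HasCutoff (fun n => BDCutoff.mixTime (C n).K (π n)) →
        BDCutoff.HasWindow (fun n ε => (BDCutoff.mixTime (C n).K (π n) ε : ℝ))
          (fun n => BDCutoff.theta (C n) (M n)) (fun n => BDCutoff.beta (C n) (M n)))) := by
  obtain ⟨c₁, hc₁, hL⟩ := hleft
  obtain ⟨c₂, hc₂, hR⟩ := hright
  set c := min c₁ c₂ with hc_def
  have hc : 0 < c := lt_min hc₁ hc₂
  have hbd : ∀ n, 1 ≤ n → BDCutoff.IsBD (C n).K (π n) := fun n hn => (C n).isBD (hπ n hn)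
  have hL' : ∀ n, 1 ≤ n → c ≤ BDCutoff.cum (π n) (M n) := fun n hn => by
    rw [BDCutoff.cum_eq_sum_Iic]; exact (min_le_left _ _).trans (hL n hn)
  have hR' : ∀ n, 1 ≤ n → c ≤ BDCutoff.tailWt (π n) (M n) := fun n hn => by
    rw [BDCutoff.tailWt_eq_sum_Ici]; exact (min_le_right _ _).trans (hR n hn)
  have hθ : ∀ n, 1 ≤ n → BDCutoff.theta (C n) (M n) = BDCutoff.hitMean (C n).K (π n) (M n) :=
    fun n hn => (BDCutoff.hitting_times (hbd n hn) (M n)).2.2.1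
  have hα : ∀ n, 1 ≤ n → BDCutoff.alpha (C n) (M n) = √(BDCutoff.hitVar (C n).K (π n) (M n)) :=
    fun n hn => (BDCutoff.hitting_times (hbd n hn) (M n)).2.2.2.2.1
  have hβ : ∀ n, 1 ≤ n → BDCutoff.beta (C n) (M n) = √(BDCutoff.stepVar (C n).K (π n) (M n)) :=
    fun n hn => (BDCutoff.hitting_times (hbd n hn) (M n)).2.2.2.2.2
  have hdata : ∀ (S : ℕ → ℝ → ℝ) (b : ℕ → ℝ) (ρ : ℝ), 0 < ρ →
      (∀ n, 1 ≤ n → b n ≤ BDCutoff.alpha (C n) (M n)) →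
      (∀ n, 1 ≤ n → ρ * BDCutoff.alpha (C n) (M n) ≤ b n) →
      (∀ ε ∈ Set.Ioo (0 : ℝ) 1, ∃ D : ℝ, ∀ n, 1 ≤ n →
        |S n ε - BDCutoff.hitMean (C n).K (π n) (M n)| ≤
            D * √(BDCutoff.hitVar (C n).K (π n) (M n)) ∧
          (Real.log (1 / (2 * ε)) ≤ 2 * (BDCutoff.spectralGap (C n).K * S n ε) ∨
            1 / 2 ≤ BDCutoff.spectralGap (C n).K)) →
      BDCutoff.CutoffData S (fun n => BDCutoff.theta (C n) (M n))
        (fun n => BDCutoff.alpha (C n) (M n)) (fun n => BDCutoff.spectralGap (C n).K) b c ρ := by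
    intro S b ρ hρ hb1 hb2 hS
    refine ⟨hc, hρ, fun n hn => ((hbd n hn).poincare_spectralGap hn).1, fun n hn => ?_,
      fun n hn => ?_, fun n hn => ?_, fun n hn => ?_, hb1, hb2, fun ε hε => ?_, fun ε hε n hn => ?_⟩
    · rw [hα n hn]; exact (hbd n hn).one_le_sqrt_hitVar hn
    · rw [hθ n hn]; exact (hbd n hn).half_le_hitMean
    · rw [hα n hn]; exact (hbd n hn).one_le_spectralGap_mul hn
    · obtain ⟨hlam, hP, -⟩ := (hbd n hn).poincare_spectralGap hn
      rw [hα n hn, hθ n hn, (hbd n hn).sq_sqrt_hitVar]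
      exact (hbd n hn).mul_hitVar_le hc hlam hP (hL' n hn) (hR' n hn)
    · obtain ⟨D, hD⟩ := hS ε hε
      exact ⟨D, fun n hn => by rw [hα n hn, hθ n hn]; exact (hD n hn).1⟩
    · obtain ⟨D, hD⟩ := hS ε hε
      exact (hD n hn).2
  refine ⟨fun n hn => ?_, ?_, ?_⟩
  · obtain ⟨r1, r2, t1, t2, -, -⟩ := BDCutoff.hitting_times (hbd n hn) (M n)
    exact ⟨r1, r2, t1.trans t2.symm⟩
  · have H := hdata (fun n => BDCutoff.mixTimec (C n).K (π n)) _ 1 one_pos (fun n _ => le_rfl)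
      (fun n _ => (one_mul _).le) fun ε hε => by
        obtain ⟨D, hD⟩ := BDCutoff.abs_mixTimec_sub_le hc hε
        exact ⟨D, fun n hn => (hD (hbd n hn) hn (hL' n hn) (hR' n hn)).imp_right Or.inl⟩
    exact ⟨H.hasCutoffc_iff, H.tendsto_mul_gap_iff, H.hasWindow_of_hasCutoffc⟩
  · rintro ⟨δ, hδ0, hδ⟩
    -- The scale stays α and the window is β; the ratio √δ reflects δα² ≤ β² ≤ α².
    have H := hdata (fun n ε => (BDCutoff.mixTime (C n).K (π n) ε : ℝ))
      (fun n => BDCutoff.beta (C n) (M n)) (√δ) (Real.sqrt_pos.2 hδ0)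
      (fun n hn => by
        rw [hα n hn, hβ n hn]
        exact Real.sqrt_le_sqrt ((hbd n hn).stepVar_le (M n)))
      (fun n hn => by
        rw [hα n hn, hβ n hn, ← Real.sqrt_mul hδ0.le]
        exact Real.sqrt_le_sqrt ((hbd n hn).mul_hitVar_le_stepVar hδ0.le (hδ n hn) (M n)))
      fun ε hε => by
        obtain ⟨D, hD⟩ := BDCutoff.abs_mixTime_sub_le hc hδ0 hε
        exact ⟨D, fun n hn => hD (hbd n hn) hn (hδ n hn) (hL' n hn) (hR' n hn)⟩
    exact ⟨H.hasCutoff_iff_hasCutoffc.trans H.hasCutoffc_iff, H.tendsto_mul_gap_iff,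
      fun h => H.hasWindow_of_hasCutoffc (H.hasCutoff_iff_hasCutoffc.1 h)⟩
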